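/- Let $p>1$ and let $\alpha_0,\alpha_1,\theta$ be real numbers with $\alpha_1-p+1>0$, $\alpha_0\ge\alpha_1-p$ and $\theta>\alpha_1-p$. For $\gamma>-1$ let $L^p_\gamma$ be the $L^p$ space on $(0,1)$ with respect to the measure $r^\gamma\,dr$. Let $X^{1,p}_1(\alpha_0,\alpha_1)$ be the closure of the set of locally absolutely continuous functions $u$ on $(0,1)$ with $\lim_{r\to1^-}u(r)=0$, $u\in L^p_{\alpha_0}$ and $u'\in L^p_{\alpha_1}$, with respect to the norm $\big(\|u\|_{L^p_{\alpha_0}}^p+\|u'\|_{L^p_{\alpha_1}}^p\big)^{1/p}$, and write $\|u\|=\|u'\|_{L^p_{\alpha_1}}$. Let $p^*=\frac{(\theta+1)p}{\alpha_1-p+1}$ and, for $\tau>0$ and $\beta>0$, let $$\mathcal F_{\tau,\beta,\theta}=\sup\Big\{\int_0^1 r^\theta|u|^{p^*}\,\big|\ln(\tau+|u|)\big|^{r^\beta}\,dr\;:\;u\in X^{1,p}_1(\alpha_0,\alpha_1),\ \|u\|=1\Big\}.$$ If $\tau\ge1$ and $0<\beta<\min\{(\theta+1)/p,\ (\alpha_1-p+1)/(p-1)\}$,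 then $\mathcal F_{\tau,\beta,\theta}$ is finite and the supremum is attained: there is $u\in X^{1,p}_1(\alpha_0,\alpha_1)$ with $\|u\|=1$ and $\int_0^1 r^\theta|u|^{p^*}|\ln(\tau+|u|)|^{r^\beta}\,dr=\mathcal F_{\tau,\beta,\theta}$. -/

import Mathlib

open MeasureTheory Set Filter Topology
open scoped ENNReal

noncomputable section

/-- The measure `r ^ α dr` on the interval `(0, 1)`. The space `L^q_α` of the theory is the
`L^q` space of this measure. -/
def weightMeasure (α : ℝ) : Measure ℝ :=
  (volume.restrict (Ioo (0 : ℝ) 1)).withDensity fun r => ENNReal.ofReal (r ^ α)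

/-- `u ∈ AC_loc(0, 1)`: `u` is absolutely continuous on every compact subinterval of `(0, 1)`. -/
def LocallyAC (u : ℝ → ℝ) : Prop :=
  ∀ a b : ℝ, 0 < a → a ≤ b → b < 1 → AbsolutelyContinuousOnInterval u a b

/-- The set of functions whose closure is `X^{1,p}_1(α₀, α₁)`: locally absolutely continuous
functions on `(0, 1)` which vanish in the limit at `1`, with `u ∈ L^p_{α₀}` and `u' ∈ L^p_{α₁}`.
(The classical derivative of such a function exists almost everywhere on `(0, 1)`.) -/
structure IsCoreX (p α₀ α₁ : ℝ) (u : ℝ → ℝ) : Prop where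
  locallyAC : LocallyAC u
  tendsto_one : Tendsto u (𝓝[<] 1) (𝓝 0)
  memLp : MemLp u (ENNReal.ofReal p) (weightMeasure α₀)
  memLp_deriv : MemLp (deriv u) (ENNReal.ofReal p) (weightMeasure α₁)

/-- The norm `(‖u‖_{L^p_{α₀}}^p + ‖v‖_{L^p_{α₁}}^p)^{1/p}` of a function `u` with derivative `v`. -/
def normX (p α₀ α₁ : ℝ) (u v : ℝ → ℝ) : ℝ≥0∞ :=
  (eLpNorm u (ENNReal.ofReal p) (weightMeasure α₀) ^ p +
    eLpNorm v (ENNReal.ofReal p) (weightMeasure α₁) ^ p) ^ (1 / p)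

/-- The weighted Sobolev space `X^{1,p}_1(α₀, α₁)`, the closure of the functions `IsCoreX` in the
norm `normX`. An element is a function `u ∈ L^p_{α₀}` together with its derivative
`u' ∈ L^p_{α₁}`, such that `(u, u')` is a limit in the norm of pairs `(w, w')` with `w` in the
core. Elements are not identified when they agree almost everywhere; nothing below depends on
the choice of representatives. -/
structure SpaceX (p α₀ α₁ : ℝ) where
  /-- the function `u` -/
  fn : ℝ → ℝ
  /-- its derivative `u'` -/
  grad : ℝ → ℝ
  memLp_fn : MemLp fn (ENNReal.ofReal p) (weightMeasure α₀)
  memLp_grad : MemLp grad (ENNReal.ofReal p) (weightMeasure α₁)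
  mem_closure : ∀ ε : ℝ≥0∞, 0 < ε →
    ∃ w : ℝ → ℝ, IsCoreX p α₀ α₁ w ∧ normX p α₀ α₁ (fn - w) (grad - deriv w) < ε

/-- The gradient norm `‖u‖ = ‖u'‖_{L^p_{α₁}}`. -/
def SpaceX.gradNorm {p α₀ α₁ : ℝ} (u : SpaceX p α₀ α₁) : ℝ≥0∞ :=
  eLpNorm u.grad (ENNReal.ofReal p) (weightMeasure α₁)

/-- The critical exponent `p* = (θ + 1) p / (α₁ - p + 1)`. -/
def critExp (p α₁ θ : ℝ) : ℝ := (θ + 1) * p / (α₁ - p + 1)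

/-- The functional `∫₀¹ r^θ |u|^{p*} |ln(τ + |u|)|^{r^β} dr`, with values in `[0, ∞]`. -/
def logFunctional {p α₀ α₁ : ℝ} (θ τ β : ℝ) (u : SpaceX p α₀ α₁) : ℝ≥0∞ :=
  ∫⁻ r in Ioo (0 : ℝ) 1, ENNReal.ofReal
    (r ^ θ * |u.fn r| ^ critExp p α₁ θ * |Real.log (τ + |u.fn r|)| ^ (r ^ β))

/-- The supremum `F_{τ,β,θ}` of the functional over the unit sphere of the gradient norm. -/
def logSup (p α₀ α₁ θ τ β : ℝ) : ℝ≥0∞ :=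
  ⨆ (u : SpaceX p α₀ α₁) (_ : u.gradNorm = 1), logFunctional θ τ β u

end

/-!
Up to sign and almost everywhere, an element of `X^{1,p}_1(α₀, α₁)` is the primitive
`tail g r = ∫_r^1 g` of its derivative, and replacing `g` by `|g|` keeps the norm and does not
decrease the functional. The problem is thus to maximize `logIntegral` over nonnegative measurable
`g` with `energyOn p α₁ g (0, 1) = 1` (`logSup_eq_profileSup`). The parameters used throughout are
`κ = (α₁ - p + 1) / (p - 1)` and `b = (θ - α₁ + p) / (p - 1)`, both positive, so that
`α₁ = (κ + 1) (p - 1)`, `θ + 1 = (b + κ) (p - 1)` and `p* = (b + κ) p / κ`.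

Since `|u(r)| ≤ C r ^ (-(α₁ - p + 1) / p)` on the unit sphere, the weight `|ln(τ + |u|)| ^ (r ^ β)`
is at most `1 + δ` near the origin (`exists_log_weight_le`) and bounded elsewhere, so the supremum
is finite (`profileSup_lt_top`) and a maximizing sequence can lose compactness only by concentrating
at the origin, where the functional behaves like `∫ r ^ θ |u| ^ p*`.

The sharp constant `Σ` of the inequality `∫ r ^ θ |u| ^ p* ≤ Σ E ^ (p* / p)`, with `E` the energy,
is due to Bliss (`bliss_inequality`). It is proved here by transporting the normalized density
`r ^ θ |u| ^ p*` to the density of the extremal `U(T) = (1 + T ^ b) ^ (-κ / b)`: Young's inequality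
and the weighted arithmetic-geometric mean inequality, both sharp at the extremal, bound the energy
from below by an integral whose integrand is a derivative in the transport variable.

Truncated extremals of scale `ε` reach `Σ` up to a loss of order `ε ^ κ` and a tail of order
`S ^ (-(b + κ))`, where the cut-off `S = ε ^ (-σ)` can be taken with any `σ < (p - 1) / p`, while
the logarithm gains a multiple of `ε ^ β`. As `β < κ` and `β < (b + κ) (p - 1) / p`, which are the
two conditions on `β`, the supremum `F` satisfies `Σ < F` (`exists_lt_logIntegral`).

Along a maximizing sequence the primitives converge pointwise, and their limit is dominated by the
primitive of some `G ≥ 0` with energy `E ≤ 1` (`exists_subseq_tendsto_tail`,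
`exists_limit_profile`). Splitting the integral close to the origin yields
`F ≤ Σ (1 - E) ^ x + logIntegral G` with `x = p* / p > 1` (`limit_le_logIntegral_add`). By scaling,
`logIntegral G ≤ E ^ x F`, so that `E < 1` would give `F ≤ Σ (1 - E) + F E < F`. Hence `E = 1`, and
`G` is a maximizer.
-/

noncomputable section

/-! ### Energies and pointwise bounds for primitives -/

/-- The energy `∫_S r ^ a |g| ^ p dr` of a derivative `g` on a set `S`. -/
def energyOn (p a : ℝ) (g : ℝ → ℝ) (S : Set ℝ) : ℝ≥0∞ :=
  ∫⁻ r in S, ENNReal.ofReal (r ^ a * |g r| ^ p)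

/-- The primitive `r ↦ ∫_r^1 g` vanishing at `1`; its derivative is `-g`. -/
def tail (g : ℝ → ℝ) (r : ℝ) : ℝ := ∫ s in Ioo r 1, g s

lemma energyOn_mono (p a : ℝ) (g : ℝ → ℝ) {S T : Set ℝ} (h : S ⊆ T) :
    energyOn p a g S ≤ energyOn p a g T :=
  lintegral_mono_set h

lemma aemeasurable_Ioo_right {g : ℝ → ℝ}
    (hg : AEMeasurable g (volume.restrict (Ioo (0 : ℝ) 1))) {r : ℝ} (hr : 0 ≤ r) :
    AEMeasurable g (volume.restrict (Ioo r 1)) :=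
  hg.mono_measure (Measure.restrict_mono (Ioo_subset_Ioo_left hr) le_rfl)

lemma lintegral_Ioi_rpow {c r : ℝ} (hc : c < -1) (hr : 0 < r) :
    ∫⁻ s in Ioi r, ENNReal.ofReal (s ^ c) = ENNReal.ofReal (r ^ (c + 1) / (-(c + 1))) := by
  rw [← ofReal_integral_eq_lintegral_ofReal (integrableOn_Ioi_rpow_of_lt hc hr),
    integral_Ioi_rpow_of_lt hc hr]
  · rw [neg_div, div_neg]
  · exact (ae_restrict_iff' measurableSet_Ioi).2
      (.of_forall fun s hs => Real.rpow_nonneg (hr.trans hs).le _)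

lemma lintegral_Ioo_rpow {c r : ℝ} (hc : -1 < c) (hr : 0 ≤ r) :
    ∫⁻ s in Ioo 0 r, ENNReal.ofReal (s ^ c) = ENNReal.ofReal (r ^ (c + 1) / (c + 1)) := by
  have hi : IntervalIntegrable (fun s : ℝ => s ^ c) volume 0 r :=
    intervalIntegral.intervalIntegrable_rpow' hc
  rw [← ofReal_integral_eq_lintegral_ofReal]
  · rw [← integral_Ioc_eq_integral_Ioo, ← intervalIntegral.integral_of_le hr,
      integral_rpow (Or.inl hc), Real.zero_rpow (by linarith), sub_zero]
  · exact ((intervalIntegrable_iff_integrableOn_Ioc_of_le hr).1 hi).mono_set Ioo_subset_Ioc_self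
  · exact (ae_restrict_iff' measurableSet_Ioo).2
      (.of_forall fun s hs => Real.rpow_nonneg hs.1.le _)

/-- The constant of the pointwise bound `|u(r)| ≤ C r ^ (-k / p) E ^ (1 / p)`, `k = a - p + 1`. -/
def tailConst (p a : ℝ) : ℝ := ((p - 1) / (a - p + 1)) ^ ((p - 1) / p)

lemma tailConst_pos {p a : ℝ} (hp : 1 < p) (ha : p - 1 < a) : 0 < tailConst p a :=
  Real.rpow_pos_of_pos (div_pos (by linarith) (by linarith)) _

/-- Hölder's inequality against the weight `s ^ σ`, which is the source of all pointwise bounds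
on primitives. -/
lemma lintegral_tail_le {p σ : ℝ} (hp : 1 < p) (hσ : p - 1 < σ) {g : ℝ → ℝ}
    (hg : AEMeasurable g (volume.restrict (Ioo (0 : ℝ) 1))) {r : ℝ} (hr : 0 < r) :
    ∫⁻ s in Ioo r 1, ENNReal.ofReal |g s| ≤
      ENNReal.ofReal (tailConst p σ * r ^ (-((σ - p + 1) / p))) *
        energyOn p σ g (Ioo r 1) ^ (1 / p) := by
  have hp0 : 0 < p := by linarith
  have hp1 : 0 < p - 1 := by linarith
  have hk : 0 < σ - p + 1 := by linarith
  have hpq : p.HolderConjugate (p / (p - 1)) := Real.HolderConjugate.conjExponent hp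
  have hgm := aemeasurable_Ioo_right hg hr.le
  have h1 : ∫⁻ s in Ioo r 1, ENNReal.ofReal |g s| =
      ∫⁻ s in Ioo r 1, ((fun s => ENNReal.ofReal (s ^ (σ / p) * |g s|)) *
        fun s => ENNReal.ofReal (s ^ (-(σ / p)))) s := by
    refine setLIntegral_congr_fun measurableSet_Ioo fun s hs => ?_
    have hs0 : 0 < s := hr.trans hs.1
    simp only [Pi.mul_apply]
    rw [← ENNReal.ofReal_mul (by positivity), mul_right_comm, ← Real.rpow_add hs0]
    simp
  rw [h1]
  have hm1 : AEMeasurable (fun s : ℝ => ENNReal.ofReal (s ^ (σ / p) * |g s|))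
      (volume.restrict (Ioo r 1)) := by
    have : AEMeasurable (fun s => |g s|) (volume.restrict (Ioo r 1)) := hgm.norm
    exact ((by fun_prop : Measurable fun s : ℝ => s ^ (σ / p)).aemeasurable.mul this).ennreal_ofReal
  refine (ENNReal.lintegral_mul_le_Lp_mul_Lq _ hpq hm1 (by fun_prop)).trans ?_
  rw [mul_comm]
  gcongr ?_ * ?_
  · have h2 : ∫⁻ s in Ioo r 1, ENNReal.ofReal (s ^ (-(σ / p))) ^ (p / (p - 1)) ≤
        ENNReal.ofReal ((p - 1) / (σ - p + 1) * r ^ (-((σ - p + 1) / (p - 1)))) := by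
      have hc : -(σ / (p - 1)) < -1 := by
        rw [neg_lt_neg_iff, lt_div_iff₀ hp1]; linarith
      calc _ = ∫⁻ s in Ioo r 1, ENNReal.ofReal (s ^ (-(σ / (p - 1)))) := by
            refine setLIntegral_congr_fun measurableSet_Ioo fun s hs => ?_
            have hs0 : 0 < s := hr.trans hs.1
            rw [ENNReal.ofReal_rpow_of_nonneg (by positivity) (by positivity), ← Real.rpow_mul hs0.le]
            congr 2; field_simp
        _ ≤ ∫⁻ s in Ioi r, ENNReal.ofReal (s ^ (-(σ / (p - 1)))) :=
            lintegral_mono_set Ioo_subset_Ioi_self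
        _ = _ := by
            rw [lintegral_Ioi_rpow hc hr]
            have e1 : -(σ / (p - 1)) + 1 = -((σ - p + 1) / (p - 1)) := by field_simp; ring
            rw [e1, neg_neg]; congr 1; field_simp
    refine (ENNReal.rpow_le_rpow h2 (by positivity)).trans (le_of_eq ?_)
    rw [ENNReal.ofReal_rpow_of_nonneg (by positivity) (by positivity),
      Real.mul_rpow (by positivity) (by positivity), ← Real.rpow_mul hr.le]
    congr 3
    · field_simp
    · field_simp
  · refine le_of_eq ?_
    congr 1
    refine setLIntegral_congr_fun measurableSet_Ioo fun s hs => ?_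
    have hs0 : 0 < s := hr.trans hs.1
    rw [ENNReal.ofReal_rpow_of_nonneg (by positivity) (by positivity),
      Real.mul_rpow (by positivity) (by positivity), ← Real.rpow_mul hs0.le]
    congr 3; field_simp

lemma integrableOn_of_energyOn_lt_top {p a : ℝ} (hp : 1 < p) (ha : p - 1 < a) {g : ℝ → ℝ}
    (hg : AEMeasurable g (volume.restrict (Ioo (0 : ℝ) 1))) (hE : energyOn p a g (Ioo 0 1) < ∞)
    {r : ℝ} (hr : 0 < r) : IntegrableOn g (Ioo r 1) := by
  refine ⟨(aemeasurable_Ioo_right hg hr.le).aestronglyMeasurable, ?_⟩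
  rw [hasFiniteIntegral_iff_norm]
  refine (lintegral_tail_le hp ha hg hr).trans_lt (ENNReal.mul_lt_top ENNReal.ofReal_lt_top ?_)
  exact ENNReal.rpow_lt_top_of_nonneg (by positivity)
    ((energyOn_mono p a g (Ioo_subset_Ioo_left hr.le)).trans_lt hE).ne

lemma ofReal_abs_tail_le {g : ℝ → ℝ} (r : ℝ) :
    ENNReal.ofReal |tail g r| ≤ ∫⁻ s in Ioo r 1, ENNReal.ofReal |g s| := by
  have := enorm_integral_le_lintegral_enorm (μ := volume.restrict (Ioo r 1)) g
  simpa only [Real.enorm_eq_ofReal_abs, tail] using this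

lemma tail_nonneg {g : ℝ → ℝ} (hg0 : ∀ s, 0 ≤ g s) (r : ℝ) : 0 ≤ tail g r :=
  integral_nonneg hg0

lemma abs_tail_le {p a : ℝ} (hp : 1 < p) (ha : p - 1 < a) {g : ℝ → ℝ}
    (hg : AEMeasurable g (volume.restrict (Ioo (0 : ℝ) 1))) {r e : ℝ} (hr : 0 < r) (he : 0 ≤ e)
    (hE : energyOn p a g (Ioo r 1) ≤ ENNReal.ofReal e) :
    |tail g r| ≤ tailConst p a * r ^ (-((a - p + 1) / p)) * e ^ (1 / p) := by
  have hC := tailConst_pos hp ha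
  have h := (ofReal_abs_tail_le r).trans (lintegral_tail_le hp ha hg hr)
  have h2 : ENNReal.ofReal |tail g r| ≤
      ENNReal.ofReal (tailConst p a * r ^ (-((a - p + 1) / p)) * e ^ (1 / p)) := by
    refine h.trans ?_
    rw [ENNReal.ofReal_mul (p := tailConst p a * _) (by positivity),
      ← ENNReal.ofReal_rpow_of_nonneg he (by positivity)]
    gcongr
  exact (ENNReal.ofReal_le_ofReal_iff (by positivity)).1 h2

/-- Hardy's inequality, with an unspecified constant: Hölder's inequality with a weight `s ^ σ`,
`p - 1 < σ < a`, followed by Tonelli's theorem. -/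
lemma exists_hardy {p a : ℝ} (hp : 1 < p) (ha : p - 1 < a) :
    ∃ C : ℝ, ∀ g : ℝ → ℝ, AEMeasurable g (volume.restrict (Ioo (0 : ℝ) 1)) →
      ∫⁻ r in Ioo (0 : ℝ) 1, ENNReal.ofReal (r ^ (a - p) * |tail g r| ^ p) ≤
        ENNReal.ofReal C * energyOn p a g (Ioo 0 1) := by
  set σ := (p - 1 + a) / 2 with hσ
  have hσ1 : p - 1 < σ := by rw [hσ]; linarith
  have hσ2 : σ < a := by rw [hσ]; linarith
  have hp0 : 0 < p := by linarith
  set K := tailConst p σ with hK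
  have hKpos : 0 < K := tailConst_pos hp hσ1
  refine ⟨K ^ p / (a - σ), fun g hg => ?_⟩
  have hgm : AEMeasurable (fun s : ℝ => ENNReal.ofReal (s ^ σ * |g s| ^ p))
      (volume.restrict (Ioo (0 : ℝ) 1)) := by
    have : AEMeasurable (fun s => |g s| ^ p) (volume.restrict (Ioo (0 : ℝ) 1)) :=
      hg.norm.pow_const p
    exact ((by fun_prop : Measurable fun s : ℝ => s ^ σ).aemeasurable.mul this).ennreal_ofReal
  have step : ∀ r ∈ Ioo (0 : ℝ) 1, ENNReal.ofReal (r ^ (a - p) * |tail g r| ^ p) ≤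
      ENNReal.ofReal (K ^ p * r ^ (a - σ - 1)) *
        ∫⁻ s in Ioo (0 : ℝ) 1, (Ioi r).indicator (fun s => ENNReal.ofReal (s ^ σ * |g s| ^ p)) s := by
    intro r hr
    have hr0 : 0 < r := hr.1
    have h := (ofReal_abs_tail_le r).trans (lintegral_tail_le hp hσ1 hg hr0)
    have h2 := ENNReal.rpow_le_rpow h hp0.le
    rw [ENNReal.mul_rpow_of_nonneg _ _ hp0.le, ← ENNReal.rpow_mul, one_div_mul_cancel hp0.ne',
      ENNReal.rpow_one, ENNReal.ofReal_rpow_of_nonneg (abs_nonneg _) hp0.le,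
      ENNReal.ofReal_rpow_of_nonneg (mul_nonneg hKpos.le (by positivity)) hp0.le,
      Real.mul_rpow hKpos.le (by positivity), ← Real.rpow_mul hr0.le] at h2
    have e3 : energyOn p σ g (Ioo r 1) = ∫⁻ s in Ioo (0 : ℝ) 1,
        (Ioi r).indicator (fun s => ENNReal.ofReal (s ^ σ * |g s| ^ p)) s := by
      rw [lintegral_indicator measurableSet_Ioi, Measure.restrict_restrict measurableSet_Ioi]
      unfold energyOn
      congr 2; ext x; simp only [mem_inter_iff, mem_Ioi, mem_Ioo]
      constructor
      · exact fun h => ⟨h.1, hr0.trans h.1, h.2⟩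
      · exact fun h => ⟨h.1, h.2.2⟩
    rw [← e3, ENNReal.ofReal_mul (by positivity)]
    refine (mul_le_mul_right h2 _).trans (le_of_eq ?_)
    rw [← mul_assoc, ← ENNReal.ofReal_mul (by positivity)]
    congr 2
    rw [mul_left_comm, ← Real.rpow_add hr0]
    congr 2; field_simp; ring
  refine (setLIntegral_mono' measurableSet_Ioo step).trans ?_
  have hmi : AEMeasurable (fun x : ℝ × ℝ => ENNReal.ofReal (K ^ p * x.1 ^ (a - σ - 1)) *
      (Ioi x.1).indicator (fun s => ENNReal.ofReal (s ^ σ * |g s| ^ p)) x.2)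
      ((volume.restrict (Ioo (0 : ℝ) 1)).prod (volume.restrict (Ioo (0 : ℝ) 1))) := by
    refine AEMeasurable.mul (by fun_prop) ?_
    have : (fun x : ℝ × ℝ => (Ioi x.1).indicator (fun s => ENNReal.ofReal (s ^ σ * |g s| ^ p)) x.2)
        = {x : ℝ × ℝ | x.1 < x.2}.indicator (fun x => ENNReal.ofReal (x.2 ^ σ * |g x.2| ^ p)) := by
      ext x; simp [indicator]
    rw [this]
    refine AEMeasurable.indicator ?_ (measurableSet_lt measurable_fst measurable_snd)
    exact hgm.comp_quasiMeasurePreserving Measure.quasiMeasurePreserving_snd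
  have hmr : ∀ r : ℝ, AEMeasurable
      ((Ioi r).indicator fun s : ℝ => ENNReal.ofReal (s ^ σ * |g s| ^ p))
      (volume.restrict (Ioo (0 : ℝ) 1)) := fun r => hgm.indicator measurableSet_Ioi
  refine le_of_eq ?_
  calc _ = ∫⁻ r in Ioo (0 : ℝ) 1, ∫⁻ s in Ioo (0 : ℝ) 1, ENNReal.ofReal (K ^ p * r ^ (a - σ - 1)) *
        (Ioi r).indicator (fun s => ENNReal.ofReal (s ^ σ * |g s| ^ p)) s := by
        refine lintegral_congr fun r => ?_
        rw [lintegral_const_mul'' _ (hmr r)]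
    _ = ∫⁻ s in Ioo (0 : ℝ) 1, ∫⁻ r in Ioo (0 : ℝ) 1, ENNReal.ofReal (K ^ p * r ^ (a - σ - 1)) *
        (Ioi r).indicator (fun s => ENNReal.ofReal (s ^ σ * |g s| ^ p)) s :=
        lintegral_lintegral_swap hmi
    _ = ∫⁻ s in Ioo (0 : ℝ) 1, ENNReal.ofReal (K ^ p / (a - σ)) *
          ENNReal.ofReal (s ^ a * |g s| ^ p) := by
        refine setLIntegral_congr_fun measurableSet_Ioo fun s hs => ?_
        have hs0 : 0 < s := hs.1
        have : ∀ r : ℝ, ENNReal.ofReal (K ^ p * r ^ (a - σ - 1)) *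
            (Ioi r).indicator (fun s => ENNReal.ofReal (s ^ σ * |g s| ^ p)) s =
            (Iio s).indicator (fun r => ENNReal.ofReal (K ^ p * (s ^ σ * |g s| ^ p)) *
              ENNReal.ofReal (r ^ (a - σ - 1))) r := by
          intro r
          by_cases h : r < s
          · simp only [indicator, mem_Ioi, h, if_true, mem_Iio]
            rw [← ENNReal.ofReal_mul' (by positivity), ← ENNReal.ofReal_mul (by positivity)]
            congr 1; ring
          · simp [indicator, h]
        simp only [this]
        rw [lintegral_indicator measurableSet_Iio, Measure.restrict_restrict measurableSet_Iio]
        have e4 : Iio s ∩ Ioo (0 : ℝ) 1 = Ioo 0 s := by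
          ext x; simp only [mem_inter_iff, mem_Iio, mem_Ioo]
          exact ⟨fun h => ⟨h.2.1, h.1⟩, fun h => ⟨h.2, h.1, h.2.trans hs.2⟩⟩
        rw [e4, lintegral_const_mul _ (by fun_prop), lintegral_Ioo_rpow (by linarith) hs0.le,
          ← ENNReal.ofReal_mul (by positivity), ← ENNReal.ofReal_mul
            (div_nonneg (by positivity) (by linarith))]
        congr 1
        have : s ^ a = s ^ σ * s ^ (a - σ - 1 + 1) := by rw [← Real.rpow_add hs0]; congr 1; ring
        rw [this]
        have h5 : a - σ ≠ 0 := by linarith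
        have h6 : a - σ - 1 + 1 = a - σ := by ring
        rw [h6]
        field_simp
    _ = ENNReal.ofReal (K ^ p / (a - σ)) * energyOn p a g (Ioo 0 1) :=
        lintegral_const_mul' _ _ ENNReal.ofReal_ne_top

/-! ### The space as a space of primitives -/

lemma measurable_weight (a : ℝ) : Measurable fun r : ℝ => ENNReal.ofReal (r ^ a) := by fun_prop

lemma ae_weightMeasure_iff {a : ℝ} {P : ℝ → Prop} :
    (∀ᵐ r ∂weightMeasure a, P r) ↔ ∀ᵐ r ∂volume.restrict (Ioo (0 : ℝ) 1), P r := by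
  unfold weightMeasure
  rw [ae_withDensity_iff (measurable_weight a)]
  constructor <;> intro h
  · filter_upwards [h, ae_restrict_mem measurableSet_Ioo] with r hr hm
    exact hr (by simpa using Real.rpow_pos_of_pos hm.1 a)
  · filter_upwards [h] with r hr _ using hr

lemma weightMeasure_absolutelyContinuous (a : ℝ) :
    weightMeasure a ≪ volume.restrict (Ioo (0 : ℝ) 1) :=
  Measure.ae_le_iff_absolutelyContinuous.1 fun _ h => ae_weightMeasure_iff.2 h

lemma absolutelyContinuous_weightMeasure (a : ℝ) :
    volume.restrict (Ioo (0 : ℝ) 1) ≪ weightMeasure a :=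
  Measure.ae_le_iff_absolutelyContinuous.1 fun _ h => ae_weightMeasure_iff.1 h

lemma aestronglyMeasurable_weightMeasure_iff {a : ℝ} {f : ℝ → ℝ} :
    AEStronglyMeasurable f (weightMeasure a) ↔ AEMeasurable f (volume.restrict (Ioo (0 : ℝ) 1)) :=
  ⟨fun h => (h.mono_ac (absolutelyContinuous_weightMeasure a)).aemeasurable,
    fun h => h.aestronglyMeasurable.mono_ac (weightMeasure_absolutelyContinuous a)⟩

lemma eLpNorm_rpow_eq_energyOn {p a : ℝ} (hp : 0 < p) (f : ℝ → ℝ) :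
    eLpNorm f (ENNReal.ofReal p) (weightMeasure a) ^ p = energyOn p a f (Ioo 0 1) := by
  rw [eLpNorm_eq_lintegral_rpow_enorm_toReal (by simpa using hp) ENNReal.ofReal_ne_top,
    ENNReal.toReal_ofReal hp.le, ← ENNReal.rpow_mul, one_div_mul_cancel hp.ne', ENNReal.rpow_one,
    weightMeasure, lintegral_withDensity_eq_lintegral_mul_non_measurable _ (measurable_weight a)
      (.of_forall fun r => ENNReal.ofReal_lt_top)]
  refine setLIntegral_congr_fun measurableSet_Ioo fun r hr => ?_
  have hr0 : 0 < r := hr.1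
  simp only [Pi.mul_apply]
  rw [Real.enorm_eq_ofReal_abs, ENNReal.ofReal_rpow_of_nonneg (abs_nonneg _) hp.le,
    ← ENNReal.ofReal_mul (by positivity)]

lemma memLp_weightMeasure_iff {p a : ℝ} (hp : 0 < p) {f : ℝ → ℝ} :
    MemLp f (ENNReal.ofReal p) (weightMeasure a) ↔
      AEMeasurable f (volume.restrict (Ioo (0 : ℝ) 1)) ∧ energyOn p a f (Ioo 0 1) < ∞ := by
  rw [MemLp, aestronglyMeasurable_weightMeasure_iff, ← eLpNorm_rpow_eq_energyOn hp,
    ENNReal.rpow_lt_top_iff_of_pos hp]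

lemma energyOn_congr_ae {p a : ℝ} {f g : ℝ → ℝ} {S : Set ℝ}
    (h : ∀ᵐ r ∂volume.restrict S, |f r| = |g r|) : energyOn p a f S = energyOn p a g S :=
  lintegral_congr_ae (by filter_upwards [h] with r hr; rw [hr])

lemma tail_eq_sub {g : ℝ → ℝ} {c r : ℝ} (hi : IntegrableOn g (Ioo c 1)) (hr : r ∈ Icc c 1) :
    tail g r = tail g c - ∫ s in c..r, g s := by
  have h1 : ∀ x ≤ 1, tail g x = ∫ s in x..1, g s := fun x hx => by
    rw [tail, ← integral_Ioc_eq_integral_Ioo, intervalIntegral.integral_of_le hx]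
  have hI : IntervalIntegrable g volume c 1 := by
    rw [intervalIntegrable_iff_integrableOn_Ioo_of_le (hr.1.trans hr.2)]; exact hi
  have h2 : IntervalIntegrable g volume c r :=
    hI.mono_set (by rw [uIcc_of_le hr.1, uIcc_of_le (hr.1.trans hr.2)]; exact Icc_subset_Icc_right hr.2)
  have h3 : IntervalIntegrable g volume r 1 :=
    hI.mono_set (by rw [uIcc_of_le hr.2, uIcc_of_le (hr.1.trans hr.2)]; exact Icc_subset_Icc_left hr.1)
  rw [h1 r hr.2, h1 c (hr.1.trans hr.2), ← intervalIntegral.integral_add_adjacent_intervals h2 h3]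
  ring

lemma intervalIntegrable_of_tail {g : ℝ → ℝ} (hi : ∀ r, 0 < r → IntegrableOn g (Ioo r 1)) {c d : ℝ}
    (hc : 0 < c) (hcd : c ≤ d) (hd : d ≤ 1) : IntervalIntegrable g volume c d := by
  rw [intervalIntegrable_iff_integrableOn_Ioo_of_le hcd]
  exact (hi c hc).mono_set (Ioo_subset_Ioo_right hd)

lemma continuousOn_tail {g : ℝ → ℝ} (hi : ∀ r, 0 < r → IntegrableOn g (Ioo r 1)) {c : ℝ}
    (hc : 0 < c) (hc1 : c ≤ 1) : ContinuousOn (tail g) (Icc c 1) := by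
  have h := intervalIntegral.continuousOn_primitive_interval (f := g) (μ := volume) (a := c) (b := 1)
    (by rw [uIcc_of_le hc1, integrableOn_Icc_iff_integrableOn_Ioo]; exact hi c hc)
  rw [uIcc_of_le hc1] at h
  exact (continuousOn_const.sub h).congr fun r hr => tail_eq_sub (hi c hc) hr

lemma tail_one (g : ℝ → ℝ) : tail g 1 = 0 := by simp [tail]

lemma tendsto_tail_one {g : ℝ → ℝ} (hi : ∀ r, 0 < r → IntegrableOn g (Ioo r 1)) :
    Tendsto (tail g) (𝓝[<] 1) (𝓝 0) := by
  have h := continuousOn_tail hi (c := 1 / 2) (by norm_num) (by norm_num) 1 (by norm_num)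
  rw [ContinuousWithinAt, tail_one] at h
  refine h.mono_left ?_
  rw [← nhdsWithin_Ioo_eq_nhdsLT (by norm_num : (1 / 2 : ℝ) < 1)]
  exact nhdsWithin_mono _ Ioo_subset_Icc_self

lemma locallyAC_tail {g : ℝ → ℝ} (hi : ∀ r, 0 < r → IntegrableOn g (Ioo r 1)) :
    LocallyAC (tail g) := by
  intro c d hc hcd hd
  have h := (intervalIntegrable_of_tail hi hc hcd hd.le).absolutelyContinuousOnInterval_intervalIntegral
    (c := c) (by simp)
  have h2 : AbsolutelyContinuousOnInterval (fun _ : ℝ => tail g c) c d := by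
    simpa [AbsolutelyContinuousOnInterval] using tendsto_const_nhds
  have h3 := h2.sub h
  rw [absolutelyContinuousOnInterval_iff] at h3 ⊢
  intro ε hε
  obtain ⟨δ, hδ, H⟩ := h3 ε hε
  refine ⟨δ, hδ, fun E hE hEd => lt_of_eq_of_lt (Finset.sum_congr rfl fun i hi' => ?_) (H E hE hEd)⟩
  have hm := hE.1 i hi'
  rw [uIcc_of_le hcd] at hm
  have hle : Icc c d ⊆ Icc c 1 := Icc_subset_Icc_right hd.le
  rw [tail_eq_sub (hi c hc) (hle hm.1), tail_eq_sub (hi c hc) (hle hm.2)]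
  rfl

lemma ae_hasDerivAt_tail {g : ℝ → ℝ} (hi : ∀ r, 0 < r → IntegrableOn g (Ioo r 1)) :
    ∀ᵐ r ∂volume.restrict (Ioo (0 : ℝ) 1), HasDerivAt (tail g) (-g r) r := by
  have h : ∀ n : ℕ, ∀ᵐ r : ℝ, r ∈ uIcc (1 / ((n : ℝ) + 1)) 1 → ∀ c ∈ uIcc (1 / ((n : ℝ) + 1)) 1,
      HasDerivAt (fun x => ∫ t in c..x, g t) (g r) r := fun n =>
    (intervalIntegrable_of_tail hi (by positivity)
      (by rw [div_le_one (by positivity)]; simp) le_rfl).ae_hasDerivAt_integral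
  rw [ae_restrict_iff' measurableSet_Ioo]
  filter_upwards [ae_all_iff.2 h] with r hr hm
  obtain ⟨n, hn⟩ := exists_nat_one_div_lt hm.1
  have hle : 1 / ((n : ℝ) + 1) ≤ 1 := by rw [div_le_one (by positivity)]; simp
  have h1 := hr n (by rw [uIcc_of_le hle]; exact ⟨hn.le, hm.2.le⟩) _ left_mem_uIcc
  have h2 := h1.const_sub (tail g (1 / ((n : ℝ) + 1)))
  refine h2.congr_of_eventuallyEq ?_
  filter_upwards [Ioo_mem_nhds hn hm.2] with x hx
  exact tail_eq_sub (hi _ (by positivity)) ⟨hx.1.le, hx.2.le⟩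

lemma energyOn_anti_exponent {p α α' : ℝ} (h : α ≤ α') {f : ℝ → ℝ} :
    energyOn p α' f (Ioo 0 1) ≤ energyOn p α f (Ioo 0 1) := by
  refine setLIntegral_mono' measurableSet_Ioo fun r hr => ENNReal.ofReal_le_ofReal ?_
  exact mul_le_mul_of_nonneg_right (Real.rpow_le_rpow_of_exponent_ge hr.1 hr.2.le h) (by positivity)

/-- Primitives of functions of finite energy belong to the core. Hardy's inequality, with weight
`r ^ (a - p)`, is what requires `a - p ≤ α₀`. -/
lemma isCoreX_tail {p α₀ a : ℝ} (hp : 1 < p) (ha : p - 1 < a) (hα₀ : a - p ≤ α₀) {g : ℝ → ℝ}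
    (hg : AEMeasurable g (volume.restrict (Ioo (0 : ℝ) 1))) (hE : energyOn p a g (Ioo 0 1) < ∞) :
    IsCoreX p α₀ a (tail g) := by
  have hp0 : 0 < p := by linarith
  have hi : ∀ r, 0 < r → IntegrableOn g (Ioo r 1) :=
    fun r hr => integrableOn_of_energyOn_lt_top hp ha hg hE hr
  have hd := ae_hasDerivAt_tail hi
  refine ⟨locallyAC_tail hi, tendsto_tail_one hi, (memLp_weightMeasure_iff hp0).2 ⟨?_, ?_⟩,
    (memLp_weightMeasure_iff hp0).2 ⟨?_, ?_⟩⟩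
  · have hc : ContinuousOn (tail g) (Ioo 0 1) := fun r hr =>
      ((continuousOn_tail hi (c := r / 2) (by linarith [hr.1]) (by linarith [hr.1, hr.2])).mono
        Ioo_subset_Icc_self).continuousAt (Ioo_mem_nhds (by linarith [hr.1]) hr.2)
          |>.continuousWithinAt
    exact hc.aemeasurable measurableSet_Ioo
  · obtain ⟨C, hC⟩ := exists_hardy hp ha
    exact (energyOn_anti_exponent hα₀).trans_lt
      ((hC g hg).trans_lt (ENNReal.mul_lt_top ENNReal.ofReal_lt_top hE))
  · refine hg.neg.congr ?_
    filter_upwards [hd] with r hr using hr.deriv.symm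
  · rwa [energyOn_congr_ae (g := g)]
    filter_upwards [hd] with r hr
    rw [hr.deriv, abs_neg]

/-- A core function as an element of the closure `X^{1,p}_1(α₀, a)`. -/
def SpaceX.ofCore {p α₀ a : ℝ} (hp : 0 < p) {w : ℝ → ℝ} (h : IsCoreX p α₀ a w) :
    SpaceX p α₀ a where
  fn := w
  grad := deriv w
  memLp_fn := h.memLp
  memLp_grad := h.memLp_deriv
  mem_closure ε hε := ⟨w, h, by simpa [normX, ENNReal.zero_rpow_of_pos hp, hp] using hε⟩

lemma IsCoreX.eq_neg_tail {p α₀ a : ℝ} (hp : 1 < p) (ha : p - 1 < a) {w : ℝ → ℝ}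
    (h : IsCoreX p α₀ a w) {r : ℝ} (hr : r ∈ Ioo (0 : ℝ) 1) : w r = -tail (deriv w) r := by
  obtain ⟨hm, hE⟩ := (memLp_weightMeasure_iff (by linarith)).1 h.memLp_deriv
  have hi : ∀ r, 0 < r → IntegrableOn (deriv w) (Ioo r 1) :=
    fun r hr => integrableOn_of_energyOn_lt_top hp ha hm hE hr
  have h1 : ∀ᶠ s in 𝓝[<] (1 : ℝ), tail (deriv w) r + w r = tail (deriv w) s + w s := by
    filter_upwards [Ioo_mem_nhdsLT hr.2] with s hs
    have e := (h.locallyAC r s hr.1 hs.1.le hs.2).integral_deriv_eq_sub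
    rw [tail_eq_sub (hi r hr.1) ⟨hs.1.le, hs.2.le⟩, e]
    ring
  have h2 : Tendsto (fun s => tail (deriv w) s + w s) (𝓝[<] 1) (𝓝 (0 + 0)) :=
    (tendsto_tail_one hi).add h.tendsto_one
  have h3 := tendsto_nhds_unique_of_eventuallyEq tendsto_const_nhds h2 h1
  linarith

/-- Every element of the closure is, almost everywhere, the primitive of its derivative. -/
lemma SpaceX.ae_fn_eq {p α₀ a : ℝ} (hp : 1 < p) (ha : p - 1 < a) (u : SpaceX p α₀ a) :
    ∀ᵐ r ∂volume.restrict (Ioo (0 : ℝ) 1), u.fn r = -tail u.grad r := by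
  have hp0 : 0 < p := by linarith
  have hpos : ∀ n : ℕ, (0 : ℝ≥0∞) < ENNReal.ofReal (1 / ((n : ℝ) + 1)) := fun n => by
    rw [ENNReal.ofReal_pos]; positivity
  choose w hw hwn using fun n : ℕ => u.mem_closure _ (hpos n)
  have hlim : Tendsto (fun n : ℕ => ENNReal.ofReal (1 / ((n : ℝ) + 1))) atTop (𝓝 0) := by
    simpa using ENNReal.tendsto_ofReal (tendsto_one_div_add_atTop_nhds_zero_nat (𝕜 := ℝ))
  have hle : ∀ n, eLpNorm (u.fn - w n) (ENNReal.ofReal p) (weightMeasure α₀) ≤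
        ENNReal.ofReal (1 / ((n : ℝ) + 1)) ∧
      eLpNorm (u.grad - deriv (w n)) (ENNReal.ofReal p) (weightMeasure a) ≤
        ENNReal.ofReal (1 / ((n : ℝ) + 1)) := by
    intro n
    have key : ∀ x y : ℝ≥0∞, y ≤ (x ^ p + y ^ p) ^ (1 / p) ∧ x ≤ (x ^ p + y ^ p) ^ (1 / p) := by
      intro x y
      have e : ∀ z : ℝ≥0∞, (z ^ p) ^ (1 / p) = z := fun z => by
        rw [← ENNReal.rpow_mul, mul_one_div_cancel hp0.ne', ENNReal.rpow_one]
      exact ⟨(e y).symm.trans_le (ENNReal.rpow_le_rpow le_add_self (by positivity)),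
        (e x).symm.trans_le (ENNReal.rpow_le_rpow le_self_add (by positivity))⟩
    exact ⟨(key _ _).2.trans (hwn n).le, (key _ _).1.trans (hwn n).le⟩
  have hf : Tendsto (fun n => eLpNorm (w n - u.fn) (ENNReal.ofReal p) (weightMeasure α₀))
      atTop (𝓝 0) := by
    refine tendsto_of_tendsto_of_tendsto_of_le_of_le tendsto_const_nhds hlim
      (fun _ => zero_le) fun n => ?_
    rw [eLpNorm_sub_comm]; exact (hle n).1
  have hmeas := tendstoInMeasure_of_tendsto_eLpNorm (by simpa using hp0)
    (fun n => (hw n).memLp.1) u.memLp_fn.1 hf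
  obtain ⟨φ, hφ, hae⟩ := hmeas.exists_seq_tendsto_ae
  rw [ae_weightMeasure_iff] at hae
  filter_upwards [hae, ae_restrict_mem measurableSet_Ioo] with r hr hr01
  obtain ⟨hm, hE⟩ := (memLp_weightMeasure_iff hp0).1 u.memLp_grad
  refine tendsto_nhds_unique hr ?_
  suffices H : Tendsto (fun n => w n r) atTop (𝓝 (-tail u.grad r)) from H.comp hφ.tendsto_atTop
  rw [tendsto_iff_dist_tendsto_zero]
  have hb : Tendsto (fun n : ℕ => tailConst p a * r ^ (-((a - p + 1) / p)) * (1 / ((n : ℝ) + 1)))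
      atTop (𝓝 0) := by
    simpa using (tendsto_one_div_add_atTop_nhds_zero_nat (𝕜 := ℝ)).const_mul
      (tailConst p a * r ^ (-((a - p + 1) / p)))
  refine squeeze_zero (fun _ => dist_nonneg) (fun n => ?_) hb
  obtain ⟨hm', hE'⟩ := (memLp_weightMeasure_iff hp0).1 (hw n).memLp_deriv
  have e1 : w n r - -tail u.grad r = tail (u.grad - deriv (w n)) r := by
    rw [(hw n).eq_neg_tail hp ha hr01]
    have := integral_sub (integrableOn_of_energyOn_lt_top hp ha hm hE hr01.1)
      (integrableOn_of_energyOn_lt_top hp ha hm' hE' hr01.1)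
    simp only [tail, Pi.sub_apply]
    rw [this]; ring
  rw [Real.dist_eq, e1]
  have h0 : (0 : ℝ) ≤ 1 / ((n : ℝ) + 1) := by positivity
  have hen : energyOn p a (u.grad - deriv (w n)) (Ioo r 1) ≤
      ENNReal.ofReal ((1 / ((n : ℝ) + 1)) ^ p) := by
    refine (energyOn_mono p a _ (Ioo_subset_Ioo_left hr01.1.le)).trans ?_
    rw [← eLpNorm_rpow_eq_energyOn hp0, ← ENNReal.ofReal_rpow_of_nonneg h0 hp0.le]
    exact ENNReal.rpow_le_rpow (hle n).2 hp0.le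
  have := abs_tail_le hp ha (hm.sub hm') hr01.1 (by positivity) hen
  rwa [← Real.rpow_mul h0, mul_one_div_cancel hp0.ne', Real.rpow_one] at this

lemma SpaceX.gradNorm_eq_one_iff {p α₀ a : ℝ} (hp : 0 < p) (u : SpaceX p α₀ a) :
    u.gradNorm = 1 ↔ energyOn p a u.grad (Ioo 0 1) = 1 := by
  rw [← eLpNorm_rpow_eq_energyOn hp, SpaceX.gradNorm]
  constructor
  · intro h; rw [h, ENNReal.one_rpow]
  · intro h
    have := congrArg (fun x : ℝ≥0∞ => x ^ (1 / p)) h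
    simpa [← ENNReal.rpow_mul, hp.ne'] using this

/-! ### The extremal density -/

/-- The density `T ^ θ U(T) ^ q` of Bliss's extremal `U(T) = (1 + T ^ b) ^ (-κ / b)`, where
`θ + 1 = (b + κ) (p - 1)` and `q = (b + κ) p / κ`. -/
def blissDensity (p κ b T : ℝ) : ℝ :=
  T ^ ((b + κ) * (p - 1) - 1) * (1 + T ^ b) ^ (-((b + κ) * p / b))

/-- The integral over `(0, ∞)` of `blissDensity`. -/
def blissMass (p κ b : ℝ) : ℝ := ∫ T in Ioi (0 : ℝ), blissDensity p κ b T

/-- The function whose derivative is `blissDensity` times `(b + κ) (p - 1) - κ T ^ b`. It vanishes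
at `0` and at `∞`, which gives the energy of the extremal. -/
def blissBoundary (p κ b T : ℝ) : ℝ :=
  T ^ ((b + κ) * (p - 1)) * (1 + T ^ b) ^ (1 - (b + κ) * p / b)

section Density

variable {p κ b : ℝ}

lemma blissDensity_pos {T : ℝ} (hT : 0 < T) : 0 < blissDensity p κ b T := by
  unfold blissDensity; positivity

lemma measurable_blissDensity (p κ b : ℝ) : Measurable (blissDensity p κ b) := by
  unfold blissDensity; fun_prop

lemma blissDensity_le_left (hp : 1 < p) (hκ : 0 < κ) (hb : 0 < b) {T : ℝ} (hT : 0 < T) :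
    blissDensity p κ b T ≤ T ^ ((b + κ) * (p - 1) - 1) := by
  unfold blissDensity
  refine mul_le_of_le_one_right (by positivity) (Real.rpow_le_one_of_one_le_of_nonpos ?_ ?_)
  · linarith [Real.rpow_nonneg hT.le b]
  · have : 0 < (b + κ) * p / b := by positivity
    linarith

lemma blissDensity_le_right (hp : 1 < p) (hκ : 0 < κ) (hb : 0 < b) {T : ℝ} (hT : 0 < T) :
    blissDensity p κ b T ≤ T ^ (-(b + κ) - 1) := by
  unfold blissDensity
  have h1 : (1 + T ^ b) ^ (-((b + κ) * p / b)) ≤ (T ^ b) ^ (-((b + κ) * p / b)) := by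
    refine Real.rpow_le_rpow_of_nonpos (by positivity) (by linarith) ?_
    have : 0 < (b + κ) * p / b := by positivity
    linarith
  refine (mul_le_mul_of_nonneg_left h1 (by positivity)).trans (le_of_eq ?_)
  rw [← Real.rpow_mul hT.le, ← Real.rpow_add hT]
  congr 1; field_simp; ring

lemma integrableOn_blissDensity (hp : 1 < p) (hκ : 0 < κ) (hb : 0 < b) :
    IntegrableOn (blissDensity p κ b) (Ioi 0) := by
  rw [← Ioc_union_Ioi_eq_Ioi (zero_le_one (α := ℝ))]
  have hp1 : 0 < p - 1 := by linarith
  refine IntegrableOn.union ?_ ?_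
  · have hi : IntegrableOn (fun T : ℝ => T ^ ((b + κ) * (p - 1) - 1)) (Ioc 0 1) := by
      rw [← intervalIntegrable_iff_integrableOn_Ioc_of_le zero_le_one]
      refine intervalIntegral.intervalIntegrable_rpow' ?_
      have : 0 < (b + κ) * (p - 1) := by positivity
      linarith
    refine hi.mono' (measurable_blissDensity p κ b).aestronglyMeasurable ?_
    refine (ae_restrict_iff' measurableSet_Ioc).2 (.of_forall fun T hT => ?_)
    rw [Real.norm_of_nonneg (blissDensity_pos hT.1).le]
    exact blissDensity_le_left hp hκ hb hT.1
  · have hi : IntegrableOn (fun T : ℝ => T ^ (-(b + κ) - 1)) (Ioi 1) :=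
      integrableOn_Ioi_rpow_of_lt (by linarith) one_pos
    refine hi.mono' (measurable_blissDensity p κ b).aestronglyMeasurable ?_
    refine (ae_restrict_iff' measurableSet_Ioi).2 (.of_forall fun T hT => ?_)
    have hT0 : (0 : ℝ) < T := one_pos.trans hT
    rw [Real.norm_of_nonneg (blissDensity_pos hT0).le]
    exact blissDensity_le_right hp hκ hb hT0

lemma blissMass_pos (hp : 1 < p) (hκ : 0 < κ) (hb : 0 < b) : 0 < blissMass p κ b := by
  unfold blissMass
  rw [setIntegral_pos_iff_support_of_nonneg_ae
    ((ae_restrict_iff' measurableSet_Ioi).2 (.of_forall fun T hT => (blissDensity_pos hT).le))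
    (integrableOn_blissDensity hp hκ hb)]
  have : Function.support (blissDensity p κ b) ∩ Ioi 0 = Ioi 0 :=
    inter_eq_right.2 fun T hT => (blissDensity_pos hT).ne'
  rw [this]; simp

/-- The distribution function of `blissDensity`. -/
def blissCdf (p κ b x : ℝ) : ℝ := ∫ T in (0 : ℝ)..x, blissDensity p κ b T

lemma hasDerivAt_blissCdf (hp : 1 < p) (hκ : 0 < κ) (hb : 0 < b) {x : ℝ} (hx : 0 < x) :
    HasDerivAt (blissCdf p κ b) (blissDensity p κ b x) x := by
  refine intervalIntegral.integral_hasDerivAt_right ?_ ?_ ?_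
  · rw [intervalIntegrable_iff_integrableOn_Ioc_of_le hx.le]
    exact (integrableOn_blissDensity hp hκ hb).mono_set Ioc_subset_Ioi_self
  · exact (measurable_blissDensity p κ b).stronglyMeasurable.stronglyMeasurableAtFilter
  · have h1 : 1 + x ^ b ≠ 0 := by positivity
    unfold blissDensity
    exact (Real.continuousAt_rpow_const _ _ (Or.inl hx.ne')).mul
      ((continuousAt_const.add (Real.continuousAt_rpow_const _ _ (Or.inl hx.ne'))).rpow_const
        (Or.inl h1))

lemma tendsto_blissCdf_atTop (hp : 1 < p) (hκ : 0 < κ) (hb : 0 < b) :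
    Tendsto (blissCdf p κ b) atTop (𝓝 (blissMass p κ b)) :=
  intervalIntegral_tendsto_integral_Ioi 0 (integrableOn_blissDensity hp hκ hb) tendsto_id

lemma tendsto_blissCdf_zero (hp : 1 < p) (hκ : 0 < κ) (hb : 0 < b) :
    Tendsto (blissCdf p κ b) (𝓝[>] 0) (𝓝 0) := by
  have hi : IntegrableOn (blissDensity p κ b) (uIcc 0 1) := by
    rw [uIcc_of_le zero_le_one, integrableOn_Icc_iff_integrableOn_Ioc]
    exact (integrableOn_blissDensity hp hκ hb).mono_set Ioc_subset_Ioi_self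
  have h := intervalIntegral.continuousOn_primitive_interval hi 0 left_mem_uIcc
  rw [ContinuousWithinAt, intervalIntegral.integral_same, uIcc_of_le zero_le_one] at h
  refine h.mono_left ?_
  rw [← nhdsWithin_Ioo_eq_nhdsGT one_pos]
  exact nhdsWithin_mono _ Ioo_subset_Icc_self

lemma hasDerivAt_blissBoundary (hb : 0 < b) {x : ℝ} (hx : 0 < x) :
    HasDerivAt (blissBoundary p κ b)
      (((b + κ) * (p - 1) - κ * x ^ b) * blissDensity p κ b x) x := by
  have hQ : 0 < 1 + x ^ b := by positivity
  have h1 : HasDerivAt (fun T : ℝ => T ^ ((b + κ) * (p - 1)))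
      ((b + κ) * (p - 1) * x ^ ((b + κ) * (p - 1) - 1)) x :=
    Real.hasDerivAt_rpow_const (Or.inl hx.ne')
  have h2 : HasDerivAt (fun T : ℝ => 1 + T ^ b) (b * x ^ (b - 1)) x :=
    (Real.hasDerivAt_rpow_const (Or.inl hx.ne')).const_add 1
  have h3 := h2.rpow_const (p := 1 - (b + κ) * p / b) (Or.inl hQ.ne')
  refine (h1.mul h3).congr_deriv ?_
  unfold blissDensity
  have e1 : (1 + x ^ b) ^ (1 - (b + κ) * p / b) =
      (1 + x ^ b) * (1 + x ^ b) ^ (-((b + κ) * p / b)) := by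
    rw [sub_eq_add_neg, Real.rpow_add hQ, Real.rpow_one]
  have e2 : 1 - (b + κ) * p / b - 1 = -((b + κ) * p / b) := by ring
  have e3 : x ^ ((b + κ) * (p - 1)) = x ^ ((b + κ) * (p - 1) - 1) * x := by
    rw [Real.rpow_sub_one hx.ne', div_mul_cancel₀ _ hx.ne']
  rw [e1, e2, e3, Real.rpow_sub_one hx.ne' b]
  field_simp
  ring

end Density

/-- A function with positive derivative on `(0, ∞)` has a differentiable inverse there. -/
lemma exists_differentiable_inverse {G G' : ℝ → ℝ} (hG : ∀ x, 0 < x → HasDerivAt G (G' x) x)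
    (hpos : ∀ x, 0 < x → 0 < G' x) :
    ∃ Φ : ℝ → ℝ, ∀ x, 0 < x → Φ (G x) = x ∧ HasDerivAt Φ (G' x)⁻¹ (G x) := by
  have hmono : StrictMonoOn G (Ioi 0) := by
    refine strictMonoOn_of_deriv_pos (convex_Ioi 0)
      (fun x hx => (hG x hx).continuousAt.continuousWithinAt) fun x hx => ?_
    rw [interior_Ioi] at hx
    rw [(hG x hx).deriv]; exact hpos x hx
  set Φ := Function.invFunOn G (Ioi 0) with hΦ
  have hleft : ∀ x, 0 < x → Φ (G x) = x := fun x hx => hmono.injOn.leftInvOn_invFunOn hx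
  refine ⟨Φ, fun x hx => ⟨hleft x hx, ?_⟩⟩
  have hopen : G '' Ioi 0 ∈ 𝓝 (G x) := by
    have h1 : G '' Icc (x / 2) (x + 1) ⊆ G '' Ioi 0 :=
      image_mono fun y hy => lt_of_lt_of_le (by positivity) hy.1
    have h2 : Icc (G (x / 2)) (G (x + 1)) ⊆ G '' Icc (x / 2) (x + 1) :=
      intermediate_value_Icc (by linarith) fun y hy =>
        (hG y (lt_of_lt_of_le (by positivity) hy.1)).continuousAt.continuousWithinAt
    refine mem_of_superset (Icc_mem_nhds ?_ ?_) (h2.trans h1)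
    · exact hmono (by simpa using hx) hx (by linarith)
    · exact hmono hx (by simp only [mem_Ioi]; linarith) (by linarith)
  have hmonoΦ : MonotoneOn Φ (G '' Ioi 0) := by
    rintro _ ⟨y, hy, rfl⟩ _ ⟨z, hz, rfl⟩ h
    rw [hleft y hy, hleft z hz]
    exact (hmono.le_iff_le hy hz).1 h
  have himg : Φ '' (G '' Ioi 0) ∈ 𝓝 (Φ (G x)) := by
    rw [hleft x hx]
    refine mem_of_superset (Ioi_mem_nhds hx) fun y hy => ⟨G y, mem_image_of_mem _ hy, hleft y hy⟩
  have hcont : ContinuousAt Φ (G x) := continuousAt_of_monotoneOn_of_image_mem_nhds hmonoΦ hopen himg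
  refine HasDerivAt.of_local_left_inverse hcont (by rw [hleft x hx]; exact hG x hx)
    (hpos x hx).ne' ?_
  filter_upwards [hopen] with y hy
  obtain ⟨z, hz, rfl⟩ := hy
  rw [hleft z hz]

/-! ### Transport and calibration -/

section Calibration

variable {p κ b : ℝ}

/-- Weighted arithmetic-geometric mean inequality: the lower bound for the derivative of the
weight `r ^ A T ^ B` along a transport map `T` with derivative `D`. -/
lemma bliss_am_gm (hp : 1 < p) (hκ : 0 < κ) (hb : 0 < b) {r T u c : ℝ} (hr : 0 < r) (hT : 0 < T)
    (hu : 0 ≤ u) (hc : 0 < c) :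
    (b + κ) * (p - 1) * c ^ (b / ((b + κ) * p)) * u ^ ((b + κ) * p / κ) *
        r ^ ((b + κ) * (p - 1) - 1) * (1 + T ^ b) ≤
      u ^ ((b + κ) * (p - 1) / κ + 1) *
        ((p - 1) / p * ((b + κ) * (p - 1) + κ) *
            r ^ ((p - 1) / p * ((b + κ) * (p - 1) + κ) - 1) * T ^ (b * (p - 1) / p) +
          r ^ ((p - 1) / p * ((b + κ) * (p - 1) + κ)) * (b * (p - 1) / p *
            T ^ (b * (p - 1) / p - 1) *
            (c * u ^ ((b + κ) * p / κ) * r ^ ((b + κ) * (p - 1) - 1) / blissDensity p κ b T))) := by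
  have hp0 : 0 < p := by linarith
  have hp1 : 0 < p - 1 := by linarith
  have hm : 0 < (b + κ) * (p - 1) / κ + 1 := by positivity
  have hq : 0 < (b + κ) * p / κ := by positivity
  -- where `u` vanishes the transport map has derivative zero, and both sides are zero
  rcases hu.eq_or_lt with rfl | hu
  · simp [Real.zero_rpow hm.ne', Real.zero_rpow hq.ne']
  have hQ : 0 < 1 + T ^ b := by positivity
  set D := c * u ^ ((b + κ) * p / κ) * r ^ ((b + κ) * (p - 1) - 1) / blissDensity p κ b T with hD
  have hd := blissDensity_pos (p := p) (κ := κ) (b := b) hT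
  have hDpos : 0 < D := by positivity
  set l := b / ((b + κ) * p) with hl
  have hl0 : 0 ≤ l := by positivity
  have hl1 : 0 ≤ 1 - l := by
    rw [sub_nonneg, hl, div_le_one (by positivity)]
    nlinarith
  have key := Real.geom_mean_le_arith_mean2_weighted hl1 hl0 (p₁ := 1 / r) (p₂ := D / T)
    (by positivity) (by positivity) (by ring)
  have hA : (p - 1) / p * ((b + κ) * (p - 1) + κ) = (b + κ) * (p - 1) * (1 - l) := by
    rw [hl]; field_simp; ring
  have hB : b * (p - 1) / p = (b + κ) * (p - 1) * l := by rw [hl]; field_simp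
  set m := (b + κ) * (p - 1) / κ + 1 with hmdef
  set A := (p - 1) / p * ((b + κ) * (p - 1) + κ) with hAdef
  set B := b * (p - 1) / p with hBdef
  have e1 : A * r ^ (A - 1) * T ^ B + r ^ A * (B * T ^ (B - 1) * D) =
      r ^ A * T ^ B * ((b + κ) * (p - 1) * ((1 - l) * (1 / r) + l * (D / T))) := by
    rw [Real.rpow_sub_one hr.ne', Real.rpow_sub_one hT.ne']
    calc _ = r ^ A * T ^ B * (A * (1 / r) + B * (D / T)) := by field_simp
      _ = _ := by rw [hA, hB]; ring
  rw [e1]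
  have e2 : u ^ m * (r ^ A * T ^ B * ((1 / r) ^ (1 - l) * (D / T) ^ l)) =
      c ^ l * u ^ ((b + κ) * p / κ) * r ^ ((b + κ) * (p - 1) - 1) * (1 + T ^ b) := by
    rw [hD]
    unfold blissDensity
    set Q := 1 + T ^ b
    -- in logarithmic coordinates the identity of monomials is linear in the exponents
    obtain ⟨x, rfl⟩ : ∃ x, Real.exp x = u := ⟨_, Real.exp_log hu⟩
    obtain ⟨y, rfl⟩ : ∃ x, Real.exp x = r := ⟨_, Real.exp_log hr⟩
    obtain ⟨z, rfl⟩ : ∃ x, Real.exp x = T := ⟨_, Real.exp_log hT⟩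
    obtain ⟨w, hw⟩ : ∃ x, Real.exp x = Q := ⟨_, Real.exp_log hQ⟩
    obtain ⟨v, rfl⟩ : ∃ x, Real.exp x = c := ⟨_, Real.exp_log hc⟩
    rw [← hw]
    simp only [← Real.exp_mul, ← Real.exp_add, ← Real.exp_sub, one_div, ← Real.exp_neg]
    congr 1
    rw [hAdef, hBdef, hmdef, hl]
    field_simp
    ring
  calc _ = (b + κ) * (p - 1) * (c ^ l * u ^ ((b + κ) * p / κ) *
        r ^ ((b + κ) * (p - 1) - 1) * (1 + T ^ b)) := by ring
    _ = (b + κ) * (p - 1) * (u ^ m * (r ^ A * T ^ B * ((1 / r) ^ (1 - l) * (D / T) ^ l))) := by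
        rw [e2]
    _ ≤ (b + κ) * (p - 1) * (u ^ m * (r ^ A * T ^ B * ((1 - l) * (1 / r) + l * (D / T)))) := by
        gcongr
    _ = _ := by ring

/-- Young's inequality for the pairing of `g` with the transported weight. -/
lemma bliss_young (hp : 1 < p) (hκ : 0 < κ) (hb : 0 < b) {r T u μ g : ℝ} (hr : 0 < r) (hT : 0 < T)
    (hu : 0 ≤ u) (hμ : 0 < μ) (hg : 0 ≤ g) :
    p * μ ^ (p - 1) * (u ^ ((b + κ) * (p - 1) / κ) * g *
        (r ^ ((p - 1) / p * ((b + κ) * (p - 1) + κ)) * T ^ (b * (p - 1) / p))) ≤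
      r ^ ((κ + 1) * (p - 1)) * g ^ p +
        (p - 1) * μ ^ p * T ^ b * r ^ ((b + κ) * (p - 1) - 1) * u ^ ((b + κ) * p / κ) := by
  have hp0 : 0 < p := by linarith
  have hp1 : 0 < p - 1 := by linarith
  have hpq : p.HolderConjugate (p / (p - 1)) := Real.HolderConjugate.conjExponent hp
  set X := r ^ ((κ + 1) * (p - 1) / p) * g with hX
  set Y := μ ^ (p - 1) * (T ^ (b * (p - 1) / p) * r ^ (((b + κ) * (p - 1) - 1) * (p - 1) / p) *
    u ^ ((b + κ) * (p - 1) / κ)) with hY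
  have hX0 : 0 ≤ X := by positivity
  have hY0 : 0 ≤ Y := by positivity
  have h := Real.young_inequality_of_nonneg hX0 hY0 hpq
  have e1 : X ^ p = r ^ ((κ + 1) * (p - 1)) * g ^ p := by
    rw [hX, Real.mul_rpow (by positivity) hg, ← Real.rpow_mul hr.le]
    congr 2; field_simp
  have e2 : Y ^ (p / (p - 1)) = μ ^ p * T ^ b * r ^ ((b + κ) * (p - 1) - 1) *
      u ^ ((b + κ) * p / κ) := by
    rw [hY, Real.mul_rpow (by positivity) (by positivity), Real.mul_rpow (by positivity)
      (by positivity), Real.mul_rpow (by positivity) (by positivity), ← Real.rpow_mul hr.le,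
      ← Real.rpow_mul hT.le, ← Real.rpow_mul hu, ← Real.rpow_mul hμ.le]
    have a1 : (p - 1) * (p / (p - 1)) = p := by field_simp
    have a2 : b * (p - 1) / p * (p / (p - 1)) = b := by field_simp
    have a3 : ((b + κ) * (p - 1) - 1) * (p - 1) / p * (p / (p - 1)) = (b + κ) * (p - 1) - 1 := by
      field_simp
    have a4 : (b + κ) * (p - 1) / κ * (p / (p - 1)) = (b + κ) * p / κ := by field_simp
    rw [a1, a2, a3, a4]; ring
  have e3 : X * Y = μ ^ (p - 1) * (u ^ ((b + κ) * (p - 1) / κ) * g *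
        (r ^ ((p - 1) / p * ((b + κ) * (p - 1) + κ)) * T ^ (b * (p - 1) / p))) := by
    have : r ^ ((p - 1) / p * ((b + κ) * (p - 1) + κ)) =
        r ^ ((κ + 1) * (p - 1) / p) * r ^ (((b + κ) * (p - 1) - 1) * (p - 1) / p) := by
      rw [← Real.rpow_add hr]; congr 1; field_simp; ring
    rw [this, hX, hY]; ring
  rw [e1, e2, e3] at h
  have h2 := mul_le_mul_of_nonneg_left h hp0.le
  calc _ = p * (μ ^ (p - 1) * (u ^ ((b + κ) * (p - 1) / κ) * g *
        (r ^ ((p - 1) / p * ((b + κ) * (p - 1) + κ)) * T ^ (b * (p - 1) / p)))) := by ring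
    _ ≤ _ := h2
    _ = _ := by field_simp

/-- The pointwise inequality behind Bliss's inequality: with `D` the derivative of the transport
map `T`, the left side is the derivative along `r` of the calibration. -/
lemma bliss_calibration (hp : 1 < p) (hκ : 0 < κ) (hb : 0 < b) {r T u c g μ D : ℝ} (hr : 0 < r)
    (hT : 0 < T) (hu : 0 ≤ u) (hc : 0 < c) (hg : 0 ≤ g)
    (hμ : μ = κ * c ^ (b / ((b + κ) * p)))
    (hD : D = c * u ^ ((b + κ) * p / κ) * r ^ ((b + κ) * (p - 1) - 1) / blissDensity p κ b T) :
    p * μ ^ (p - 1) * (u ^ ((b + κ) * (p - 1) / κ) * g *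
        (r ^ ((p - 1) / p * ((b + κ) * (p - 1) + κ)) * T ^ (b * (p - 1) / p))) -
      p * μ ^ (p - 1) / ((b + κ) * (p - 1) / κ + 1) * (u ^ ((b + κ) * (p - 1) / κ + 1) *
        ((p - 1) / p * ((b + κ) * (p - 1) + κ) *
            r ^ ((p - 1) / p * ((b + κ) * (p - 1) + κ) - 1) * T ^ (b * (p - 1) / p) +
          r ^ ((p - 1) / p * ((b + κ) * (p - 1) + κ)) * (b * (p - 1) / p *
            T ^ (b * (p - 1) / p - 1) * D))) +
      c ^ (-(κ / (b + κ))) * (((b + κ) * (p - 1) * κ ^ (p - 1) -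
        κ ^ (p - 1) * b * (p - 1) / ((b + κ) * (p - 1) + κ) *
          ((b + κ) * (p - 1) - κ * T ^ b)) * blissDensity p κ b T * D) ≤
      r ^ ((κ + 1) * (p - 1)) * g ^ p := by
  have hp0 : 0 < p := by linarith
  have hp1 : 0 < p - 1 := by linarith
  have hμ0 : 0 < μ := by rw [hμ]; positivity
  have h1 := bliss_young hp hκ hb hr hT hu hμ0 hg
  have h2 := bliss_am_gm hp hκ hb hr hT hu hc
  rw [← hD] at h2
  have hd := blissDensity_pos (p := p) (κ := κ) (b := b) hT
  have h3 : blissDensity p κ b T * D = c * u ^ ((b + κ) * p / κ) * r ^ ((b + κ) * (p - 1) - 1) := by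
    rw [hD]; field_simp
  have hm : 0 < (b + κ) * (p - 1) / κ + 1 := by positivity
  have h4 := mul_le_mul_of_nonneg_left h2
    (show 0 ≤ p * μ ^ (p - 1) / ((b + κ) * (p - 1) / κ + 1) by positivity)
  have m1 : μ ^ (p - 1) * c ^ (b / ((b + κ) * p)) = κ ^ (p - 1) * c ^ (b / (b + κ)) := by
    rw [hμ, Real.mul_rpow hκ.le (by positivity), ← Real.rpow_mul hc.le, mul_assoc,
      ← Real.rpow_add hc]
    congr 2; field_simp; ring
  have m2 : μ ^ p = κ * κ ^ (p - 1) * c ^ (b / (b + κ)) := by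
    rw [hμ, Real.mul_rpow hκ.le (by positivity), ← Real.rpow_mul hc.le, Real.rpow_sub_one hκ.ne',
      mul_div_cancel₀ _ hκ.ne']
    congr 2; field_simp
  have m3 : c ^ (-(κ / (b + κ))) * c = c ^ (b / (b + κ)) := by
    rw [← Real.rpow_add_one hc.ne']; congr 1; field_simp; ring
  set w := u ^ ((b + κ) * p / κ) with hw
  set s := r ^ ((b + κ) * (p - 1) - 1) with hs
  set L := c ^ (b / (b + κ)) with hL
  set K := κ ^ (p - 1) with hK
  set t := T ^ b with ht
  set n := (b + κ) * (p - 1) with hn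
  rw [m2] at h1
  have e4 : p * μ ^ (p - 1) / (n / κ + 1) * (n * c ^ (b / ((b + κ) * p)) * w * s * (1 + t)) =
      p * (K * L) / (n / κ + 1) * n * w * s * (1 + t) := by rw [← m1]; ring
  rw [e4] at h4
  have e5 : c ^ (-(κ / (b + κ))) * ((n * K - K * b * (p - 1) / (n + κ) * (n - κ * t)) *
      blissDensity p κ b T * D) =
      L * w * s * (n * K - K * b * (p - 1) / (n + κ) * (n - κ * t)) := by
    rw [mul_assoc _ (blissDensity p κ b T), h3, ← m3]; ring
  rw [e5]
  have hn0 : 0 < n := by positivity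
  have e6 : p * (K * L) / (n / κ + 1) * n * w * s * (1 + t) -
      (p - 1) * (κ * K * L) * t * s * w =
      L * w * s * (n * K - K * b * (p - 1) / (n + κ) * (n - κ * t)) := by
    have : b * (p - 1) = n - κ * (p - 1) := by rw [hn]; ring
    rw [mul_assoc K b, this]
    field_simp
    ring
  linarith

end Calibration

/-! ### Bliss's inequality for continuous derivatives -/

section Bliss

variable {p κ b : ℝ}

/-- Primitive of the integrand that is left, after transport, in the lower bound for the energy. -/
def blissPotential (p κ b T : ℝ) : ℝ :=
  (b + κ) * (p - 1) * κ ^ (p - 1) * blissCdf p κ b T -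
    κ ^ (p - 1) * b * (p - 1) / ((b + κ) * (p - 1) + κ) * blissBoundary p κ b T

lemma hasDerivAt_blissPotential (hp : 1 < p) (hκ : 0 < κ) (hb : 0 < b) {x : ℝ} (hx : 0 < x) :
    HasDerivAt (blissPotential p κ b)
      (((b + κ) * (p - 1) * κ ^ (p - 1) - κ ^ (p - 1) * b * (p - 1) / ((b + κ) * (p - 1) + κ) *
          ((b + κ) * (p - 1) - κ * x ^ b)) * blissDensity p κ b x) x := by
  refine (((hasDerivAt_blissCdf hp hκ hb hx).const_mul _).sub
    ((hasDerivAt_blissBoundary hb hx).const_mul _)).congr_deriv ?_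
  ring

/-- The transport argument, with the values of the transport map confined to `[T₀, T₁]`. -/
lemma bliss_transport (hp : 1 < p) (hκ : 0 < κ) (hb : 0 < b) {g : ℝ → ℝ} (hg : Continuous g)
    (hg0 : ∀ s, 0 ≤ g s) {ρ T₀ T₁ J c : ℝ} (hρ : 0 < ρ) (hρ1 : ρ < 1) (hT₀ : 0 < T₀) (hT : T₀ < T₁)
    (hJ : J = ∫ r in ρ..1, r ^ ((b + κ) * (p - 1) - 1) * (∫ s in r..1, g s) ^ ((b + κ) * p / κ))
    (hJ0 : 0 < J) (hc : c = (blissCdf p κ b T₁ - blissCdf p κ b T₀) / J) :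
    c ^ (-(κ / (b + κ))) * (blissPotential p κ b T₁ - blissPotential p κ b T₀) ≤
      ∫ r in ρ..1, r ^ ((κ + 1) * (p - 1)) * g r ^ p := by
  have hp0 : 0 < p := by linarith
  have hp1 : 0 < p - 1 := by linarith
  set G := blissCdf p κ b with hGdef
  have hG : ∀ x, 0 < x → HasDerivAt G (blissDensity p κ b x) x :=
    fun x hx => hasDerivAt_blissCdf hp hκ hb hx
  have hmono : StrictMonoOn G (Ioi 0) := by
    refine strictMonoOn_of_deriv_pos (convex_Ioi 0)
      (fun x hx => (hG x hx).continuousAt.continuousWithinAt) fun x hx => ?_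
    rw [interior_Ioi] at hx
    rw [(hG x hx).deriv]; exact blissDensity_pos hx
  have hc0 : 0 < c := by
    rw [hc]; exact div_pos (sub_pos.2 (hmono hT₀ (hT₀.trans hT) hT)) hJ0
  set q := (b + κ) * p / κ with hq
  have hq0 : 0 < q := by positivity
  set n := (b + κ) * (p - 1) with hn
  have hn0 : 0 < n := by positivity
  set u : ℝ → ℝ := fun r => ∫ s in r..1, g s with hu
  have hud : ∀ r, HasDerivAt u (-g r) r := fun r =>
    intervalIntegral.integral_hasDerivAt_left (hg.intervalIntegrable _ _)
      hg.stronglyMeasurable.stronglyMeasurableAtFilter hg.continuousAt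
  have huc : Continuous u := continuous_iff_continuousAt.2 fun r => (hud r).continuousAt
  have hu0 : ∀ r ≤ 1, 0 ≤ u r := fun r hr =>
    intervalIntegral.integral_nonneg hr fun s _ => hg0 s
  have hu1 : u 1 = 0 := intervalIntegral.integral_same
  set f : ℝ → ℝ := fun r => r ^ (n - 1) * u r ^ q with hf
  have hfc : ∀ r, 0 < r → ContinuousAt f r := fun r hr =>
    (Real.continuousAt_rpow_const _ _ (Or.inl hr.ne')).mul
      (huc.continuousAt.rpow_const (Or.inr hq0.le))
  have hfm : Measurable f := by
    have := huc.measurable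
    simp only [hf]; fun_prop
  have hfi : ∀ r, 0 < r → IntervalIntegrable f volume ρ r := fun r hr =>
    ContinuousOn.intervalIntegrable fun s hs =>
      (hfc s (lt_of_lt_of_le (lt_min hρ hr) hs.1)).continuousWithinAt
  have hf0 : ∀ r, 0 < r → r ≤ 1 → 0 ≤ f r := fun r hr hr1 =>
    mul_nonneg (Real.rpow_nonneg hr.le _) (Real.rpow_nonneg (hu0 r hr1) _)
  set y : ℝ → ℝ := fun r => G T₀ + c * ∫ s in ρ..r, f s with hy
  have hyd : ∀ r, 0 < r → HasDerivAt y (c * f r) r := fun r hr =>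
    ((intervalIntegral.integral_hasDerivAt_right (hfi r hr)
      hfm.stronglyMeasurable.stronglyMeasurableAtFilter (hfc r hr)).const_mul c).const_add _
  have hyρ : y ρ = G T₀ := by simp [hy]
  have hy1 : y 1 = G T₁ := by
    simp only [hy, hf]
    rw [← hJ, hc]; field_simp; ring
  have hymono : MonotoneOn y (Icc ρ 1) := by
    refine monotoneOn_of_deriv_nonneg (convex_Icc ρ 1)
      (fun r hr => (hyd r (hρ.trans_le hr.1)).continuousAt.continuousWithinAt)
      (fun r hr => ?_) fun r hr => ?_
    all_goals rw [interior_Icc] at hr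
    · exact (hyd r (hρ.trans hr.1)).differentiableAt.differentiableWithinAt
    · rw [(hyd r (hρ.trans hr.1)).deriv]
      exact mul_nonneg hc0.le (hf0 r (hρ.trans hr.1) hr.2.le)
  obtain ⟨Φ, hΦ⟩ := exists_differentiable_inverse hG fun x hx => blissDensity_pos hx
  set T : ℝ → ℝ := fun r => Φ (y r) with hTdef
  have hTr : ∀ r ∈ Icc ρ 1, 0 < T r ∧ HasDerivAt T ((blissDensity p κ b (T r))⁻¹ * (c * f r)) r := by
    intro r hr
    have hmem : y r ∈ Icc (G T₀) (G T₁) := by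
      rw [← hyρ, ← hy1]
      exact ⟨hymono (left_mem_Icc.2 hρ1.le) hr hr.1, hymono hr (right_mem_Icc.2 hρ1.le) hr.2⟩
    obtain ⟨x, hx, hxy⟩ := intermediate_value_Icc hT.le (fun z hz =>
      (hG z (hT₀.trans_le hz.1)).continuousAt.continuousWithinAt) hmem
    have hx0 : 0 < x := hT₀.trans_le hx.1
    have hTx : T r = x := by simp only [hTdef, ← hxy, (hΦ x hx0).1]
    rw [hTx]
    refine ⟨hx0, ?_⟩
    have h1 := (hΦ x hx0).2
    rw [hxy] at h1
    exact h1.comp r (hyd r (hρ.trans_le hr.1))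
  have hTρ : T ρ = T₀ := by simp only [hTdef, hyρ, (hΦ T₀ hT₀).1]
  have hT1 : T 1 = T₁ := by simp only [hTdef, hy1, (hΦ T₁ (hT₀.trans hT)).1]
  set μ := κ * c ^ (b / ((b + κ) * p)) with hμ
  have hμ0 : 0 < μ := by positivity
  set A := (p - 1) / p * (n + κ) with hA
  set B := b * (p - 1) / p with hB
  set P : ℝ → ℝ := fun r => -(p * μ ^ (p - 1) / (n / κ + 1)) * (u r ^ (n / κ + 1) *
    (r ^ A * T r ^ B)) + c ^ (-(κ / (b + κ))) * blissPotential p κ b (T r) with hP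
  have hm0 : 0 < n / κ := by positivity
  have hPd : ∀ r ∈ Icc ρ 1, ∃ P', HasDerivAt P P' r ∧ P' ≤ r ^ ((κ + 1) * (p - 1)) * g r ^ p := by
    intro r hr
    have hr0 : 0 < r := hρ.trans_le hr.1
    obtain ⟨hTpos, hTd⟩ := hTr r hr
    set D := (blissDensity p κ b (T r))⁻¹ * (c * f r) with hD
    have d1 : HasDerivAt (fun r => u r ^ (n / κ + 1))
        (-g r * (n / κ + 1) * u r ^ (n / κ + 1 - 1)) r :=
      (hud r).rpow_const (Or.inr (by linarith))
    have d2 : HasDerivAt (fun r : ℝ => r ^ A) (A * r ^ (A - 1)) r :=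
      Real.hasDerivAt_rpow_const (Or.inl hr0.ne')
    have d3 : HasDerivAt (fun r => T r ^ B) (D * B * T r ^ (B - 1)) r :=
      hTd.rpow_const (Or.inl hTpos.ne')
    have d4 : HasDerivAt (fun r => blissPotential p κ b (T r)) _ r :=
      (hasDerivAt_blissPotential hp hκ hb hTpos).comp r hTd
    have d5 := ((d1.mul (d2.mul d3)).const_mul (-(p * μ ^ (p - 1) / (n / κ + 1)))).add
      (d4.const_mul (c ^ (-(κ / (b + κ)))))
    refine ⟨_, d5, ?_⟩
    refine le_trans (le_of_eq ?_) (bliss_calibration hp hκ hb hr0 hTpos (hu0 r hr.2) hc0 (hg0 r)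
      hμ (D := D) (by rw [hD, hf, ← hn, ← hq, div_eq_inv_mul]; ring))
    rw [add_sub_cancel_right]
    have hm1 : n / κ + 1 ≠ 0 := by positivity
    simp only [Pi.mul_apply]
    rw [← hn, ← hA, ← hB]
    field_simp
    ring
  choose! P' hPd' using hPd
  have hint : IntegrableOn (fun r => r ^ ((κ + 1) * (p - 1)) * g r ^ p) (Icc ρ 1) := by
    refine ContinuousOn.integrableOn_Icc fun r hr => ?_
    exact ((Real.continuousAt_rpow_const _ _ (Or.inl (hρ.trans_le hr.1).ne')).mul
      (hg.continuousAt.rpow_const (Or.inr hp0.le))).continuousWithinAt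
  have hmain := intervalIntegral.sub_le_integral_of_hasDeriv_right_of_le hρ1.le
    (fun r hr => (hPd' r hr).1.continuousAt.continuousWithinAt)
    (fun r hr => (hPd' r (Ioo_subset_Icc_self hr)).1.hasDerivWithinAt) hint
    (fun r hr => (hPd' r (Ioo_subset_Icc_self hr)).2)
  refine le_trans ?_ hmain
  simp only [hP, hTρ, hT1, hu1]
  rw [Real.zero_rpow (by positivity)]
  have h1 : 0 ≤ p * μ ^ (p - 1) / (n / κ + 1) * (u ρ ^ (n / κ + 1) * (ρ ^ A * T₀ ^ B)) := by
    have := hu0 ρ hρ1.le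
    positivity
  linarith

lemma blissBoundary_nonneg {x : ℝ} (hx : 0 < x) : 0 ≤ blissBoundary p κ b x := by
  unfold blissBoundary; positivity

lemma tendsto_blissBoundary_zero (hp : 1 < p) (hκ : 0 < κ) (hb : 0 < b) :
    Tendsto (blissBoundary p κ b) (𝓝[>] 0) (𝓝 0) := by
  have hn : 0 < (b + κ) * (p - 1) := mul_pos (by linarith) (by linarith)
  have h : ContinuousAt (blissBoundary p κ b) 0 := by
    unfold blissBoundary
    refine (Real.continuousAt_rpow_const _ _ (Or.inr hn.le)).mul
      ((continuousAt_const.add (Real.continuousAt_rpow_const _ _ (Or.inr hb.le))).rpow_const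
        (Or.inl ?_))
    simp [Real.zero_rpow hb.ne']
  have h0 : blissBoundary p κ b 0 = 0 := by simp [blissBoundary, Real.zero_rpow hn.ne']
  have := h.tendsto
  rw [h0] at this
  exact this.mono_left nhdsWithin_le_nhds

lemma tendsto_blissBoundary_atTop (hp : 1 < p) (hκ : 0 < κ) (hb : 0 < b) :
    Tendsto (blissBoundary p κ b) atTop (𝓝 0) := by
  have hE : 1 - (b + κ) * p / b ≤ 0 := by
    rw [sub_nonpos, le_div_iff₀ hb]; nlinarith
  refine squeeze_zero' (g := fun x : ℝ => x ^ (-κ)) ?_ ?_ (tendsto_rpow_neg_atTop hκ)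
  · filter_upwards [eventually_gt_atTop 0] with x hx using blissBoundary_nonneg hx
  · filter_upwards [eventually_gt_atTop 0] with x hx
    unfold blissBoundary
    have h1 : (1 + x ^ b) ^ (1 - (b + κ) * p / b) ≤ (x ^ b) ^ (1 - (b + κ) * p / b) :=
      Real.rpow_le_rpow_of_nonpos (by positivity) (by linarith) hE
    refine (mul_le_mul_of_nonneg_left h1 (by positivity)).trans (le_of_eq ?_)
    rw [← Real.rpow_mul hx.le, ← Real.rpow_add hx]
    congr 1; field_simp; ring

/-- Bliss's inequality for a continuous derivative, away from the origin. -/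
lemma bliss_continuous (hp : 1 < p) (hκ : 0 < κ) (hb : 0 < b) {g : ℝ → ℝ} (hg : Continuous g)
    (hg0 : ∀ s, 0 ≤ g s) {ρ : ℝ} (hρ : 0 < ρ) (hρ1 : ρ < 1) :
    (b + κ) * (p - 1) * κ ^ (p - 1) * blissMass p κ b *
      ((∫ r in ρ..1, r ^ ((b + κ) * (p - 1) - 1) * (∫ s in r..1, g s) ^ ((b + κ) * p / κ)) /
        blissMass p κ b) ^ (κ / (b + κ)) ≤
      ∫ r in ρ..1, r ^ ((κ + 1) * (p - 1)) * g r ^ p := by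
  have hp1 : 0 < p - 1 := by linarith
  set J := ∫ r in ρ..1, r ^ ((b + κ) * (p - 1) - 1) * (∫ s in r..1, g s) ^ ((b + κ) * p / κ) with hJ
  have hM := blissMass_pos hp hκ hb
  have hJ0 : 0 ≤ J := intervalIntegral.integral_nonneg hρ1.le fun r hr =>
    mul_nonneg (Real.rpow_nonneg (hρ.le.trans hr.1) _)
      (Real.rpow_nonneg (intervalIntegral.integral_nonneg hr.2 fun s _ => hg0 s) _)
  rcases hJ0.eq_or_lt with h | hJ0
  · rw [← h, zero_div, Real.zero_rpow (by positivity), mul_zero]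
    exact intervalIntegral.integral_nonneg hρ1.le fun r hr =>
      mul_nonneg (Real.rpow_nonneg (hρ.le.trans hr.1) _) (Real.rpow_nonneg (hg0 r) _)
  set G := blissCdf p κ b
  have hx0 : Tendsto (fun x : ℝ => x⁻¹) atTop (𝓝[>] 0) := tendsto_inv_atTop_nhdsGT_zero
  have hc : Tendsto (fun x => (G x - G x⁻¹) / J) atTop (𝓝 ((blissMass p κ b - 0) / J)) :=
    ((tendsto_blissCdf_atTop hp hκ hb).sub ((tendsto_blissCdf_zero hp hκ hb).comp hx0)).div_const J
  rw [sub_zero] at hc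
  set n := (b + κ) * (p - 1)
  set e := κ ^ (p - 1) * b * (p - 1) / (n + κ)
  have hΨ : Tendsto (fun x => blissPotential p κ b x - blissPotential p κ b x⁻¹) atTop
      (𝓝 ((n * κ ^ (p - 1) * blissMass p κ b - e * 0) - (n * κ ^ (p - 1) * 0 - e * 0))) := by
    refine Tendsto.sub ?_ ?_
    · exact ((tendsto_blissCdf_atTop hp hκ hb).const_mul _).sub
        ((tendsto_blissBoundary_atTop hp hκ hb).const_mul _)
    · exact (((tendsto_blissCdf_zero hp hκ hb).comp hx0).const_mul _).sub
        (((tendsto_blissBoundary_zero hp hκ hb).comp hx0).const_mul _)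
  have hlim := (hc.rpow_const (p := -(κ / (b + κ))) (Or.inl (by positivity))).mul hΨ
  have hle := le_of_tendsto hlim (b := ∫ r in ρ..1, r ^ ((κ + 1) * (p - 1)) * g r ^ p) (by
    filter_upwards [eventually_gt_atTop 1] with x hx
    have hx0 : 0 < x := by linarith
    exact bliss_transport hp hκ hb hg hg0 hρ hρ1 (inv_pos.2 hx0)
      ((inv_lt_one_of_one_lt₀ hx).trans hx) hJ hJ0 rfl)
  refine le_trans (le_of_eq ?_) hle
  rw [Real.rpow_neg (by positivity), ← Real.inv_rpow (by positivity), inv_div]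
  ring

end Bliss

/-! ### Bliss's inequality -/

/-- The sharp constant in Bliss's inequality. -/
def blissConst (p κ b : ℝ) : ℝ :=
  blissMass p κ b / ((b + κ) * (p - 1) * κ ^ (p - 1) * blissMass p κ b) ^ ((b + κ) / κ)

instance isFiniteMeasure_weightMeasure {a : ℝ} [Fact (-1 < a)] :
    IsFiniteMeasure (weightMeasure a) := by
  refine ⟨?_⟩
  rw [weightMeasure, withDensity_apply _ MeasurableSet.univ, Measure.restrict_univ,
    lintegral_Ioo_rpow Fact.out zero_le_one]
  exact ENNReal.ofReal_lt_top

section Bliss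

variable {p κ b : ℝ}

lemma blissConst_pos (hp : 1 < p) (hκ : 0 < κ) (hb : 0 < b) : 0 < blissConst p κ b := by
  have hM := blissMass_pos hp hκ hb
  have hp1 : 0 < p - 1 := by linarith
  unfold blissConst; positivity

lemma tail_eq_intervalIntegral (g : ℝ → ℝ) {r : ℝ} (hr : r ≤ 1) : tail g r = ∫ s in r..1, g s := by
  rw [tail, ← integral_Ioc_eq_integral_Ioo, intervalIntegral.integral_of_le hr]

lemma bliss_continuous_lintegral (hp : 1 < p) (hκ : 0 < κ) (hb : 0 < b) {g : ℝ → ℝ}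
    (hg : Continuous g) (hg0 : ∀ s, 0 ≤ g s) {ρ : ℝ} (hρ : 0 < ρ) (hρ1 : ρ < 1) :
    ∫⁻ r in Ioo ρ 1, ENNReal.ofReal
        (r ^ ((b + κ) * (p - 1) - 1) * tail g r ^ ((b + κ) * p / κ)) ≤
      ENNReal.ofReal (blissConst p κ b) *
        energyOn p ((κ + 1) * (p - 1)) g (Ioo 0 1) ^ ((b + κ) / κ) := by
  have hM := blissMass_pos hp hκ hb
  have hp0 : 0 < p := by linarith
  have hp1 : 0 < p - 1 := by linarith
  have huc : Continuous fun r : ℝ => ∫ s in r..1, g s := by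
    have h : (fun r : ℝ => ∫ s in r..1, g s) = fun r => -∫ s in (1 : ℝ)..r, g s := by
      ext r; rw [intervalIntegral.integral_symm]
    rw [h]
    exact (intervalIntegral.continuous_primitive (fun a b => hg.intervalIntegrable a b) 1).neg
  have hJc : ContinuousOn (fun r : ℝ => r ^ ((b + κ) * (p - 1) - 1) *
      (∫ s in r..1, g s) ^ ((b + κ) * p / κ)) (Icc ρ 1) := fun r hr =>
    ((Real.continuousAt_rpow_const _ _ (Or.inl (hρ.trans_le hr.1).ne')).mul
      (huc.continuousAt.rpow_const (Or.inr (by positivity)))).continuousWithinAt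
  have hEc : ContinuousOn (fun r : ℝ => r ^ ((κ + 1) * (p - 1)) * g r ^ p) (Icc ρ 1) := fun r hr =>
    ((Real.continuousAt_rpow_const _ _ (Or.inl (hρ.trans_le hr.1).ne')).mul
      (hg.continuousAt.rpow_const (Or.inr hp0.le))).continuousWithinAt
  have hconv : ∀ f : ℝ → ℝ, ContinuousOn f (Icc ρ 1) → (∀ r ∈ Icc ρ 1, 0 ≤ f r) →
      ∫⁻ r in Ioo ρ 1, ENNReal.ofReal (f r) = ENNReal.ofReal (∫ r in ρ..1, f r) := by
    intro f hf hf0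
    rw [intervalIntegral.integral_of_le hρ1.le, integral_Ioc_eq_integral_Ioo,
      ofReal_integral_eq_lintegral_ofReal (hf.integrableOn_Icc.mono_set Ioo_subset_Icc_self)]
    exact (ae_restrict_iff' measurableSet_Ioo).2
      (.of_forall fun r hr => hf0 r (Ioo_subset_Icc_self hr))
  have hJ0 : ∀ r ∈ Icc ρ 1, 0 ≤ r ^ ((b + κ) * (p - 1) - 1) *
      (∫ s in r..1, g s) ^ ((b + κ) * p / κ) := fun r hr =>
    mul_nonneg (Real.rpow_nonneg (hρ.le.trans hr.1) _)
      (Real.rpow_nonneg (intervalIntegral.integral_nonneg hr.2 fun s _ => hg0 s) _)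
  have hE0 : ∀ r ∈ Icc ρ 1, 0 ≤ r ^ ((κ + 1) * (p - 1)) * g r ^ p := fun r hr =>
    mul_nonneg (Real.rpow_nonneg (hρ.le.trans hr.1) _) (Real.rpow_nonneg (hg0 r) _)
  have hL : ∫⁻ r in Ioo ρ 1, ENNReal.ofReal
        (r ^ ((b + κ) * (p - 1) - 1) * tail g r ^ ((b + κ) * p / κ)) =
      ENNReal.ofReal (∫ r in ρ..1, r ^ ((b + κ) * (p - 1) - 1) *
        (∫ s in r..1, g s) ^ ((b + κ) * p / κ)) := by
    rw [← hconv _ hJc hJ0]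
    exact setLIntegral_congr_fun measurableSet_Ioo fun r hr => by
      rw [tail_eq_intervalIntegral g hr.2.le]
  have hR : ENNReal.ofReal (∫ r in ρ..1, r ^ ((κ + 1) * (p - 1)) * g r ^ p) ≤
      energyOn p ((κ + 1) * (p - 1)) g (Ioo 0 1) := by
    rw [← hconv _ hEc hE0]
    refine le_trans (le_of_eq ?_) (energyOn_mono p _ g (Ioo_subset_Ioo_left hρ.le))
    exact setLIntegral_congr_fun measurableSet_Ioo fun r hr => by rw [abs_of_nonneg (hg0 r)]
  have hmain := bliss_continuous hp hκ hb hg hg0 hρ hρ1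
  set J := ∫ r in ρ..1, r ^ ((b + κ) * (p - 1) - 1) * (∫ s in r..1, g s) ^ ((b + κ) * p / κ)
  set E := ∫ r in ρ..1, r ^ ((κ + 1) * (p - 1)) * g r ^ p
  have hJn : 0 ≤ J := intervalIntegral.integral_nonneg hρ1.le hJ0
  have hEn : 0 ≤ E := intervalIntegral.integral_nonneg hρ1.le hE0
  rw [hL]
  have hK : 0 < (b + κ) * (p - 1) * κ ^ (p - 1) * blissMass p κ b := by positivity
  have hJE : J ≤ blissConst p κ b * E ^ ((b + κ) / κ) := by
    have h1 : (J / blissMass p κ b) ^ (κ / (b + κ)) ≤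
        E / ((b + κ) * (p - 1) * κ ^ (p - 1) * blissMass p κ b) := by
      rw [le_div_iff₀ hK]; linarith
    have h2 := Real.rpow_le_rpow (by positivity) h1 (show 0 ≤ (b + κ) / κ by positivity)
    rw [← Real.rpow_mul (by positivity), show κ / (b + κ) * ((b + κ) / κ) = 1 by field_simp,
      Real.rpow_one, Real.div_rpow hEn hK.le, div_le_iff₀ hM] at h2
    refine h2.trans (le_of_eq ?_)
    unfold blissConst
    ring
  refine (ENNReal.ofReal_le_ofReal hJE).trans ?_
  rw [ENNReal.ofReal_mul (blissConst_pos hp hκ hb).le,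
    ← ENNReal.ofReal_rpow_of_nonneg hEn (by positivity)]
  gcongr

/-- **Bliss's inequality**, with its sharp constant. -/
theorem bliss_inequality (hp : 1 < p) (hκ : 0 < κ) (hb : 0 < b) {g : ℝ → ℝ}
    (hg : AEMeasurable g (volume.restrict (Ioo (0 : ℝ) 1))) (hg0 : ∀ s, 0 ≤ g s) :
    ∫⁻ r in Ioo (0 : ℝ) 1, ENNReal.ofReal
        (r ^ ((b + κ) * (p - 1) - 1) * tail g r ^ ((b + κ) * p / κ)) ≤
      ENNReal.ofReal (blissConst p κ b) *
        energyOn p ((κ + 1) * (p - 1)) g (Ioo 0 1) ^ ((b + κ) / κ) := by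
  have hp0 : 0 < p := by linarith
  have hp1 : 0 < p - 1 := by linarith
  have hC := blissConst_pos hp hκ hb
  set a := (κ + 1) * (p - 1) with ha
  have ha1 : p - 1 < a := by rw [ha]; nlinarith
  have : Fact (-1 < a) := ⟨by linarith⟩
  have hq0 : 0 < (b + κ) * p / κ := by positivity
  rcases eq_or_ne (energyOn p a g (Ioo 0 1)) ∞ with hE | hE
  · rw [hE, ENNReal.top_rpow_of_pos (by positivity), ENNReal.mul_top (by simpa using hC)]
    exact le_top
  have hmem : MemLp g (ENNReal.ofReal p) (weightMeasure a) :=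
    (memLp_weightMeasure_iff hp0).2 ⟨hg, hE.lt_top⟩
  have hpos : ∀ k : ℕ, ENNReal.ofReal (1 / ((k : ℝ) + 1)) ≠ 0 := fun k => by
    simp only [ne_eq, ENNReal.ofReal_eq_zero, not_le]; positivity
  choose h hhs hh hhc hhm using fun k : ℕ =>
    hmem.exists_hasCompactSupport_eLpNorm_sub_le ENNReal.ofReal_ne_top (hpos k)
  set g' : ℕ → ℝ → ℝ := fun k s => |h k s| with hg'
  have hg'c : ∀ k, Continuous (g' k) := fun k => (hhc k).abs
  have hsub : ∀ k, eLpNorm (g - g' k) (ENNReal.ofReal p) (weightMeasure a) ≤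
      ENNReal.ofReal (1 / ((k : ℝ) + 1)) := by
    intro k
    refine (eLpNorm_mono fun s => ?_).trans (hh k)
    simp only [Pi.sub_apply, Real.norm_eq_abs, hg']
    rw [← abs_of_nonneg (hg0 s)]
    simpa only [abs_abs] using abs_abs_sub_abs_le (|g s|) (h k s)
  have hg'm : ∀ k, AEMeasurable (g' k) (volume.restrict (Ioo (0 : ℝ) 1)) :=
    fun k => (hg'c k).aemeasurable
  have hg'E : ∀ k, energyOn p a (g' k) (Ioo 0 1) < ∞ := fun k =>
    ((memLp_weightMeasure_iff hp0).1 (hhm k).abs).2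
  -- Pointwise convergence of the primitives.
  have htail : ∀ r ∈ Ioo (0 : ℝ) 1, Tendsto (fun k => tail (g' k) r) atTop (𝓝 (tail g r)) := by
    intro r hr
    rw [tendsto_iff_dist_tendsto_zero]
    have hb : Tendsto (fun n : ℕ => tailConst p a * r ^ (-((a - p + 1) / p)) * (1 / ((n : ℝ) + 1)))
        atTop (𝓝 0) := by
      simpa using (tendsto_one_div_add_atTop_nhds_zero_nat (𝕜 := ℝ)).const_mul
        (tailConst p a * r ^ (-((a - p + 1) / p)))
    refine squeeze_zero (fun _ => dist_nonneg) (fun k => ?_) hb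
    have e1 : tail g r - tail (g' k) r = tail (g - g' k) r :=
      (integral_sub (integrableOn_of_energyOn_lt_top hp ha1 hg hE.lt_top hr.1)
        (integrableOn_of_energyOn_lt_top hp ha1 (hg'm k) (hg'E k) hr.1)).symm
    have h0 : (0 : ℝ) ≤ 1 / ((k : ℝ) + 1) := by positivity
    have hen : energyOn p a (g - g' k) (Ioo r 1) ≤ ENNReal.ofReal ((1 / ((k : ℝ) + 1)) ^ p) := by
      refine (energyOn_mono p a _ (Ioo_subset_Ioo_left hr.1.le)).trans ?_
      rw [← eLpNorm_rpow_eq_energyOn hp0, ← ENNReal.ofReal_rpow_of_nonneg h0 hp0.le]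
      exact ENNReal.rpow_le_rpow (hsub k) hp0.le
    have := abs_tail_le hp ha1 (hg.sub (hg'm k)) hr.1 (by positivity) hen
    rw [dist_comm, Real.dist_eq, e1]
    rwa [← Real.rpow_mul h0, mul_one_div_cancel hp0.ne', Real.rpow_one] at this
  set F : ℕ → ℝ → ℝ≥0∞ := fun k => (Ioi (1 / ((k : ℝ) + 2))).indicator fun r =>
    ENNReal.ofReal (r ^ ((b + κ) * (p - 1) - 1) * tail (g' k) r ^ ((b + κ) * p / κ)) with hF
  have hFm : ∀ k, AEMeasurable (F k) (volume.restrict (Ioo (0 : ℝ) 1)) := by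
    intro k
    refine AEMeasurable.indicator ?_ measurableSet_Ioi
    have hc : ContinuousOn (tail (g' k)) (Ioo 0 1) := fun r hr =>
      ((continuousOn_tail (fun r hr => integrableOn_of_energyOn_lt_top hp ha1 (hg'm k) (hg'E k) hr)
        (c := r / 2) (by linarith [hr.1]) (by linarith [hr.1, hr.2])).mono
        Ioo_subset_Icc_self).continuousAt (Ioo_mem_nhds (by linarith [hr.1]) hr.2)
          |>.continuousWithinAt
    have := hc.aemeasurable (μ := volume) measurableSet_Ioo
    fun_prop
  have hFlim : ∀ r ∈ Ioo (0 : ℝ) 1, Tendsto (fun k => F k r) atTop (𝓝 (ENNReal.ofReal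
      (r ^ ((b + κ) * (p - 1) - 1) * tail g r ^ ((b + κ) * p / κ)))) := by
    intro r hr
    have h1 := ENNReal.tendsto_ofReal ((((htail r hr).rpow_const
      (p := (b + κ) * p / κ) (Or.inr hq0.le)).const_mul (r ^ ((b + κ) * (p - 1) - 1))))
    refine h1.congr' ?_
    have h2 : Tendsto (fun k : ℕ => 1 / ((k : ℝ) + 2)) atTop (𝓝 0) := by
      have := tendsto_const_nhds (x := (1 : ℝ)).div_atTop
        (tendsto_atTop_add_const_right atTop (2 : ℝ) tendsto_natCast_atTop_atTop)
      exact this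
    filter_upwards [h2.eventually_lt_const hr.1] with k hk
    simp only [hF]
    rw [indicator_of_mem (mem_Ioi.2 hk)]
  have hFle : ∀ k, ∫⁻ r in Ioo (0 : ℝ) 1, F k r ≤ ENNReal.ofReal (blissConst p κ b) *
      (eLpNorm g (ENNReal.ofReal p) (weightMeasure a) + ENNReal.ofReal (1 / ((k : ℝ) + 1))) ^
        ((b + κ) * p / κ) := by
    intro k
    have hρ0 : (0 : ℝ) < 1 / ((k : ℝ) + 2) := by positivity
    have hρ1 : 1 / ((k : ℝ) + 2) < 1 := by
      rw [div_lt_one (by positivity)]; linarith [Nat.cast_nonneg (α := ℝ) k]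
    have h1 : ∫⁻ r in Ioo (0 : ℝ) 1, F k r = ∫⁻ r in Ioo (1 / ((k : ℝ) + 2)) 1, ENNReal.ofReal
        (r ^ ((b + κ) * (p - 1) - 1) * tail (g' k) r ^ ((b + κ) * p / κ)) := by
      rw [lintegral_indicator measurableSet_Ioi, Measure.restrict_restrict measurableSet_Ioi]
      congr 2
      ext x; simp only [mem_inter_iff, mem_Ioi, mem_Ioo]
      exact ⟨fun h => ⟨h.1, h.2.2⟩, fun h => ⟨h.1, hρ0.trans h.1, h.2⟩⟩
    rw [h1]
    refine (bliss_continuous_lintegral hp hκ hb (hg'c k) (fun s => abs_nonneg _) hρ0 hρ1).trans ?_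
    rw [← ha, ← eLpNorm_rpow_eq_energyOn hp0, ← ENNReal.rpow_mul,
      show p * ((b + κ) / κ) = (b + κ) * p / κ by ring]
    gcongr
    calc eLpNorm (g' k) (ENNReal.ofReal p) (weightMeasure a) =
          eLpNorm (g - (g - g' k)) (ENNReal.ofReal p) (weightMeasure a) := by rw [sub_sub_cancel]
      _ ≤ _ := eLpNorm_sub_le hmem.1 (hmem.sub (hhm k).abs).1 (by simpa using hp.le)
      _ ≤ _ := by gcongr; exact hsub k
  have hlim : Tendsto (fun k : ℕ => ENNReal.ofReal (blissConst p κ b) *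
      (eLpNorm g (ENNReal.ofReal p) (weightMeasure a) + ENNReal.ofReal (1 / ((k : ℝ) + 1))) ^
        ((b + κ) * p / κ)) atTop (𝓝 (ENNReal.ofReal (blissConst p κ b) *
          (eLpNorm g (ENNReal.ofReal p) (weightMeasure a) + ENNReal.ofReal 0) ^
            ((b + κ) * p / κ))) := by
    refine ENNReal.Tendsto.const_mul ?_ (Or.inr ENNReal.ofReal_ne_top)
    refine ((ENNReal.continuous_rpow_const).tendsto _).comp ?_
    exact tendsto_const_nhds.add
      (ENNReal.tendsto_ofReal (tendsto_one_div_add_atTop_nhds_zero_nat (𝕜 := ℝ)))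
  calc _ = ∫⁻ r in Ioo (0 : ℝ) 1, liminf (fun k => F k r) atTop :=
        setLIntegral_congr_fun measurableSet_Ioo fun r hr => (hFlim r hr).liminf_eq.symm
    _ ≤ liminf (fun k => ∫⁻ r in Ioo (0 : ℝ) 1, F k r) atTop := lintegral_liminf_le' hFm
    _ ≤ liminf (fun k : ℕ => ENNReal.ofReal (blissConst p κ b) *
      (eLpNorm g (ENNReal.ofReal p) (weightMeasure a) + ENNReal.ofReal (1 / ((k : ℝ) + 1))) ^
        ((b + κ) * p / κ)) atTop := liminf_le_liminf (.of_forall hFle)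
    _ = _ := by
      rw [hlim.liminf_eq, ENNReal.ofReal_zero, add_zero, ← eLpNorm_rpow_eq_energyOn hp0,
        ← ENNReal.rpow_mul, show p * ((b + κ) / κ) = (b + κ) * p / κ by ring]

end Bliss

/-! ### Compactness of primitives -/

section Compactness

variable {p a : ℝ}

lemma integrableOn_tail (hp : 1 < p) (ha : p - 1 < a) {g : ℝ → ℝ} (hg : Measurable g)
    (hE : energyOn p a g (Ioo 0 1) ≤ 1) : ∀ r, 0 < r → IntegrableOn g (Ioo r 1) := fun _ hr =>
  integrableOn_of_energyOn_lt_top hp ha hg.aemeasurable (hE.trans_lt ENNReal.one_lt_top) hr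

lemma ofReal_dist_tail {g : ℝ → ℝ} (hg0 : ∀ s, 0 ≤ g s)
    (hi : ∀ r, 0 < r → IntegrableOn g (Ioo r 1)) {x y : ℝ} (hx : 0 < x) (hx1 : x ≤ 1) (hy : 0 < y)
    (hy1 : y ≤ 1) :
    ENNReal.ofReal (dist (tail g x) (tail g y)) = ∫⁻ s in uIoc x y, ENNReal.ofReal (g s) := by
  wlog hxy : x ≤ y generalizing x y
  · rw [dist_comm, uIoc_comm]; exact this hy hy1 hx hx1 (le_of_not_ge hxy)
  have h := tail_eq_sub (hi x hx) ⟨hxy, hy1⟩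
  have hI := intervalIntegrable_of_tail hi hx hxy hy1
  have h0 : 0 ≤ ∫ s in x..y, g s := intervalIntegral.integral_nonneg hxy fun s _ => hg0 s
  rw [Real.dist_eq, h, sub_sub_cancel, abs_of_nonneg h0, intervalIntegral.integral_of_le hxy,
    uIoc_of_le hxy, ofReal_integral_eq_lintegral_ofReal]
  · exact (intervalIntegrable_iff_integrableOn_Ioc_of_le hxy).1 hI
  · exact .of_forall hg0

/-- Either `x` is below the threshold `η ^ (-1 / (p - 1))`, or `η x ^ p` exceeds `x`. -/
lemma le_mul_rpow_add (hp : 1 < p) {η x : ℝ} (hη : 0 < η) (hx : 0 ≤ x) :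
    x ≤ η * x ^ p + η ^ (-(1 / (p - 1))) := by
  have hp1 : 0 < p - 1 := by linarith
  rcases le_total x (η ^ (-(1 / (p - 1)))) with h | h
  · have : 0 ≤ η * x ^ p := by positivity
    linarith
  · have hx0 : 0 < x := lt_of_lt_of_le (by positivity) h
    have h1 := Real.rpow_le_rpow (by positivity) h hp1.le
    rw [← Real.rpow_mul hη.le, show -(1 / (p - 1)) * (p - 1) = -1 by field_simp,
      Real.rpow_neg_one, Real.rpow_sub_one hx0.ne', le_div_iff₀ hx0, inv_mul_le_iff₀ hη] at h1
    have : 0 ≤ η ^ (-(1 / (p - 1))) := by positivity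
    linarith

/-- Primitives of functions of energy at most one are absolutely continuous on `[c, 1]`, uniformly.
-/
lemma sum_dist_tail_le (hp : 1 < p) (ha : p - 1 < a) {g : ℝ → ℝ} (hg : Measurable g)
    (hg0 : ∀ s, 0 ≤ g s) (hE : energyOn p a g (Ioo 0 1) ≤ 1) {c d η : ℝ} (hc : 0 < c) (hcd : c ≤ d)
    (hd : d ≤ 1) (hη : 0 < η) {E : ℕ × (ℕ → ℝ × ℝ)}
    (hEm : E ∈ AbsolutelyContinuousOnInterval.disjWithin c d) :
    ∑ i ∈ Finset.range E.1, dist (tail g (E.2 i).1) (tail g (E.2 i).2) ≤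
      η * c ^ (-a) +
        η ^ (-(1 / (p - 1))) * ∑ i ∈ Finset.range E.1, dist (E.2 i).1 (E.2 i).2 := by
  have hi := integrableOn_tail hp ha hg hE
  have ha0 : 0 < a := by linarith
  have hmem := hEm.1
  rw [uIcc_of_le hcd] at hmem
  set C := η ^ (-(1 / (p - 1))) with hC
  have hC0 : 0 ≤ C := by positivity
  have hsum0 : 0 ≤ ∑ i ∈ Finset.range E.1, dist (E.2 i).1 (E.2 i).2 :=
    Finset.sum_nonneg fun _ _ => dist_nonneg
  rw [← ENNReal.ofReal_le_ofReal_iff (by positivity),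
    ENNReal.ofReal_sum_of_nonneg fun _ _ => dist_nonneg, ENNReal.ofReal_add (by positivity)
    (by positivity), ENNReal.ofReal_mul hC0, ENNReal.ofReal_sum_of_nonneg fun _ _ => dist_nonneg]
  have h1 : ∀ i ∈ Finset.range E.1, ENNReal.ofReal (dist (tail g (E.2 i).1) (tail g (E.2 i).2)) ≤
      (∫⁻ s in uIoc (E.2 i).1 (E.2 i).2, ENNReal.ofReal (η * c ^ (-a) * (s ^ a * |g s| ^ p))) +
        ENNReal.ofReal C * ENNReal.ofReal (dist (E.2 i).1 (E.2 i).2) := by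
    intro i hi'
    obtain ⟨hm1, hm2⟩ := hmem i hi'
    rw [ofReal_dist_tail hg0 hi (hc.trans_le hm1.1) (hm1.2.trans hd) (hc.trans_le hm2.1)
      (hm2.2.trans hd)]
    have hvol : ENNReal.ofReal (dist (E.2 i).1 (E.2 i).2) =
        volume (uIoc (E.2 i).1 (E.2 i).2) := by
      rw [uIoc, Real.volume_Ioc, max_sub_min_eq_abs', Real.dist_eq]
    rw [hvol, ← setLIntegral_const, ← lintegral_add_left (by fun_prop)]
    refine setLIntegral_mono' measurableSet_uIoc fun s hs => ?_
    have hsc : c ≤ s := (le_min hm1.1 hm2.1).trans hs.1.le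
    have hs0 : 0 < s := hc.trans_le hsc
    rw [← ENNReal.ofReal_add (by positivity) hC0]
    refine ENNReal.ofReal_le_ofReal ((le_mul_rpow_add hp hη (hg0 s)).trans ?_)
    rw [abs_of_nonneg (hg0 s)]
    have h2 : 1 ≤ c ^ (-a) * s ^ a := by
      rw [Real.rpow_neg hc.le, ← div_eq_inv_mul, one_le_div (by positivity)]
      exact Real.rpow_le_rpow hc.le hsc ha0.le
    have h3 : 0 ≤ η * g s ^ p := mul_nonneg hη.le (Real.rpow_nonneg (hg0 s) p)
    have h4 := mul_le_mul_of_nonneg_left h2 h3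
    have h5 : η * c ^ (-a) * (s ^ a * g s ^ p) = η * g s ^ p * (c ^ (-a) * s ^ a) := by ring
    rw [h5]; linarith
  refine (Finset.sum_le_sum h1).trans ?_
  rw [Finset.sum_add_distrib, ← Finset.mul_sum]
  refine add_le_add ?_ le_rfl
  rw [← lintegral_biUnion_finset (s := Finset.range E.1)
    (t := fun i => uIoc (E.2 i).1 (E.2 i).2) hEm.2 (fun _ _ => measurableSet_uIoc)]
  have hsub : (⋃ i ∈ Finset.range E.1, uIoc (E.2 i).1 (E.2 i).2) ⊆ Ioc c d := by
    have := AbsolutelyContinuousOnInterval.biUnion_uIoc_subset_of_mem_disjWithin (n := E.1)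
      (I := E.2) hEm
    rwa [uIoc_of_le hcd] at this
  have hcp : (0 : ℝ) ≤ η * c ^ (-a) := by positivity
  calc _ ≤ ∫⁻ s in Ioc c d, ENNReal.ofReal (η * c ^ (-a) * (s ^ a * |g s| ^ p)) :=
        lintegral_mono_set hsub
    _ ≤ ∫⁻ s in Ioc 0 1, ENNReal.ofReal (η * c ^ (-a) * (s ^ a * |g s| ^ p)) :=
        lintegral_mono_set (Ioc_subset_Ioc hc.le hd)
    _ = ENNReal.ofReal (η * c ^ (-a)) * energyOn p a g (Ioo 0 1) := by
        simp_rw [ENNReal.ofReal_mul hcp]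
        rw [lintegral_const_mul' _ _ ENNReal.ofReal_ne_top, energyOn, restrict_Ioo_eq_restrict_Ioc]
    _ ≤ _ := mul_le_of_le_one_right zero_le hE

lemma dist_tail_le (hp : 1 < p) (ha : p - 1 < a) {g : ℝ → ℝ} (hg : Measurable g)
    (hg0 : ∀ s, 0 ≤ g s) (hE : energyOn p a g (Ioo 0 1) ≤ 1) {c η x y : ℝ} (hc : 0 < c) (hη : 0 < η)
    (hx : x ∈ Icc c 1) (hy : y ∈ Icc c 1) :
    dist (tail g x) (tail g y) ≤ η * c ^ (-a) + η ^ (-(1 / (p - 1))) * dist x y := by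
  have h := sum_dist_tail_le hp ha hg hg0 hE hc (hx.1.trans hx.2) le_rfl hη
    (E := (1, fun _ => (x, y))) ⟨fun i _ => ?_, ?_⟩
  · simpa using h
  · rw [uIcc_of_le (hx.1.trans hx.2)]; exact ⟨hx, hy⟩
  · intro i hi j hj hij
    simp only [Finset.coe_range, mem_Iio] at hi hj
    omega

lemma exists_forall_dist_tail_lt (hp : 1 < p) (ha : p - 1 < a) {c ε : ℝ} (hc : 0 < c) (hε : 0 < ε) :
    ∃ δ > 0, ∀ g : ℝ → ℝ, Measurable g → (∀ s, 0 ≤ g s) → energyOn p a g (Ioo 0 1) ≤ 1 →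
      ∀ x ∈ Icc c 1, ∀ y ∈ Icc c 1, dist x y < δ → dist (tail g x) (tail g y) < ε := by
  set η := ε / 2 * c ^ a with hη
  have hη0 : 0 < η := by positivity
  set C := η ^ (-(1 / (p - 1))) with hC
  have hC0 : 0 < C := by positivity
  refine ⟨ε / (2 * C), by positivity, fun g hg hg0 hE x hx y hy hxy => ?_⟩
  refine (dist_tail_le hp ha hg hg0 hE hc hη0 hx hy).trans_lt ?_
  have h1 : η * c ^ (-a) = ε / 2 := by
    rw [hη, mul_assoc, ← Real.rpow_add hc]; simp
  have h2 : C * dist x y < ε / 2 := by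
    calc C * dist x y < C * (ε / (2 * C)) := by gcongr
      _ = ε / 2 := by field_simp
  rw [h1]; linarith

/-- Selection: a sequence of primitives of functions of energy at most one has a subsequence
converging everywhere on `(0, 1)`, by a diagonal argument over the rationals and equicontinuity. -/
lemma exists_subseq_tendsto_tail (hp : 1 < p) (ha : p - 1 < a) {g : ℕ → ℝ → ℝ}
    (hg : ∀ n, Measurable (g n)) (hg0 : ∀ n s, 0 ≤ g n s)
    (hE : ∀ n, energyOn p a (g n) (Ioo 0 1) ≤ 1) :
    ∃ φ : ℕ → ℕ, StrictMono φ ∧ ∃ u : ℝ → ℝ, ∀ r ∈ Ioo (0 : ℝ) 1,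
      Tendsto (fun n => tail (g (φ n)) r) atTop (𝓝 (u r)) := by
  classical
  set K : Set (ℚ → ℝ) := Set.pi univ fun q : ℚ =>
    Icc 0 |tailConst p a * (q : ℝ) ^ (-((a - p + 1) / p)) * 1 ^ (1 / p)| with hK
  set v : ℕ → ℚ → ℝ := fun n q => if (0 : ℝ) < q then tail (g n) q else 0 with hv
  have hKne : ∀ n, v n ∈ K := by
    intro n q _
    simp only [hv]
    split_ifs with hq
    · refine ⟨tail_nonneg (hg0 n) _, (le_abs_self _).trans (le_trans ?_ (le_abs_self _))⟩
      refine abs_tail_le hp ha (hg n).aemeasurable hq zero_le_one ?_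
      rw [ENNReal.ofReal_one]
      exact (energyOn_mono p a _ (Ioo_subset_Ioo_left hq.le)).trans (hE n)
    · exact ⟨le_rfl, abs_nonneg _⟩
  obtain ⟨w, -, φ, hφ, hw⟩ := (isCompact_univ_pi fun q : ℚ => isCompact_Icc).tendsto_subseq hKne
  refine ⟨φ, hφ, ?_⟩
  have hex : ∀ r ∈ Ioo (0 : ℝ) 1, ∃ l, Tendsto (fun n => tail (g (φ n)) r) atTop (𝓝 l) := by
    intro r hr
    refine cauchySeq_tendsto_of_complete (Metric.cauchySeq_iff'.2 fun ε hε => ?_)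
    have hr2 : 0 < r / 2 := by linarith [hr.1]
    obtain ⟨δ, hδ, H⟩ := exists_forall_dist_tail_lt hp ha hr2 (show 0 < ε / 3 by positivity)
    obtain ⟨q, hq1, hq2⟩ := exists_rat_btwn (show r < min (r + δ) 1 from
      lt_min (by linarith) hr.2)
    have hq0 : (0 : ℝ) < q := hr.1.trans hq1
    have hcq := (tendsto_pi_nhds.1 hw q).cauchySeq
    obtain ⟨N, hN⟩ := Metric.cauchySeq_iff'.1 hcq (ε / 3) (by positivity)
    refine ⟨N, fun n hn => ?_⟩
    have h1 := hN n hn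
    simp only [Function.comp_apply, hv, hq0, if_true] at h1
    have hrm : r ∈ Icc (r / 2) 1 := ⟨by linarith, hr.2.le⟩
    have hqm : (q : ℝ) ∈ Icc (r / 2) 1 := ⟨by linarith, (hq2.trans_le (min_le_right _ _)).le⟩
    have hd : dist r q < δ := by
      rw [dist_comm, Real.dist_eq, abs_of_pos (by linarith)]
      linarith [hq2.trans_le (min_le_left _ _)]
    have h2 := H _ (hg (φ n)) (hg0 _) (hE _) r hrm q hqm hd
    have h3 := H _ (hg (φ N)) (hg0 _) (hE _) r hrm q hqm hd
    rw [dist_comm] at h3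
    calc dist (tail (g (φ n)) r) (tail (g (φ N)) r) ≤ dist (tail (g (φ n)) r) (tail (g (φ n)) q) +
          dist (tail (g (φ n)) q) (tail (g (φ N)) q) + dist (tail (g (φ N)) q) (tail (g (φ N)) r) :=
          dist_triangle4 _ _ _ _
      _ < ε := by linarith
  choose! u hu using hex
  exact ⟨u, hu⟩

/-- Difference quotients do not increase the energy, because the weight `r ^ a` is increasing. -/
lemma lintegral_slope_tail_le (hp : 1 < p) (ha : p - 1 < a) {g : ℝ → ℝ} (hg : Measurable g)
    (hg0 : ∀ s, 0 ≤ g s) (hE : energyOn p a g (Ioo 0 1) ≤ 1) {ρ h : ℝ} (hρ : 0 ≤ ρ) (hh : 0 < h) :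
    ∫⁻ r in Ioo ρ (1 - h), ENNReal.ofReal (r ^ a * |(tail g (r + h) - tail g r) / h| ^ p) ≤
      energyOn p a g (Ioo ρ 1) := by
  have hp0 : 0 < p := by linarith
  have hp1 : 0 < p - 1 := by linarith
  have ha0 : 0 < a := by linarith
  have hi := integrableOn_tail hp ha hg hE
  have hpq : p.HolderConjugate (p / (p - 1)) := Real.HolderConjugate.conjExponent hp
  set k : ℝ → ℝ≥0∞ := (Ioo ρ 1).indicator fun s => ENNReal.ofReal (s ^ a * |g s| ^ p) with hk
  have hkm : Measurable k := Measurable.indicator (by fun_prop) measurableSet_Ioo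
  have hkE : ∫⁻ s, k s = energyOn p a g (Ioo ρ 1) := lintegral_indicator measurableSet_Ioo _
  have hpt : ∀ r ∈ Ioo ρ (1 - h), ENNReal.ofReal (r ^ a * |(tail g (r + h) - tail g r) / h| ^ p) ≤
      ENNReal.ofReal (1 / h) * ∫⁻ t in Ioc 0 h, k (r + t) := by
    intro r hr
    have hr0 : 0 < r := hρ.trans_lt hr.1
    have hrh : r + h < 1 := by linarith [hr.2]
    have e1 : ENNReal.ofReal |tail g (r + h) - tail g r| =
        ∫⁻ t in Ioc 0 h, ENNReal.ofReal (g (r + t)) := by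
      have := ofReal_dist_tail hg0 hi (x := r + h) (y := r) (by linarith) hrh.le hr0 (by linarith)
      rw [Real.dist_eq] at this
      rw [this, uIoc_comm, uIoc_of_le (by linarith), ← lintegral_indicator measurableSet_Ioc,
        ← lintegral_indicator measurableSet_Ioc, ← lintegral_add_left_eq_self _ r]
      refine lintegral_congr fun t => ?_
      simp only [indicator, mem_Ioc]
      congr 1
      simp
    have e2 : ENNReal.ofReal |tail g (r + h) - tail g r| ^ p ≤
        ENNReal.ofReal (h ^ (p - 1)) * ∫⁻ t in Ioc 0 h, ENNReal.ofReal (g (r + t) ^ p) := by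
      have hH := ENNReal.lintegral_mul_le_Lp_mul_Lq (volume.restrict (Ioc 0 h)) hpq
        (f := fun t => ENNReal.ofReal (g (r + t))) (g := fun _ => 1)
        (by fun_prop) (by fun_prop)
      simp only [Pi.mul_apply, mul_one, ENNReal.one_rpow, lintegral_const, one_mul,
        Measure.restrict_apply MeasurableSet.univ, univ_inter, Real.volume_Ioc, sub_zero] at hH
      rw [← e1] at hH
      refine (ENNReal.rpow_le_rpow hH hp0.le).trans (le_of_eq ?_)
      rw [ENNReal.mul_rpow_of_nonneg _ _ hp0.le, ← ENNReal.rpow_mul, one_div_mul_cancel hp0.ne',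
        ENNReal.rpow_one, ← ENNReal.rpow_mul, mul_comm, ENNReal.ofReal_rpow_of_pos hh]
      congr 1
      · congr 2; field_simp
      · refine lintegral_congr fun t => ?_
        rw [ENNReal.ofReal_rpow_of_nonneg (hg0 _) hp0.le]
    have e3 : ENNReal.ofReal (r ^ a * |(tail g (r + h) - tail g r) / h| ^ p) =
        ENNReal.ofReal (r ^ a * h ^ (-p)) * ENNReal.ofReal |tail g (r + h) - tail g r| ^ p := by
      rw [ENNReal.ofReal_rpow_of_nonneg (abs_nonneg _) hp0.le, ← ENNReal.ofReal_mul (by positivity),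
        abs_div, abs_of_pos hh, Real.div_rpow (abs_nonneg _) hh.le, Real.rpow_neg hh.le]
      congr 1; ring
    rw [e3]
    calc _ ≤ ENNReal.ofReal (r ^ a * h ^ (-p)) * (ENNReal.ofReal (h ^ (p - 1)) *
          ∫⁻ t in Ioc 0 h, ENNReal.ofReal (g (r + t) ^ p)) := by gcongr
      _ = ENNReal.ofReal (1 / h) * ∫⁻ t in Ioc 0 h, ENNReal.ofReal (r ^ a * g (r + t) ^ p) := by
          have e4 : ∀ t, ENNReal.ofReal (r ^ a * g (r + t) ^ p) =
              ENNReal.ofReal (r ^ a) * ENNReal.ofReal (g (r + t) ^ p) := fun t =>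
            ENNReal.ofReal_mul (by positivity)
          simp_rw [e4]
          rw [lintegral_const_mul' _ _ ENNReal.ofReal_ne_top, ← mul_assoc, ← mul_assoc,
            ← ENNReal.ofReal_mul (by positivity), ← ENNReal.ofReal_mul (by positivity)]
          congr 2
          rw [mul_assoc, ← Real.rpow_add hh, show -p + (p - 1) = -1 by ring, Real.rpow_neg_one]
          ring
      _ ≤ _ := by
          refine mul_le_mul_right ?_ _
          refine setLIntegral_mono' measurableSet_Ioc fun t ht => ?_
          have hmem : r + t ∈ Ioo ρ 1 := ⟨by linarith [hr.1, ht.1], by linarith [ht.2]⟩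
          rw [hk, indicator_of_mem hmem, abs_of_nonneg (hg0 _)]
          refine ENNReal.ofReal_le_ofReal (mul_le_mul_of_nonneg_right ?_
            (Real.rpow_nonneg (hg0 _) _))
          exact Real.rpow_le_rpow hr0.le (by linarith [ht.1]) ha0.le
  calc _ ≤ ∫⁻ r in Ioo ρ (1 - h), ENNReal.ofReal (1 / h) * ∫⁻ t in Ioc 0 h, k (r + t) :=
        setLIntegral_mono' measurableSet_Ioo hpt
    _ ≤ ∫⁻ r, ENNReal.ofReal (1 / h) * ∫⁻ t in Ioc 0 h, k (r + t) := setLIntegral_le_lintegral _ _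
    _ = ENNReal.ofReal (1 / h) * ∫⁻ t in Ioc 0 h, ∫⁻ r, k (r + t) := by
        rw [lintegral_const_mul' _ _ ENNReal.ofReal_ne_top, lintegral_lintegral_swap]
        exact (hkm.comp (measurable_fst.add measurable_snd)).aemeasurable
    _ = ENNReal.ofReal (1 / h) * ∫⁻ t in Ioc 0 h, energyOn p a g (Ioo ρ 1) := by
        simp_rw [lintegral_add_right_eq_self k, hkE]
    _ = energyOn p a g (Ioo ρ 1) := by
        rw [setLIntegral_const, Real.volume_Ioc, sub_zero, mul_left_comm,
          ← ENNReal.ofReal_mul (by positivity), one_div_mul_cancel hh.ne', ENNReal.ofReal_one,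
          mul_one]

end Compactness

/-! ### Lower semicontinuity of the energy -/

section Compactness

variable {p a : ℝ}

lemma LocallyAC.continuousOn {u : ℝ → ℝ} (h : LocallyAC u) : ContinuousOn u (Ioo 0 1) := by
  intro r hr
  have h1 := (h (r / 2) ((r + 1) / 2) (by linarith [hr.1]) (by linarith [hr.1, hr.2])
    (by linarith [hr.2])).continuousOn
  rw [uIcc_of_le (by linarith [hr.1, hr.2])] at h1
  exact (h1.continuousAt (Icc_mem_nhds (by linarith [hr.1]) (by linarith [hr.2]))).continuousWithinAt

lemma LocallyAC.ae_differentiableAt {u : ℝ → ℝ} (h : LocallyAC u) :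
    ∀ᵐ r ∂volume.restrict (Ioo (0 : ℝ) 1), DifferentiableAt ℝ u r := by
  have h1 : ∀ n : ℕ, ∀ᵐ r : ℝ, r ∈ Icc (1 / ((n : ℝ) + 2)) (1 - 1 / ((n : ℝ) + 2)) →
      DifferentiableAt ℝ u r := by
    intro n
    have hn : (0 : ℝ) < (n : ℝ) + 2 := by positivity
    have hle : 1 / ((n : ℝ) + 2) ≤ 1 - 1 / ((n : ℝ) + 2) := by
      rw [le_sub_iff_add_le, ← add_div, div_le_one hn]
      linarith [Nat.cast_nonneg (α := ℝ) n]
    have h2 := (h (1 / ((n : ℝ) + 2)) (1 - 1 / ((n : ℝ) + 2)) (by positivity) hle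
      (by linarith [show 0 < 1 / ((n : ℝ) + 2) by positivity])).ae_differentiableAt
    rwa [uIcc_of_le hle] at h2
  rw [ae_restrict_iff' measurableSet_Ioo]
  filter_upwards [ae_all_iff.2 h1] with r hr hm
  have h2 : Tendsto (fun k : ℕ => 1 / ((k : ℝ) + 2)) atTop (𝓝 0) :=
    tendsto_const_nhds.div_atTop
      (tendsto_atTop_add_const_right atTop (2 : ℝ) tendsto_natCast_atTop_atTop)
  obtain ⟨n, hn1, hn2⟩ := ((h2.eventually_lt_const hm.1).and
    (h2.eventually_lt_const (sub_pos.2 hm.2))).exists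
  exact hr n ⟨hn1.le, by linarith⟩

section Limit

variable {g : ℕ → ℝ → ℝ} {u : ℝ → ℝ}

lemma locallyAC_of_tendsto_tail (hp : 1 < p) (ha : p - 1 < a) (hg : ∀ n, Measurable (g n))
    (hg0 : ∀ n s, 0 ≤ g n s) (hE : ∀ n, energyOn p a (g n) (Ioo 0 1) ≤ 1)
    (hu : ∀ r ∈ Ioo (0 : ℝ) 1, Tendsto (fun n => tail (g n) r) atTop (𝓝 (u r))) :
    LocallyAC u := by
  intro c d hc hcd hd
  rw [absolutelyContinuousOnInterval_iff]
  intro ε hε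
  set η := ε / 4 * c ^ a with hη
  have hη0 : 0 < η := by positivity
  set C := η ^ (-(1 / (p - 1))) with hC
  have hC0 : 0 < C := by positivity
  refine ⟨ε / (4 * C), by positivity, fun E hEm hEd => ?_⟩
  have hmem := hEm.1
  rw [uIcc_of_le hcd] at hmem
  have hlim : Tendsto (fun n => ∑ i ∈ Finset.range E.1,
      dist (tail (g n) (E.2 i).1) (tail (g n) (E.2 i).2)) atTop
      (𝓝 (∑ i ∈ Finset.range E.1, dist (u (E.2 i).1) (u (E.2 i).2))) := by
    refine tendsto_finsetSum _ fun i hi => ?_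
    obtain ⟨h1, h2⟩ := hmem i hi
    exact (hu _ ⟨hc.trans_le h1.1, h1.2.trans_lt hd⟩).dist
      (hu _ ⟨hc.trans_le h2.1, h2.2.trans_lt hd⟩)
  have hle := le_of_tendsto' hlim fun n =>
    sum_dist_tail_le hp ha (hg n) (hg0 n) (hE n) hc hcd hd.le hη0 hEm
  refine hle.trans_lt ?_
  have h1 : η * c ^ (-a) = ε / 4 := by
    rw [hη, mul_assoc, ← Real.rpow_add hc]; simp
  have h2 : C * ∑ i ∈ Finset.range E.1, dist (E.2 i).1 (E.2 i).2 < ε / 4 := by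
    calc _ < C * (ε / (4 * C)) := by gcongr
      _ = ε / 4 := by field_simp
  rw [h1]; linarith

lemma tendsto_one_of_tendsto_tail (hp : 1 < p) (ha : p - 1 < a) (hg : ∀ n, Measurable (g n))
    (hg0 : ∀ n s, 0 ≤ g n s) (hE : ∀ n, energyOn p a (g n) (Ioo 0 1) ≤ 1)
    (hu : ∀ r ∈ Ioo (0 : ℝ) 1, Tendsto (fun n => tail (g n) r) atTop (𝓝 (u r))) :
    Tendsto u (𝓝[<] 1) (𝓝 0) := by
  rw [Metric.tendsto_nhds]
  intro ε hε
  obtain ⟨δ, hδ, H⟩ := exists_forall_dist_tail_lt hp ha (show (0 : ℝ) < 1 / 2 by norm_num)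
    (half_pos hε)
  have hlt : max (1 / 2) (1 - δ) < (1 : ℝ) := max_lt (by norm_num) (by linarith)
  filter_upwards [Ioo_mem_nhdsLT hlt] with s hs
  have hs1 : 1 / 2 < s := (le_max_left _ _).trans_lt hs.1
  have hs2 : 1 - δ < s := (le_max_right _ _).trans_lt hs.1
  have hd : dist s 1 < δ := by
    rw [dist_comm, Real.dist_eq, abs_of_pos (by linarith [hs.2])]; linarith
  have hlim : Tendsto (fun n => dist (tail (g n) s) (tail (g n) 1)) atTop (𝓝 (dist (u s) 0)) := by
    simp only [tail_one]
    exact (hu s ⟨by linarith, hs.2⟩).dist tendsto_const_nhds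
  refine (le_of_tendsto' hlim fun n => (H _ (hg n) (hg0 n) (hE n) s ⟨hs1.le, hs.2.le⟩ 1
    ⟨by norm_num, le_rfl⟩ hd).le).trans_lt (by linarith)

/-- Lower semicontinuity of the energy under pointwise convergence of primitives, by Fatou's lemma
applied to difference quotients. -/
lemma energyOn_deriv_le_liminf (hp : 1 < p) (ha : p - 1 < a) (hg : ∀ n, Measurable (g n))
    (hg0 : ∀ n s, 0 ≤ g n s) (hE : ∀ n, energyOn p a (g n) (Ioo 0 1) ≤ 1)
    (hu : ∀ r ∈ Ioo (0 : ℝ) 1, Tendsto (fun n => tail (g n) r) atTop (𝓝 (u r))) {ρ : ℝ}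
    (hρ : 0 ≤ ρ) :
    energyOn p a (deriv u) (Ioo ρ 1) ≤ liminf (fun n => energyOn p a (g n) (Ioo ρ 1)) atTop := by
  have hp0 : 0 < p := by linarith
  have hAC := locallyAC_of_tendsto_tail hp ha hg hg0 hE hu
  set h : ℕ → ℝ := fun j => 1 / ((j : ℝ) + 1) with hh
  have hh0 : ∀ j, 0 < h j := fun j => by simp only [hh]; positivity
  have hhlim : Tendsto h atTop (𝓝 0) := tendsto_one_div_add_atTop_nhds_zero_nat
  set F : ℕ → ℝ → ℝ≥0∞ := fun j => (Ioo ρ (1 - h j)).indicator fun r =>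
    ENNReal.ofReal (r ^ a * |(u (r + h j) - u r) / h j| ^ p) with hF
  have hFm : ∀ j, AEMeasurable (F j) (volume.restrict (Ioo ρ 1)) := by
    intro j
    rw [hF, aemeasurable_indicator_iff measurableSet_Ioo]
    refine AEMeasurable.mono_measure ?_
      (Measure.restrict_mono le_rfl Measure.restrict_le_self)
    refine (ContinuousOn.aemeasurable ?_ measurableSet_Ioo).ennreal_ofReal
    have hc := hAC.continuousOn
    have h1 : ContinuousOn (fun r => u (r + h j)) (Ioo ρ (1 - h j)) :=
      hc.comp (by fun_prop) fun r hr => ⟨by linarith [hr.1, hh0 j], by linarith [hr.2]⟩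
    have h2 : ContinuousOn u (Ioo ρ (1 - h j)) :=
      hc.mono fun r hr => ⟨by linarith [hr.1], by linarith [hr.2, hh0 j]⟩
    refine ContinuousOn.mul (fun r hr => (Real.continuousAt_rpow_const _ _
      (Or.inl (hρ.trans_lt hr.1).ne')).continuousWithinAt) ?_
    exact (((h1.sub h2).div_const _).abs).rpow_const fun _ _ => Or.inr hp0.le
  have hdiff : ∀ᵐ r ∂volume.restrict (Ioo ρ 1), DifferentiableAt ℝ u r :=
    ae_restrict_of_ae_restrict_of_subset (Ioo_subset_Ioo_left hρ) hAC.ae_differentiableAt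
  have hFlim : ∀ᵐ r ∂volume.restrict (Ioo ρ 1), Tendsto (fun j => F j r) atTop
      (𝓝 (ENNReal.ofReal (r ^ a * |deriv u r| ^ p))) := by
    filter_upwards [hdiff, ae_restrict_mem measurableSet_Ioo] with r hr hm
    have h1 := hr.hasDerivAt.tendsto_slope_zero
    have h2 : Tendsto h atTop (𝓝[≠] 0) :=
      tendsto_nhdsWithin_iff.2 ⟨hhlim, .of_forall fun j => (hh0 j).ne'⟩
    have h3 := ENNReal.tendsto_ofReal
      ((((h1.comp h2).abs).rpow_const (p := p) (Or.inr hp0.le)).const_mul (r ^ a))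
    refine h3.congr' ?_
    filter_upwards [hhlim.eventually_lt_const (sub_pos.2 hm.2)] with j hj
    simp only [hF, Function.comp_apply, smul_eq_mul]
    rw [indicator_of_mem (show r ∈ Ioo ρ (1 - h j) from ⟨hm.1, by linarith⟩), div_eq_inv_mul]
  have hFle : ∀ j, ∫⁻ r in Ioo ρ 1, F j r ≤
      liminf (fun n => energyOn p a (g n) (Ioo ρ 1)) atTop := by
    intro j
    have e1 : ∫⁻ r in Ioo ρ 1, F j r = ∫⁻ r in Ioo ρ (1 - h j),
        ENNReal.ofReal (r ^ a * |(u (r + h j) - u r) / h j| ^ p) := by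
      rw [lintegral_indicator measurableSet_Ioo, Measure.restrict_restrict measurableSet_Ioo,
        inter_eq_left.2 (Ioo_subset_Ioo_right (by linarith [hh0 j]))]
    have htm : ∀ n, AEMeasurable (fun r => ENNReal.ofReal
        (r ^ a * |(tail (g n) (r + h j) - tail (g n) r) / h j| ^ p))
        (volume.restrict (Ioo ρ (1 - h j))) := by
      intro n
      have hc := (locallyAC_tail (integrableOn_tail hp ha (hg n) (hE n))).continuousOn
      refine (ContinuousOn.aemeasurable ?_ measurableSet_Ioo).ennreal_ofReal
      have h1 : ContinuousOn (fun r => tail (g n) (r + h j)) (Ioo ρ (1 - h j)) :=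
        hc.comp (by fun_prop) fun r hr => ⟨by linarith [hr.1, hh0 j], by linarith [hr.2]⟩
      have h2 : ContinuousOn (tail (g n)) (Ioo ρ (1 - h j)) :=
        hc.mono fun r hr => ⟨by linarith [hr.1], by linarith [hr.2, hh0 j]⟩
      refine ContinuousOn.mul (fun r hr => (Real.continuousAt_rpow_const _ _
        (Or.inl (hρ.trans_lt hr.1).ne')).continuousWithinAt) ?_
      exact (((h1.sub h2).div_const _).abs).rpow_const fun _ _ => Or.inr hp0.le
    rw [e1]
    calc _ = ∫⁻ r in Ioo ρ (1 - h j), liminf (fun n => ENNReal.ofReal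
          (r ^ a * |(tail (g n) (r + h j) - tail (g n) r) / h j| ^ p)) atTop := by
          refine setLIntegral_congr_fun measurableSet_Ioo fun r hr => ?_
          have h1 := hu (r + h j) ⟨by linarith [hr.1, hh0 j], by linarith [hr.2]⟩
          have h2 := hu r ⟨by linarith [hr.1], by linarith [hr.2, hh0 j]⟩
          exact (ENNReal.tendsto_ofReal (((((h1.sub h2).div_const (h j)).abs).rpow_const (p := p)
            (Or.inr hp0.le)).const_mul (r ^ a))).liminf_eq.symm
      _ ≤ liminf (fun n => ∫⁻ r in Ioo ρ (1 - h j), ENNReal.ofReal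
          (r ^ a * |(tail (g n) (r + h j) - tail (g n) r) / h j| ^ p)) atTop :=
          lintegral_liminf_le' htm
      _ ≤ _ := liminf_le_liminf (.of_forall fun n =>
          lintegral_slope_tail_le hp ha (hg n) (hg0 n) (hE n) hρ (hh0 j))
  calc energyOn p a (deriv u) (Ioo ρ 1) = ∫⁻ r in Ioo ρ 1, liminf (fun j => F j r) atTop :=
        lintegral_congr_ae (by filter_upwards [hFlim] with r hr using hr.liminf_eq.symm)
    _ ≤ liminf (fun j => ∫⁻ r in Ioo ρ 1, F j r) atTop := lintegral_liminf_le' hFm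
    _ ≤ liminf (fun _ : ℕ => liminf (fun n => energyOn p a (g n) (Ioo ρ 1)) atTop) atTop :=
        liminf_le_liminf (.of_forall hFle)
    _ = _ := liminf_const _

/-- The limit of the primitives is dominated by the primitive of a function whose energy is at most
the limit of the energies, on every interval `(ρ, 1)`. -/
lemma exists_limit_profile (hp : 1 < p) (ha : p - 1 < a) (hg : ∀ n, Measurable (g n))
    (hg0 : ∀ n s, 0 ≤ g n s) (hE : ∀ n, energyOn p a (g n) (Ioo 0 1) ≤ 1)
    (hu : ∀ r ∈ Ioo (0 : ℝ) 1, Tendsto (fun n => tail (g n) r) atTop (𝓝 (u r))) :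
    ∃ G : ℝ → ℝ, Measurable G ∧ (∀ s, 0 ≤ G s) ∧ (∀ r ∈ Ioo (0 : ℝ) 1, u r ≤ tail G r) ∧
      ∀ ρ, 0 ≤ ρ → energyOn p a G (Ioo ρ 1) ≤
        liminf (fun n => energyOn p a (g n) (Ioo ρ 1)) atTop := by
  have hAC := locallyAC_of_tendsto_tail hp ha hg hg0 hE hu
  have hone := tendsto_one_of_tendsto_tail hp ha hg hg0 hE hu
  have hen : ∀ ρ, 0 ≤ ρ → energyOn p a (fun s => |deriv u s|) (Ioo ρ 1) ≤
        liminf (fun n => energyOn p a (g n) (Ioo ρ 1)) atTop := by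
    intro ρ hρ
    refine le_trans (le_of_eq ?_) (energyOn_deriv_le_liminf hp ha hg hg0 hE hu hρ)
    exact energyOn_congr_ae (.of_forall fun s => abs_abs _)
  have hG : Measurable fun s => |deriv u s| := (measurable_deriv u).norm
  have hE1 : energyOn p a (fun s => |deriv u s|) (Ioo 0 1) ≤ 1 :=
    (hen 0 le_rfl).trans ((liminf_le_liminf (.of_forall hE)).trans_eq (liminf_const _))
  refine ⟨fun s => |deriv u s|, hG, fun s => abs_nonneg _, fun r hr => ?_, hen⟩
  have hi := integrableOn_tail hp ha hG hE1
  have h1 : Tendsto (fun s => u s + tail (fun s => |deriv u s|) r) (𝓝[<] 1)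
      (𝓝 (0 + tail (fun s => |deriv u s|) r)) := hone.add tendsto_const_nhds
  rw [zero_add] at h1
  refine ge_of_tendsto h1 ?_
  filter_upwards [Ioo_mem_nhdsLT hr.2] with s hs
  have h2 := (hAC r s hr.1 hs.1.le hs.2).integral_deriv_eq_sub
  have h3 := tail_eq_sub (hi r hr.1) ⟨hs.1.le, hs.2.le⟩
  have h4 : 0 ≤ tail (fun s => |deriv u s|) s := tail_nonneg (fun s => abs_nonneg _) s
  have h5 := intervalIntegral.abs_integral_le_integral_abs (f := deriv u) (μ := volume) hs.1.le
  have h6 := neg_abs_le (∫ x in r..s, deriv u x)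
  linarith

end Limit

end Compactness

/-! ### Truncated extremals as test functions -/

/-- Bliss's extremal `U(T) = (1 + T ^ b) ^ (-κ / b)`. -/
def blissProfile (κ b T : ℝ) : ℝ := (1 + T ^ b) ^ (-(κ / b))

section TestFunction

variable {p κ b : ℝ}

lemma blissProfile_pos {T : ℝ} (hT : 0 < T) : 0 < blissProfile κ b T := by
  unfold blissProfile; positivity

lemma blissProfile_anti (hκ : 0 < κ) (hb : 0 < b) {S T : ℝ} (hS : 0 < S) (h : S ≤ T) :
    blissProfile κ b T ≤ blissProfile κ b S := by
  unfold blissProfile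
  have : 0 < κ / b := by positivity
  exact Real.rpow_le_rpow_of_nonpos (by positivity)
    (by have := Real.rpow_le_rpow hS.le h hb.le; linarith) (by linarith)

lemma blissProfile_le (hκ : 0 < κ) (hb : 0 < b) {T : ℝ} (hT : 0 < T) :
    blissProfile κ b T ≤ T ^ (-κ) := by
  unfold blissProfile
  have : 0 < κ / b := by positivity
  refine (Real.rpow_le_rpow_of_nonpos (by positivity)
    (show T ^ b ≤ 1 + T ^ b by linarith) (by linarith)).trans (le_of_eq ?_)
  rw [← Real.rpow_mul hT.le]; congr 1; field_simp

lemma le_blissProfile (hκ : 0 < κ) (hb : 0 < b) {T : ℝ} (hT : 1 ≤ T) :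
    2 ^ (-(κ / b)) * T ^ (-κ) ≤ blissProfile κ b T := by
  unfold blissProfile
  have : 0 < κ / b := by positivity
  have h1 : 1 ≤ T ^ b := Real.one_le_rpow hT hb.le
  have hT0 : 0 < T := by linarith
  refine le_trans (le_of_eq ?_) (Real.rpow_le_rpow_of_nonpos (by positivity)
    (show 1 + T ^ b ≤ 2 * T ^ b by linarith) (by linarith))
  rw [Real.mul_rpow (by norm_num) (by positivity), ← Real.rpow_mul hT0.le]
  congr 2; field_simp

lemma hasDerivAt_blissProfile (hb : 0 < b) {x : ℝ} (hx : 0 < x) :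
    HasDerivAt (blissProfile κ b) (-(κ * x ^ (b - 1) * (1 + x ^ b) ^ (-(κ / b) - 1))) x := by
  have hQ : 0 < 1 + x ^ b := by positivity
  have h2 : HasDerivAt (fun T : ℝ => 1 + T ^ b) (b * x ^ (b - 1)) x :=
    (Real.hasDerivAt_rpow_const (Or.inl hx.ne')).const_add 1
  refine (h2.rpow_const (p := -(κ / b)) (Or.inl hQ.ne')).congr_deriv ?_
  field_simp

lemma blissDensity_eq (hκ : 0 < κ) (hb : 0 < b) {T : ℝ} (hT : 0 < T) :
    blissDensity p κ b T =
      T ^ ((b + κ) * (p - 1) - 1) * blissProfile κ b T ^ ((b + κ) * p / κ) := by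
  unfold blissDensity blissProfile
  rw [← Real.rpow_mul (by positivity)]
  congr 2; field_simp

lemma lintegral_Ioo_scale {ε : ℝ} (hε : 0 < ε) (f : ℝ → ℝ≥0∞) :
    ∫⁻ r in Ioo (0 : ℝ) 1, f r = ∫⁻ T in Ioo 0 (1 / ε), ENNReal.ofReal ε * f (ε * T) := by
  have himg : (fun T => ε * T) '' Ioo 0 (1 / ε) = Ioo 0 1 := by
    rw [image_mul_left_Ioo hε, mul_zero, mul_one_div_cancel hε.ne']
  rw [← himg, lintegral_image_eq_lintegral_abs_deriv_mul measurableSet_Ioo (f' := fun _ => ε)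
    (fun x _ => by simpa using ((hasDerivAt_id x).const_mul ε).hasDerivWithinAt)
    (fun x _ y _ h => mul_left_cancel₀ hε.ne' h), abs_of_pos hε]

/-- The energy of the extremal on `(0, Y)`, after removal of constants. -/
lemma lintegral_energy_blissProfile_le (hp : 1 < p) (hκ : 0 < κ) (hb : 0 < b) {Y : ℝ} (hY : 0 < Y) :
    ∫⁻ T in Ioo 0 Y, ENNReal.ofReal (κ * T ^ b * blissDensity p κ b T) ≤
      ENNReal.ofReal ((b + κ) * (p - 1) * blissMass p κ b) := by
  have hp1 : 0 < p - 1 := by linarith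
  set F : ℝ → ℝ := fun T => (b + κ) * (p - 1) * blissCdf p κ b T - blissBoundary p κ b T with hF
  have hFd : ∀ T, 0 < T → HasDerivAt F (κ * T ^ b * blissDensity p κ b T) T := fun T hT =>
    (((hasDerivAt_blissCdf hp hκ hb hT).const_mul _).sub
      (hasDerivAt_blissBoundary hb hT)).congr_deriv (by ring)
  have hF0 : Tendsto F (𝓝[>] 0) (𝓝 ((b + κ) * (p - 1) * 0 - 0)) :=
    ((tendsto_blissCdf_zero hp hκ hb).const_mul _).sub (tendsto_blissBoundary_zero hp hκ hb)
  have hFY : ContinuousAt F Y := (hFd Y hY).continuousAt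
  have hnn : ∀ T ∈ Ioo 0 Y, 0 ≤ κ * T ^ b * blissDensity p κ b T := fun T hT => by
    have := blissDensity_pos (p := p) (κ := κ) (b := b) hT.1
    have := hT.1
    positivity
  have hint : IntervalIntegrable (fun T => κ * T ^ b * blissDensity p κ b T) volume 0 Y := by
    rw [intervalIntegrable_iff_integrableOn_Ioc_of_le hY.le]
    have h1 : IntegrableOn (fun T => κ * Y ^ b * blissDensity p κ b T) (Ioc 0 Y) :=
      ((integrableOn_blissDensity hp hκ hb).mono_set Ioc_subset_Ioi_self).const_mul _
    refine h1.mono' ?_ ?_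
    · have := measurable_blissDensity p κ b
      exact (by fun_prop : Measurable fun T => κ * T ^ b * blissDensity p κ b T).aestronglyMeasurable
    · refine (ae_restrict_iff' measurableSet_Ioc).2 (.of_forall fun T hT => ?_)
      have h2 := blissDensity_pos (p := p) (κ := κ) (b := b) hT.1
      have h3 := hT.1
      rw [Real.norm_of_nonneg (by positivity)]
      gcongr
      exact hT.2
  have hI : ∫ T in (0 : ℝ)..Y, κ * T ^ b * blissDensity p κ b T = F Y - ((b + κ) * (p - 1) * 0 - 0) :=
    intervalIntegral.integral_eq_sub_of_hasDerivAt_of_tendsto hY (fun T hT => hFd T hT.1) hint hF0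
      (hFY.tendsto.mono_left nhdsWithin_le_nhds)
  have hle : blissCdf p κ b Y ≤ blissMass p κ b := by
    rw [blissCdf, intervalIntegral.integral_of_le hY.le, blissMass]
    refine setIntegral_mono_set (integrableOn_blissDensity hp hκ hb) ?_
      (.of_forall Ioc_subset_Ioi_self)
    exact (ae_restrict_iff' measurableSet_Ioi).2 (.of_forall fun T hT => (blissDensity_pos hT).le)
  have h1 : ∫⁻ T in Ioo 0 Y, ENNReal.ofReal (κ * T ^ b * blissDensity p κ b T) =
      ENNReal.ofReal (∫ T in (0 : ℝ)..Y, κ * T ^ b * blissDensity p κ b T) := by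
    rw [intervalIntegral.integral_of_le hY.le, integral_Ioc_eq_integral_Ioo,
      ofReal_integral_eq_lintegral_ofReal]
    · exact ((intervalIntegrable_iff_integrableOn_Ioc_of_le hY.le).1 hint).mono_set
        Ioo_subset_Ioc_self
    · exact (ae_restrict_iff' measurableSet_Ioo).2 (.of_forall hnn)
  rw [h1, hI]
  refine ENNReal.ofReal_le_ofReal ?_
  have h2 := blissBoundary_nonneg (p := p) (κ := κ) (b := b) hY
  have h3 : (b + κ) * (p - 1) * blissCdf p κ b Y ≤ (b + κ) * (p - 1) * blissMass p κ b := by gcongr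
  simp only [hF]; linarith

/-- The factor normalizing the energy of the extremal to one. -/
def blissFactor (p κ b : ℝ) : ℝ :=
  ((b + κ) * (p - 1) * κ ^ (p - 1) * blissMass p κ b) ^ (-(1 / p))

lemma blissFactor_pos (hp : 1 < p) (hκ : 0 < κ) (hb : 0 < b) : 0 < blissFactor p κ b := by
  have hM := blissMass_pos hp hκ hb
  have hp1 : 0 < p - 1 := by linarith
  unfold blissFactor; positivity

/-- The truncated and rescaled extremal, of energy at most one. -/
lemma exists_test_function (hp : 1 < p) (hκ : 0 < κ) (hb : 0 < b) {ε : ℝ} (hε : 0 < ε) :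
    ∃ g : ℝ → ℝ, Measurable g ∧ (∀ s, 0 ≤ g s) ∧
      energyOn p ((κ + 1) * (p - 1)) g (Ioo 0 1) ≤ 1 ∧
      ∀ r ∈ Ioo (0 : ℝ) 1, tail g r = blissFactor p κ b * ε ^ (-(κ * (p - 1) / p)) *
        (blissProfile κ b (r / ε) - blissProfile κ b (1 / ε)) := by
  have hM := blissMass_pos hp hκ hb
  have hp0 : 0 < p := by linarith
  have hp1 : 0 < p - 1 := by linarith
  have hc := blissFactor_pos hp hκ hb
  set c := blissFactor p κ b with hcdef
  set A := c * ε ^ (-(κ * (p - 1) / p)) with hA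
  have hA0 : 0 < A := by positivity
  set f : ℝ → ℝ := fun T => κ * T ^ (b - 1) * (1 + T ^ b) ^ (-(κ / b) - 1) with hf
  have hf0 : ∀ T, 0 < T → 0 < f T := fun T hT => by simp only [hf]; positivity
  set g : ℝ → ℝ := fun r => |A * (f (r / ε) / ε)| with hg
  have hgm : Measurable g := by simp only [hg, hf]; fun_prop
  have hgp : ∀ r, 0 < r → g r = A * (f (r / ε) / ε) := fun r hr => by
    have := hf0 (r / ε) (by positivity)
    exact abs_of_pos (by positivity)
  refine ⟨g, hgm, fun s => abs_nonneg _, ?_, fun r hr => ?_⟩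
  · rw [energyOn, lintegral_Ioo_scale hε]
    have hcp : c ^ p * ((b + κ) * (p - 1) * κ ^ (p - 1) * blissMass p κ b) = 1 := by
      rw [hcdef, blissFactor, ← Real.rpow_mul (by positivity), neg_mul, one_div_mul_cancel hp0.ne',
        Real.rpow_neg_one, inv_mul_cancel₀ (by positivity)]
    calc _ = ∫⁻ T in Ioo 0 (1 / ε), ENNReal.ofReal (c ^ p * κ ^ (p - 1)) *
          ENNReal.ofReal (κ * T ^ b * blissDensity p κ b T) := by
          refine setLIntegral_congr_fun measurableSet_Ioo fun T hT => ?_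
          have hT0 : 0 < T := hT.1
          have hfT := hf0 T hT0
          have hQ : 0 < 1 + T ^ b := by positivity
          have hκp : κ ^ p = κ ^ (p - 1) * κ := by
            rw [Real.rpow_sub_one hκ.ne', div_mul_cancel₀ _ hκ.ne']
          rw [← ENNReal.ofReal_mul hε.le, ← ENNReal.ofReal_mul (by positivity),
            abs_of_nonneg (show 0 ≤ g (ε * T) from abs_nonneg _),
            hgp _ (by positivity), mul_div_cancel_left₀ _ hε.ne']
          congr 1
          simp only [hf, hA, blissDensity]
          set Q := 1 + T ^ b
          -- in logarithmic coordinates the identity of monomials is linear in the exponents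
          obtain ⟨x, rfl⟩ : ∃ x, Real.exp x = ε := ⟨_, Real.exp_log hε⟩
          obtain ⟨y, rfl⟩ : ∃ x, Real.exp x = T := ⟨_, Real.exp_log hT0⟩
          obtain ⟨w, hw⟩ : ∃ x, Real.exp x = Q := ⟨_, Real.exp_log hQ⟩
          have e1 : c * Real.exp x ^ (-(κ * (p - 1) / p)) * (κ * Real.exp y ^ (b - 1) *
              Q ^ (-(κ / b) - 1) / Real.exp x) = c * κ * (Real.exp x ^ (-(κ * (p - 1) / p)) *
                (Real.exp y ^ (b - 1) * Q ^ (-(κ / b) - 1) / Real.exp x)) := by ring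
          rw [e1, Real.mul_rpow hε.le hT0.le, Real.mul_rpow (x := c * κ) (by positivity)
            (by positivity), Real.mul_rpow hc.le hκ.le, hκp, ← hw]
          simp only [← Real.exp_mul, ← Real.exp_add, ← Real.exp_sub]
          have e2 : ∀ P K k X Y Z V W : ℝ, X + Y + Z = V + W → Real.exp X * (Real.exp Y *
              (P * (K * k) * Real.exp Z)) = P * K * (k * Real.exp V * Real.exp W) := by
            intro P K k X Y Z V W h
            have : Real.exp X * Real.exp Y * Real.exp Z = Real.exp V * Real.exp W := by
              rw [← Real.exp_add, ← Real.exp_add, h, Real.exp_add]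
            linear_combination P * K * k * this
          refine e2 _ _ _ _ _ _ _ _ ?_
          field_simp
          ring
      _ ≤ ENNReal.ofReal (c ^ p * κ ^ (p - 1)) *
          ENNReal.ofReal ((b + κ) * (p - 1) * blissMass p κ b) := by
          rw [lintegral_const_mul' _ _ ENNReal.ofReal_ne_top]
          gcongr
          exact lintegral_energy_blissProfile_le hp hκ hb (by positivity)
      _ = 1 := by
          rw [← ENNReal.ofReal_mul (by positivity), show c ^ p * κ ^ (p - 1) *
            ((b + κ) * (p - 1) * blissMass p κ b) = 1 from Eq.trans (by ring) hcp,
            ENNReal.ofReal_one]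
  · have hd : ∀ s ∈ uIcc r 1, HasDerivAt (fun s => -(A * blissProfile κ b (s / ε))) (g s) s := by
      intro s hs
      rw [uIcc_of_le hr.2.le] at hs
      have hs0 : 0 < s := hr.1.trans_le hs.1
      have h1 := (hasDerivAt_blissProfile (κ := κ) hb (div_pos hs0 hε)).comp s
        ((hasDerivAt_id s).div_const ε)
      refine ((h1.const_mul A).neg).congr_deriv ?_
      rw [hgp s hs0]; simp only [hf]; ring
    have hci : ContinuousOn g (uIcc r 1) := by
      rw [uIcc_of_le hr.2.le]
      intro s hs
      have hs0 : 0 < s / ε := div_pos (hr.1.trans_le hs.1) hε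
      have h1 : ContinuousAt (fun s : ℝ => s / ε) s := by fun_prop
      have h2 : ContinuousAt f (s / ε) := by
        have hQ : 1 + (s / ε) ^ b ≠ 0 := by positivity
        exact (continuousAt_const.mul (Real.continuousAt_rpow_const _ _ (Or.inl hs0.ne'))).mul
          ((continuousAt_const.add (Real.continuousAt_rpow_const _ _ (Or.inl hs0.ne'))).rpow_const
            (Or.inl hQ))
      have h3 : ContinuousAt (fun s => f (s / ε)) s := ContinuousAt.comp (f := fun s : ℝ => s / ε) (x := s) h2 h1
      exact ((continuousAt_const.mul (h3.div_const ε)).abs).continuousWithinAt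
    rw [tail_eq_intervalIntegral g hr.2.le,
      intervalIntegral.integral_eq_sub_of_hasDerivAt hd hci.intervalIntegrable]
    ring

end TestFunction

/-! ### The supremum exceeds the Bliss constant -/

/-- The logarithmic functional of the primitive of `g`. -/
def logIntegral (θ q τ β : ℝ) (g : ℝ → ℝ) : ℝ≥0∞ :=
  ∫⁻ r in Ioo (0 : ℝ) 1, ENNReal.ofReal
    (r ^ θ * tail g r ^ q * |Real.log (τ + tail g r)| ^ (r ^ β))

lemma ofReal_integral_le_lintegral {α : Type*} [MeasurableSpace α] {μ : Measure α} {f : α → ℝ}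
    (hf : Integrable f μ) : ENNReal.ofReal (∫ x, f x ∂μ) ≤ ∫⁻ x, ENNReal.ofReal (f x) ∂μ := by
  rw [integral_eq_lintegral_pos_part_sub_lintegral_neg_part hf]
  exact (ENNReal.ofReal_le_ofReal (sub_le_self _ ENNReal.toReal_nonneg)).trans
    ENNReal.ofReal_toReal_le

section Strict

variable {p κ b : ℝ}

lemma blissConst_eq (hp : 1 < p) (hκ : 0 < κ) (hb : 0 < b) :
    blissConst p κ b = blissFactor p κ b ^ ((b + κ) * p / κ) * blissMass p κ b := by
  have hM := blissMass_pos hp hκ hb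
  have hp1 : 0 < p - 1 := by linarith
  have hp0 : 0 < p := by linarith
  unfold blissConst blissFactor
  rw [← Real.rpow_mul (by positivity), show -(1 / p) * ((b + κ) * p / κ) = -((b + κ) / κ) by
    field_simp, Real.rpow_neg (by positivity)]
  field_simp

/-- The integrand of the first-order loss caused by truncating the extremal. -/
def blissLoss (p κ b T : ℝ) : ℝ :=
  T ^ ((b + κ) * (p - 1) - 1) * blissProfile κ b T ^ ((b + κ) * p / κ - 1)

lemma integrableOn_blissLoss (hp : 1 < p) (hκ : 0 < κ) (hb : 0 < b) :
    IntegrableOn (blissLoss p κ b) (Ioi 0) := by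
  have hp1 : 0 < p - 1 := by linarith
  have hq : 0 ≤ (b + κ) * p / κ - 1 := by
    rw [sub_nonneg, le_div_iff₀ hκ]; nlinarith
  have hm : Measurable (blissLoss p κ b) := by unfold blissLoss blissProfile; fun_prop
  have hpos : ∀ T, 0 < T → 0 < blissLoss p κ b T := fun T hT => by
    have := blissProfile_pos (κ := κ) (b := b) hT
    unfold blissLoss; positivity
  rw [← Ioc_union_Ioi_eq_Ioi (zero_le_one (α := ℝ))]
  refine IntegrableOn.union ?_ ?_
  · have hi : IntegrableOn (fun T : ℝ => T ^ ((b + κ) * (p - 1) - 1)) (Ioc 0 1) := by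
      rw [← intervalIntegrable_iff_integrableOn_Ioc_of_le zero_le_one]
      refine intervalIntegral.intervalIntegrable_rpow' ?_
      have : 0 < (b + κ) * (p - 1) := by positivity
      linarith
    refine hi.mono' hm.aestronglyMeasurable ?_
    refine (ae_restrict_iff' measurableSet_Ioc).2 (.of_forall fun T hT => ?_)
    have hT0 : 0 < T := hT.1
    rw [Real.norm_of_nonneg (hpos T hT0).le]
    have h1 : blissProfile κ b T ≤ 1 := by
      unfold blissProfile
      refine Real.rpow_le_one_of_one_le_of_nonpos (by linarith [Real.rpow_nonneg hT0.le b]) ?_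
      have : 0 < κ / b := by positivity
      linarith
    refine mul_le_of_le_one_right (by positivity)
      (Real.rpow_le_one (blissProfile_pos hT0).le h1 hq)
  · have hi : IntegrableOn (fun T : ℝ => T ^ (-b - 1)) (Ioi 1) :=
      integrableOn_Ioi_rpow_of_lt (by linarith) one_pos
    refine hi.mono' hm.aestronglyMeasurable ?_
    refine (ae_restrict_iff' measurableSet_Ioi).2 (.of_forall fun T hT => ?_)
    have hT0 : (0 : ℝ) < T := one_pos.trans hT
    rw [Real.norm_of_nonneg (hpos T hT0).le]
    have h1 := Real.rpow_le_rpow (blissProfile_pos hT0).le (blissProfile_le hκ hb hT0) hq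
    refine (mul_le_mul_of_nonneg_left h1 (by positivity)).trans (le_of_eq ?_)
    rw [← Real.rpow_mul hT0.le, ← Real.rpow_add hT0]
    congr 1; field_simp; ring

lemma blissMass_sub_blissCdf_le (hp : 1 < p) (hκ : 0 < κ) (hb : 0 < b) {S : ℝ} (hS : 0 < S) :
    blissMass p κ b - blissCdf p κ b S ≤ S ^ (-(b + κ)) / (b + κ) := by
  have hi := integrableOn_blissDensity hp hκ hb
  have h1 : blissMass p κ b = blissCdf p κ b S + ∫ T in Ioi S, blissDensity p κ b T := by
    rw [blissMass, blissCdf, intervalIntegral.integral_of_le hS.le, ← Ioc_union_Ioi_eq_Ioi hS.le]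
    refine setIntegral_union ?_ measurableSet_Ioi (hi.mono_set Ioc_subset_Ioi_self)
      (hi.mono_set (Ioi_subset_Ioi hS.le))
    exact Set.disjoint_left.2 fun x hx hx' => absurd hx.2 (not_le.2 hx')
  have h2 : ∫ T in Ioi S, blissDensity p κ b T ≤ ∫ T in Ioi S, T ^ (-(b + κ) - 1) :=
    setIntegral_mono_on (hi.mono_set (Ioi_subset_Ioi hS.le))
      (integrableOn_Ioi_rpow_of_lt (by linarith) hS) measurableSet_Ioi
      fun T hT => blissDensity_le_right hp hκ hb (hS.trans hT)
  rw [integral_Ioi_rpow_of_lt (by linarith) hS] at h2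
  have h3 : -S ^ (-(b + κ) - 1 + 1) / (-(b + κ) - 1 + 1) = S ^ (-(b + κ)) / (b + κ) := by
    rw [show -(b + κ) - 1 + 1 = -(b + κ) by ring, neg_div_neg_eq]
  linarith

/-- Lower bound for the functional on the test function of scale `ε`, cut at `S` in the rescaled
variable: the logarithm is at least `1` up to `S` and at least `exp 1` on `(1, 2)`. -/
lemma lt_logIntegral_of_scale (hp : 1 < p) (hκ : 0 < κ) (hb : 0 < b) {τ β ε S A : ℝ} {g : ℝ → ℝ}
    (hτ : 1 ≤ τ) (hβ : 0 < β) (hε : 0 < ε)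
    (hA : A = blissFactor p κ b * ε ^ (-(κ * (p - 1) / p)))
    (hg : ∀ r ∈ Ioo (0 : ℝ) 1, tail g r =
      A * (blissProfile κ b (r / ε) - blissProfile κ b (1 / ε)))
    (hS2 : 2 ≤ S) (hSε : S < 1 / ε) (hη : blissProfile κ b (1 / ε) ≤ blissProfile κ b S / 2)
    (hAS : Real.exp 1 ≤ A * (blissProfile κ b S / 2))
    (hA2 : Real.exp (Real.exp 1) ≤ A * (blissProfile κ b 2 / 2))
    (hgain : (b + κ) * p / κ * blissProfile κ b (1 / ε) * (∫ T in Ioi (0 : ℝ), blissLoss p κ b T) +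
        S ^ (-(b + κ)) / (b + κ) <
      min 1 (2 ^ ((b + κ) * (p - 1) - 1)) * (blissProfile κ b 2 / 2) ^ ((b + κ) * p / κ) * ε ^ β) :
    ENNReal.ofReal (blissConst p κ b) <
      logIntegral ((b + κ) * (p - 1) - 1) ((b + κ) * p / κ) τ β g := by
  have hp0 : 0 < p := by linarith
  have hp1 : 0 < p - 1 := by linarith
  have hM := blissMass_pos hp hκ hb
  have hc := blissFactor_pos hp hκ hb
  set c := blissFactor p κ b
  have hA0 : 0 < A := by rw [hA]; positivity
  set n := (b + κ) * (p - 1) with hn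
  set q := (b + κ) * p / κ with hq
  have hq1 : 1 ≤ q := by rw [hq, le_div_iff₀ hκ]; nlinarith
  have hS0 : 0 < S := by linarith
  set U := blissProfile κ b with hU
  have hU0 : ∀ T, 0 < T → 0 < U T := fun T hT => blissProfile_pos hT
  have hUanti : ∀ S T, 0 < S → S ≤ T → U T ≤ U S := fun S T hS h => blissProfile_anti hκ hb hS h
  set η := U (1 / ε) with hηdef
  have hη0 : 0 < η := hU0 _ (by positivity)
  set γ := min 1 (2 ^ (n - 1)) * (U 2 / 2) ^ q with hγ
  have hU2 : 0 < U 2 := hU0 2 (by norm_num)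
  have hγ0 : 0 < γ := by
    have : (0 : ℝ) < min 1 (2 ^ (n - 1)) := lt_min one_pos (by positivity)
    positivity
  set H : ℝ → ℝ := fun T => blissDensity p κ b T - q * η * blissLoss p κ b T +
    (Ioc 1 2).indicator (fun _ => γ * ε ^ β) T with hH
  have hHi1 : IntegrableOn (blissDensity p κ b) (Ioc 0 S) :=
    (integrableOn_blissDensity hp hκ hb).mono_set Ioc_subset_Ioi_self
  have hHi2 : IntegrableOn (fun T => q * η * blissLoss p κ b T) (Ioc 0 S) :=
    ((integrableOn_blissLoss hp hκ hb).mono_set Ioc_subset_Ioi_self).const_mul _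
  have hHi3 : IntegrableOn ((Ioc 1 2).indicator fun _ : ℝ => γ * ε ^ β) (Ioc 0 S) := by
    refine Integrable.integrableOn ?_
    rw [integrable_indicator_iff measurableSet_Ioc]
    exact integrableOn_const (by simp)
  have hHi : IntegrableOn H (Ioc 0 S) := (hHi1.sub hHi2).add hHi3
  have hHint : blissMass p κ b < ∫ T in Ioc 0 S, H T := by
    have e1 : ∫ T in Ioc 0 S, H T = (∫ T in Ioc 0 S, blissDensity p κ b T) -
        (∫ T in Ioc 0 S, q * η * blissLoss p κ b T) +
        ∫ T in Ioc 0 S, (Ioc 1 2).indicator (fun _ => γ * ε ^ β) T := by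
      have h12 := integral_sub hHi1 hHi2
      have h123 := integral_add (hHi1.sub hHi2) hHi3
      simp only [Pi.sub_apply] at h12 h123
      rw [← h12, ← h123]
    have e2 : ∫ T in Ioc 0 S, (Ioc 1 2).indicator (fun _ => γ * ε ^ β) T = γ * ε ^ β := by
      rw [setIntegral_indicator measurableSet_Ioc, inter_eq_right.2
        (Ioc_subset_Ioc zero_le_one hS2), setIntegral_const]
      simp only [measureReal_def, Real.volume_Ioc, smul_eq_mul]
      norm_num
    have e3 : ∫ T in Ioc 0 S, blissDensity p κ b T = blissCdf p κ b S := by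
      rw [blissCdf, intervalIntegral.integral_of_le hS0.le]
    have e4 : ∫ T in Ioc 0 S, q * η * blissLoss p κ b T ≤
        q * η * ∫ T in Ioi (0 : ℝ), blissLoss p κ b T := by
      rw [integral_const_mul]
      refine mul_le_mul_of_nonneg_left ?_ (by positivity)
      refine setIntegral_mono_set (integrableOn_blissLoss hp hκ hb) ?_
        (.of_forall Ioc_subset_Ioi_self)
      refine (ae_restrict_iff' measurableSet_Ioi).2 (.of_forall fun T hT => ?_)
      have hT0 : 0 < T := hT
      have := hU0 T hT0
      show 0 ≤ blissLoss p κ b T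
      unfold blissLoss
      positivity
    have e5 := blissMass_sub_blissCdf_le hp hκ hb hS0
    rw [e1, e2, e3]
    linarith
  have hpt : ∀ T ∈ Ioc 0 S, ENNReal.ofReal (c ^ q * H T) ≤ ENNReal.ofReal ε * ENNReal.ofReal
      ((ε * T) ^ (n - 1) * tail g (ε * T) ^ q *
        |Real.log (τ + tail g (ε * T))| ^ ((ε * T) ^ β)) := by
    intro T hT
    have hT0 : 0 < T := hT.1
    have hεT : ε * T < 1 := by
      have := hT.2.trans_lt hSε
      rw [lt_div_iff₀ hε] at this; linarith
    rw [hg (ε * T) ⟨by positivity, hεT⟩, mul_div_cancel_left₀ _ hε.ne']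
    set V := U T - η with hV
    have hVS : U S / 2 ≤ V := by
      have := hUanti T S hT0 hT.2
      rw [hV]; linarith
    have hV0 : 0 < V := lt_of_lt_of_le (by have := hU0 S hS0; positivity) hVS
    have hUT := hU0 T hT0
    have hlog1 : 1 ≤ Real.log (τ + A * V) := by
      rw [Real.le_log_iff_exp_le (by positivity)]
      have : A * (U S / 2) ≤ A * V := by gcongr
      linarith
    have hVq : U T ^ q - q * η * U T ^ (q - 1) ≤ V ^ q := by
      have h1 := one_add_mul_self_le_rpow_one_add (s := -(η / U T)) (p := q) (by
        rw [neg_le_neg_iff, div_le_one hUT]; linarith) hq1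
      have h2 := mul_le_mul_of_nonneg_left h1 (Real.rpow_nonneg hUT.le q)
      rw [← Real.mul_rpow hUT.le (by
        rw [← sub_eq_add_neg, sub_nonneg, div_le_one hUT]; linarith)] at h2
      have h3 : U T * (1 + -(η / U T)) = V := by rw [hV]; field_simp; ring
      rw [h3] at h2
      refine le_trans (le_of_eq ?_) h2
      rw [Real.rpow_sub_one hUT.ne']; field_simp; ring
    have hεp : ε * ((ε * T) ^ (n - 1) * (A * V) ^ q) = c ^ q * (T ^ (n - 1) * V ^ q) := by
      rw [hA, Real.mul_rpow hε.le hT0.le, Real.mul_rpow (by positivity) hV0.le,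
        Real.mul_rpow hc.le (by positivity), ← Real.rpow_mul hε.le, Real.rpow_sub_one hε.ne']
      have h1 : ε ^ n * ε ^ (-(κ * (p - 1) / p) * q) = 1 := by
        rw [← Real.rpow_add hε, show n + -(κ * (p - 1) / p) * q = 0 by
          rw [hn, hq]; field_simp; ring, Real.rpow_zero]
      calc _ = (ε ^ n * ε ^ (-(κ * (p - 1) / p) * q)) * (c ^ q * (T ^ (n - 1) * V ^ q)) := by
            field_simp
        _ = _ := by rw [h1, one_mul]
    rw [← ENNReal.ofReal_mul hε.le]
    refine ENNReal.ofReal_le_ofReal ?_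
    rw [← mul_assoc ε, hεp, mul_assoc (c ^ q)]
    refine mul_le_mul_of_nonneg_left ?_ (by positivity)
    have hx0 : 0 < ε * T := by positivity
    have hbase : blissDensity p κ b T - q * η * blissLoss p κ b T ≤ T ^ (n - 1) * V ^ q := by
      rw [blissDensity_eq hκ hb hT0, blissLoss]
      have := mul_le_mul_of_nonneg_left hVq (Real.rpow_nonneg hT0.le (n - 1))
      refine le_trans (le_of_eq ?_) this
      ring
    have hTV : 0 ≤ T ^ (n - 1) * V ^ q := by positivity
    rw [abs_of_nonneg (by linarith)]
    simp only [hH]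
    by_cases h12 : T ∈ Ioc 1 2
    · rw [indicator_of_mem h12]
      have hV2 : U 2 / 2 ≤ V := by
        have h1 := hUanti T 2 hT0 h12.2
        have h2 := hUanti 2 S (by norm_num) hS2
        rw [hV]; linarith
      have hlog2 : Real.exp 1 ≤ Real.log (τ + A * V) := by
        rw [Real.le_log_iff_exp_le (by positivity)]
        have : A * (U 2 / 2) ≤ A * V := by gcongr
        linarith
      have hpow : 1 + ε ^ β ≤ Real.log (τ + A * V) ^ ((ε * T) ^ β) := by
        have h1 : ε ^ β ≤ (ε * T) ^ β :=
          Real.rpow_le_rpow hε.le (by nlinarith [h12.1]) hβ.le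
        calc 1 + ε ^ β ≤ Real.exp ((ε * T) ^ β) := by
              linarith [Real.add_one_le_exp ((ε * T) ^ β)]
          _ = Real.exp 1 ^ ((ε * T) ^ β) := by rw [← Real.exp_mul, one_mul]
          _ ≤ _ := Real.rpow_le_rpow (Real.exp_pos _).le hlog2 (by positivity)
      have hTn : min 1 ((2 : ℝ) ^ (n - 1)) ≤ T ^ (n - 1) := by
        rcases le_total 0 (n - 1) with h | h
        · exact (min_le_left _ _).trans (Real.one_le_rpow h12.1.le h)
        · exact (min_le_right _ _).trans (Real.rpow_le_rpow_of_nonpos hT0 h12.2 h)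
      have hγle : γ ≤ T ^ (n - 1) * V ^ q := by
        rw [hγ]
        refine mul_le_mul hTn (Real.rpow_le_rpow (by positivity) hV2 (by linarith))
          (by positivity) (by positivity)
      have h1 : T ^ (n - 1) * V ^ q * (1 + ε ^ β) ≤
          T ^ (n - 1) * V ^ q * Real.log (τ + A * V) ^ ((ε * T) ^ β) :=
        mul_le_mul_of_nonneg_left hpow hTV
      have h2 : γ * ε ^ β ≤ T ^ (n - 1) * V ^ q * ε ^ β :=
        mul_le_mul_of_nonneg_right hγle (by positivity)
      linarith
    · rw [indicator_of_notMem h12, add_zero]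
      refine hbase.trans (le_mul_of_one_le_right hTV ?_)
      exact Real.one_le_rpow hlog1 (by positivity)
  have hcq : 0 < c ^ q := by positivity
  calc ENNReal.ofReal (blissConst p κ b) < ENNReal.ofReal (∫ T in Ioc 0 S, c ^ q * H T) := by
        rw [integral_const_mul, blissConst_eq hp hκ hb]
        exact (ENNReal.ofReal_lt_ofReal_iff (mul_pos hcq (hM.trans hHint))).2
          (mul_lt_mul_of_pos_left hHint hcq)
    _ ≤ ∫⁻ T in Ioc 0 S, ENNReal.ofReal (c ^ q * H T) :=
        ofReal_integral_le_lintegral (hHi.const_mul _)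
    _ ≤ ∫⁻ T in Ioc 0 S, ENNReal.ofReal ε * ENNReal.ofReal
      ((ε * T) ^ (n - 1) * tail g (ε * T) ^ q *
        |Real.log (τ + tail g (ε * T))| ^ ((ε * T) ^ β)) :=
        setLIntegral_mono' measurableSet_Ioc hpt
    _ ≤ ∫⁻ T in Ioo 0 (1 / ε), ENNReal.ofReal ε * ENNReal.ofReal
      ((ε * T) ^ (n - 1) * tail g (ε * T) ^ q *
        |Real.log (τ + tail g (ε * T))| ^ ((ε * T) ^ β)) :=
        lintegral_mono_set fun T hT => ⟨hT.1, hT.2.trans_lt hSε⟩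
    _ = _ := (lintegral_Ioo_scale hε fun r => ENNReal.ofReal
      (r ^ (n - 1) * tail g r ^ q * |Real.log (τ + tail g r)| ^ (r ^ β))).symm

/-- The supremum lies strictly above the level of concentrating sequences. -/
lemma exists_lt_logIntegral (hp : 1 < p) (hκ : 0 < κ) (hb : 0 < b) {τ β : ℝ} (hτ : 1 ≤ τ)
    (hβ : 0 < β) (hβκ : β < κ) (hβb : β < (b + κ) * (p - 1) / p) :
    ∃ g : ℝ → ℝ, Measurable g ∧ (∀ s, 0 ≤ g s) ∧
      energyOn p ((κ + 1) * (p - 1)) g (Ioo 0 1) ≤ 1 ∧ ENNReal.ofReal (blissConst p κ b) <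
        logIntegral ((b + κ) * (p - 1) - 1) ((b + κ) * p / κ) τ β g := by
  have hp0 : 0 < p := by linarith
  have hp1 : 0 < p - 1 := by linarith
  have hc := blissFactor_pos hp hκ hb
  have hbκ : 0 < b + κ := by positivity
  obtain ⟨σ, hσ1, hσ2⟩ := exists_between (show β / (b + κ) < (p - 1) / p by
    rw [div_lt_iff₀ hbκ]; calc β < _ := hβb
      _ = _ := by ring)
  have hσ0 : 0 < σ := lt_trans (by positivity) hσ1
  have hσlt1 : σ < 1 := hσ2.trans (by rw [div_lt_one hp0]; linarith)
  have hσβ : β < σ * (b + κ) := by rwa [div_lt_iff₀ hbκ] at hσ1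
  set c := blissFactor p κ b
  set D : ℝ := 2 ^ (-(κ / b)) with hD
  have hD0 : 0 < D := by positivity
  set q := (b + κ) * p / κ with hq
  set K := ∫ T in Ioi (0 : ℝ), blissLoss p κ b T with hK
  have hK0 : 0 ≤ K := by
    refine setIntegral_nonneg measurableSet_Ioi fun T hT => ?_
    have hT0 : 0 < T := hT
    have := blissProfile_pos (κ := κ) (b := b) hT0
    unfold blissLoss; positivity
  have hU2 : 0 < blissProfile κ b 2 := blissProfile_pos (by norm_num)
  set γ := min 1 (2 ^ ((b + κ) * (p - 1) - 1)) * (blissProfile κ b 2 / 2) ^ q with hγ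
  have hγ0 : 0 < γ := by
    have : (0 : ℝ) < min 1 (2 ^ ((b + κ) * (p - 1) - 1)) := lt_min one_pos (by positivity)
    positivity
  -- Powers of the scale with positive, respectively negative, exponent.
  have hto0 : ∀ x : ℝ, 0 < x → Tendsto (fun ε : ℝ => ε ^ x) (𝓝[>] 0) (𝓝 0) := by
    intro x hx
    have := (Real.continuousAt_rpow_const 0 x (Or.inr hx.le)).tendsto
    rw [Real.zero_rpow hx.ne'] at this
    exact this.mono_left nhdsWithin_le_nhds
  have htoinf : ∀ x : ℝ, 0 < x → Tendsto (fun ε : ℝ => ε ^ (-x)) (𝓝[>] 0) atTop := by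
    intro x hx
    refine ((tendsto_rpow_atTop hx).comp tendsto_inv_nhdsGT_zero).congr' ?_
    filter_upwards [self_mem_nhdsWithin] with ε hε
    have hε0 : (0 : ℝ) < ε := hε
    simp only [Function.comp_apply]
    rw [Real.inv_rpow hε0.le, Real.rpow_neg hε0.le]
  have hx1 : 0 < κ * (p - 1) / p - σ * κ := by
    have : σ * κ < (p - 1) / p * κ := by gcongr
    have e : κ * (p - 1) / p = (p - 1) / p * κ := by ring
    linarith
  have hx2 : 0 < κ * (1 - σ) := mul_pos hκ (by linarith)
  have hev1 := (htoinf σ hσ0).eventually_ge_atTop 2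
  have hev2 := (hto0 _ hx2).eventually_lt_const (show 0 < D / 2 by positivity)
  have hev3 := (htoinf _ hx1).eventually_ge_atTop (Real.exp 1 * 2 / (c * D))
  have hev4 := (htoinf (κ * (p - 1) / p) (by positivity)).eventually_ge_atTop
    (Real.exp (Real.exp 1) / (c * (blissProfile κ b 2 / 2)))
  have hev5 : ∀ᶠ ε : ℝ in 𝓝[>] 0,
      q * K * ε ^ (κ - β) + ε ^ (σ * (b + κ) - β) / (b + κ) < γ := by
    have h := ((hto0 (κ - β) (by linarith)).const_mul (q * K)).add
      ((hto0 (σ * (b + κ) - β) (by linarith)).div_const (b + κ))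
    rw [mul_zero, zero_div, add_zero] at h
    exact h.eventually_lt_const hγ0
  have hev6 : ∀ᶠ ε : ℝ in 𝓝[>] 0, ε < 1 := nhdsWithin_le_nhds (eventually_lt_nhds one_pos)
  obtain ⟨ε, h1, h2, h3, h4, h5, h6, hε⟩ := (hev1.and (hev2.and (hev3.and (hev4.and (hev5.and
    (hev6.and self_mem_nhdsWithin)))))).exists
  have hε0 : (0 : ℝ) < ε := hε
  obtain ⟨g, hgm, hg0, hgE, hgt⟩ := exists_test_function hp hκ hb hε0
  refine ⟨g, hgm, hg0, hgE, ?_⟩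
  set S := ε ^ (-σ) with hS
  have hUS : D * ε ^ (σ * κ) ≤ blissProfile κ b S := by
    have := le_blissProfile hκ hb (T := S) (by linarith)
    rwa [hS, ← Real.rpow_mul hε0.le, neg_mul_neg] at this
  have hη : blissProfile κ b (1 / ε) ≤ ε ^ κ := by
    refine (blissProfile_le hκ hb (by positivity)).trans (le_of_eq ?_)
    rw [one_div, Real.inv_rpow hε0.le, Real.rpow_neg hε0.le, inv_inv]
  refine lt_logIntegral_of_scale hp hκ hb hτ hβ hε0 rfl hgt h1 ?_ ?_ ?_ ?_ ?_
  · rw [one_div, ← Real.rpow_neg_one]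
    exact Real.rpow_lt_rpow_of_exponent_gt hε0 h6 (by linarith)
  · refine hη.trans (le_trans ?_ (div_le_div_of_nonneg_right hUS (by norm_num)))
    have e : ε ^ κ = ε ^ (κ * (1 - σ)) * ε ^ (σ * κ) := by
      rw [← Real.rpow_add hε0]; congr 1; ring
    rw [e]
    have := mul_le_mul_of_nonneg_right h2.le (Real.rpow_nonneg hε0.le (σ * κ))
    linarith
  · rw [div_le_iff₀ (by positivity)] at h3
    have e : ε ^ (-(κ * (p - 1) / p - σ * κ)) = ε ^ (-(κ * (p - 1) / p)) * ε ^ (σ * κ) := by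
      rw [← Real.rpow_add hε0]; congr 1; ring
    rw [e] at h3
    have h7 : c * ε ^ (-(κ * (p - 1) / p)) * (D * ε ^ (σ * κ) / 2) ≤
        c * ε ^ (-(κ * (p - 1) / p)) * (blissProfile κ b S / 2) := by gcongr
    refine le_trans ?_ h7
    linarith
  · rw [div_le_iff₀ (by positivity)] at h4
    linarith
  · have h7 := mul_lt_mul_of_pos_right h5 (Real.rpow_pos_of_pos hε0 β)
    have e1 : ε ^ (κ - β) * ε ^ β = ε ^ κ := by rw [← Real.rpow_add hε0]; congr 1; ring
    have e2 : ε ^ (σ * (b + κ) - β) * ε ^ β = S ^ (-(b + κ)) := by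
      rw [← Real.rpow_add hε0, hS, ← Real.rpow_mul hε0.le]; congr 1; ring
    have hq0 : 0 < q := by positivity
    have h8 : q * blissProfile κ b (1 / ε) * K ≤ q * ε ^ κ * K := by gcongr
    calc _ ≤ q * ε ^ κ * K + S ^ (-(b + κ)) / (b + κ) := by linarith
      _ = (q * K * ε ^ (κ - β) + ε ^ (σ * (b + κ) - β) / (b + κ)) * ε ^ β := by
          rw [← e1, ← e2]; ring
      _ < _ := h7

end Strict

/-! ### Finiteness of the supremum -/

section Weight

lemma log_weight_mono {τ x y s q : ℝ} (hτ : 1 ≤ τ) (hx : 0 ≤ x) (hxy : x ≤ y) (hs : 0 ≤ s)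
    (hq : 0 ≤ q) : x ^ q * |Real.log (τ + x)| ^ s ≤ y ^ q * |Real.log (τ + y)| ^ s := by
  have h1 : 0 ≤ Real.log (τ + x) := Real.log_nonneg (by linarith)
  have h2 : Real.log (τ + x) ≤ Real.log (τ + y) := Real.log_le_log (by linarith) (by linarith)
  rw [abs_of_nonneg h1, abs_of_nonneg (h1.trans h2)]
  exact mul_le_mul (Real.rpow_le_rpow hx hxy hq) (Real.rpow_le_rpow h1 h2 hs)
    (Real.rpow_nonneg h1 _) (Real.rpow_nonneg (hx.trans hxy) _)

/-- Near the origin the logarithmic weight is almost at most one, along functions of growth at most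
`C r ^ (-x)`. -/
lemma exists_log_weight_le {τ β C x : ℝ} (hτ : 1 ≤ τ) (hβ : 0 < β) (hC : 0 ≤ C) (hx : 0 ≤ x) {δ : ℝ}
    (hδ : 0 < δ) : ∃ ρ ∈ Ioo (0 : ℝ) 1, ∀ r ∈ Ioo 0 ρ, ∀ t, 0 ≤ t → t ≤ C * r ^ (-x) →
      |Real.log (τ + t)| ^ (r ^ β) ≤ 1 + δ := by
  have h1 : Tendsto (fun r : ℝ => Real.exp (r ^ β * Real.log (τ + C) - x * (Real.log r * r ^ β)))
      (𝓝[>] 0) (𝓝 (Real.exp (0 * Real.log (τ + C) - x * 0))) := by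
    refine (Real.continuous_exp.tendsto _).comp ?_
    refine Tendsto.sub (Tendsto.mul_const _ ?_)
      ((tendsto_log_mul_rpow_nhdsGT_zero hβ).const_mul x)
    have := (Real.continuousAt_rpow_const 0 β (Or.inr hβ.le)).tendsto
    rw [Real.zero_rpow hβ.ne'] at this
    exact this.mono_left nhdsWithin_le_nhds
  rw [zero_mul, mul_zero, sub_zero, Real.exp_zero] at h1
  have h2 := h1.eventually_lt_const (show (1 : ℝ) < 1 + δ by linarith)
  obtain ⟨ρ, hρ, hsub⟩ := mem_nhdsGT_iff_exists_Ioo_subset.1 h2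
  have hρ0 : (0 : ℝ) < ρ := hρ
  refine ⟨min ρ (1 / 2), ⟨lt_min hρ0 (by norm_num), (min_le_right _ _).trans_lt (by norm_num)⟩,
    fun r hr t ht htC => ?_⟩
  have hr0 := hr.1
  have hr1 : r ≤ 1 := (hr.2.le.trans (min_le_right _ _)).trans (by norm_num)
  have hmem : r ∈ Ioo 0 ρ := ⟨hr0, hr.2.trans_le (min_le_left _ _)⟩
  refine le_trans ?_ (hsub hmem).le
  have hlog0 : 0 ≤ Real.log (τ + t) := Real.log_nonneg (by linarith)
  have hrx : 1 ≤ r ^ (-x) := Real.one_le_rpow_of_pos_of_le_one_of_nonpos hr0 hr1 (by linarith)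
  have hlogle : Real.log (τ + t) ≤ Real.log (τ + C) - x * Real.log r := by
    have h3 : τ + t ≤ (τ + C) * r ^ (-x) := by nlinarith
    refine (Real.log_le_log (by linarith) h3).trans (le_of_eq ?_)
    rw [Real.log_mul (by linarith) (by positivity), Real.log_rpow hr0]; ring
  rw [abs_of_nonneg hlog0]
  calc Real.log (τ + t) ^ (r ^ β) ≤ Real.exp (Real.log (τ + t)) ^ (r ^ β) :=
        Real.rpow_le_rpow hlog0 ((by linarith : Real.log (τ + t) ≤ Real.log (τ + t) + 1).trans
          (Real.add_one_le_exp _)) (by positivity)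
    _ = Real.exp (r ^ β * Real.log (τ + t)) := by rw [← Real.exp_mul, mul_comm]
    _ ≤ _ := by
        refine Real.exp_le_exp.2 ?_
        have := mul_le_mul_of_nonneg_left hlogle (show 0 ≤ r ^ β by positivity)
        linarith

/-- Away from the origin the logarithmic weight is bounded. -/
lemma log_weight_le_of_le {τ β r t M : ℝ} (hτ : 1 ≤ τ) (hβ : 0 < β) (hr : r ∈ Ioo (0 : ℝ) 1)
    (ht : 0 ≤ t) (htM : t ≤ M) : |Real.log (τ + t)| ^ (r ^ β) ≤ 1 + Real.log (τ + M) := by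
  have hlog0 : 0 ≤ Real.log (τ + t) := Real.log_nonneg (by linarith)
  have hlogle : Real.log (τ + t) ≤ Real.log (τ + M) := Real.log_le_log (by linarith) (by linarith)
  have hrβ : r ^ β ≤ 1 := Real.rpow_le_one hr.1.le hr.2.le hβ.le
  rw [abs_of_nonneg hlog0]
  calc Real.log (τ + t) ^ (r ^ β) ≤ (1 + Real.log (τ + M)) ^ (r ^ β) :=
        Real.rpow_le_rpow hlog0 (by linarith) (Real.rpow_nonneg hr.1.le _)
    _ ≤ (1 + Real.log (τ + M)) ^ (1 : ℝ) :=
        Real.rpow_le_rpow_of_exponent_le (by linarith) hrβ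
    _ = _ := Real.rpow_one _

end Weight

/-- Nonnegative measurable functions of energy one, the derivatives of the competitors. -/
structure IsProfile (p a : ℝ) (g : ℝ → ℝ) : Prop where
  measurable : Measurable g
  nonneg : ∀ s, 0 ≤ g s
  energy : energyOn p a g (Ioo 0 1) = 1

/-- The supremum of the functional over the primitives of profiles. -/
def profileSup (p a θ q τ β : ℝ) : ℝ≥0∞ :=
  ⨆ (g : ℝ → ℝ) (_ : IsProfile p a g), logIntegral θ q τ β g

lemma IsProfile.logIntegral_le {p a θ q τ β : ℝ} {g : ℝ → ℝ} (h : IsProfile p a g) :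
    logIntegral θ q τ β g ≤ profileSup p a θ q τ β :=
  le_iSup₂ (f := fun g (_ : IsProfile p a g) => logIntegral θ q τ β g) g h

lemma energyOn_const_mul {p a t : ℝ} (ht : 0 ≤ t) (g : ℝ → ℝ) (S : Set ℝ) :
    energyOn p a (fun s => t * g s) S = ENNReal.ofReal (t ^ p) * energyOn p a g S := by
  unfold energyOn
  rw [← lintegral_const_mul' _ _ ENNReal.ofReal_ne_top]
  refine lintegral_congr fun r => ?_
  rw [← ENNReal.ofReal_mul (Real.rpow_nonneg ht p), abs_mul, abs_of_nonneg ht,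
    Real.mul_rpow ht (abs_nonneg _)]
  congr 1; ring

/-- Scaling up to the unit sphere: the functional is superhomogeneous of degree `q`. -/
lemma logIntegral_le_energy_rpow_mul {p a θ q τ β : ℝ} (hp : 1 < p) (ha : p - 1 < a) (hq : 0 < q)
    (hτ : 1 ≤ τ) {g : ℝ → ℝ} (hg : Measurable g) (hg0 : ∀ s, 0 ≤ g s)
    (hE : energyOn p a g (Ioo 0 1) ≤ 1) :
    logIntegral θ q τ β g ≤ energyOn p a g (Ioo 0 1) ^ (q / p) * profileSup p a θ q τ β := by
  have hp0 : 0 < p := by linarith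
  set E := energyOn p a g (Ioo 0 1) with hEdef
  rcases eq_or_ne E 0 with h0 | h0
  · have htail : ∀ r ∈ Ioo (0 : ℝ) 1, tail g r = 0 := by
      intro r hr
      have h1 := abs_tail_le hp ha hg.aemeasurable hr.1 le_rfl
        ((energyOn_mono p a g (Ioo_subset_Ioo_left hr.1.le)).trans (by rw [← hEdef, h0]; simp))
      rw [Real.zero_rpow (by positivity), mul_zero] at h1
      exact abs_nonpos_iff.1 h1
    have h1 : logIntegral θ q τ β g = ∫⁻ r in Ioo (0 : ℝ) 1, 0 := by
      refine setLIntegral_congr_fun measurableSet_Ioo fun r hr => ?_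
      simp [htail r hr, Real.zero_rpow hq.ne']
    rw [h1]; simp
  · have hEtop : E ≠ ∞ := (hE.trans_lt ENNReal.one_lt_top).ne
    set e := E.toReal with he
    have he0 : 0 < e := ENNReal.toReal_pos h0 hEtop
    have he1 : e ≤ 1 := by
      have := ENNReal.toReal_mono ENNReal.one_ne_top hE
      simpa using this
    have hEe : E = ENNReal.ofReal e := (ENNReal.ofReal_toReal hEtop).symm
    set t := e ^ (-(1 / p)) with ht
    have ht0 : 0 < t := by positivity
    have ht1 : 1 ≤ t := Real.one_le_rpow_of_pos_of_le_one_of_nonpos he0 he1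
      (by have : 0 < 1 / p := by positivity
          linarith)
    have hprof : IsProfile p a (fun s => t * g s) := by
      refine ⟨hg.const_mul t, fun s => mul_nonneg ht0.le (hg0 s), ?_⟩
      rw [energyOn_const_mul ht0.le, ← hEdef, hEe, ← ENNReal.ofReal_mul (by positivity), ht,
        ← Real.rpow_mul he0.le, neg_mul, one_div_mul_cancel hp0.ne', Real.rpow_neg_one,
        inv_mul_cancel₀ he0.ne', ENNReal.ofReal_one]
    have htail : ∀ r, tail (fun s => t * g s) r = t * tail g r := fun r => integral_const_mul _ _
    have hscale : ENNReal.ofReal (t ^ q) * logIntegral θ q τ β g ≤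
        logIntegral θ q τ β (fun s => t * g s) := by
      unfold logIntegral
      rw [← lintegral_const_mul' _ _ ENNReal.ofReal_ne_top]
      refine setLIntegral_mono' measurableSet_Ioo fun r hr => ?_
      rw [← ENNReal.ofReal_mul (by positivity), htail]
      refine ENNReal.ofReal_le_ofReal ?_
      have hu0 := tail_nonneg hg0 r
      have hm := log_weight_mono hτ hu0 (le_mul_of_one_le_left hu0 ht1)
        (Real.rpow_nonneg hr.1.le β) le_rfl
      rw [Real.rpow_zero, Real.rpow_zero, one_mul, one_mul] at hm
      have hc : 0 ≤ r ^ θ * (t * tail g r) ^ q :=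
        mul_nonneg (Real.rpow_nonneg hr.1.le _) (Real.rpow_nonneg (by positivity) _)
      refine le_trans (le_of_eq ?_) (mul_le_mul_of_nonneg_left hm hc)
      rw [Real.mul_rpow ht0.le hu0]; ring
    have h1 := mul_le_mul_right (hscale.trans hprof.logIntegral_le) (ENNReal.ofReal (e ^ (q / p)))
    rw [← mul_assoc, ← ENNReal.ofReal_mul (by positivity)] at h1
    have h2 : e ^ (q / p) * t ^ q = 1 := by
      rw [ht, ← Real.rpow_mul he0.le, ← Real.rpow_add he0,
        show q / p + -(1 / p) * q = 0 by ring, Real.rpow_zero]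
    rw [h2, ENNReal.ofReal_one, one_mul] at h1
    rwa [hEe, ENNReal.ofReal_rpow_of_pos he0]

section Concentration

variable {p κ b : ℝ}

lemma antitoneOn_tail {g : ℝ → ℝ} (hg0 : ∀ s, 0 ≤ g s)
    (hi : ∀ r, 0 < r → IntegrableOn g (Ioo r 1)) {x y : ℝ} (hx : 0 < x) (hxy : x ≤ y) :
    tail g y ≤ tail g x :=
  setIntegral_mono_set (hi x hx) (.of_forall hg0)
    (LE.le.eventuallyLE (Ioo_subset_Ioo_left hxy))

lemma aemeasurable_tail {g : ℝ → ℝ} (hi : ∀ r, 0 < r → IntegrableOn g (Ioo r 1)) :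
    AEMeasurable (tail g) (volume.restrict (Ioo (0 : ℝ) 1)) :=
  (locallyAC_tail hi).continuousOn.aemeasurable measurableSet_Ioo

/-- Upper bound for the part of the critical integral near the origin by the energy near the origin
and the value of the primitive at the end point. -/
lemma lintegral_near_zero_le (hp : 1 < p) (hκ : 0 < κ) (hb : 0 < b) {g : ℝ → ℝ} (hg : Measurable g)
    (hg0 : ∀ s, 0 ≤ g s) (hE : energyOn p ((κ + 1) * (p - 1)) g (Ioo 0 1) ≤ 1) {ρ : ℝ}
    (hρ : ρ ∈ Ioo (0 : ℝ) 1) {s : ℝ≥0∞} (hs : energyOn p ((κ + 1) * (p - 1)) g (Ioo 0 ρ) ≤ s) :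
    ∫⁻ r in Ioo 0 ρ, ENNReal.ofReal
        (r ^ ((b + κ) * (p - 1) - 1) * tail g r ^ ((b + κ) * p / κ)) ≤
      ((ENNReal.ofReal (blissConst p κ b) * s ^ ((b + κ) / κ)) ^ (1 / ((b + κ) * p / κ)) +
        (∫⁻ r in Ioo 0 ρ, ENNReal.ofReal (r ^ ((b + κ) * (p - 1) - 1) *
          tail g ρ ^ ((b + κ) * p / κ))) ^ (1 / ((b + κ) * p / κ))) ^ ((b + κ) * p / κ) := by
  have hp0 : 0 < p := by linarith
  set a := (κ + 1) * (p - 1) with ha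
  have ha1 : p - 1 < a := by rw [ha]; nlinarith
  set q := (b + κ) * p / κ with hq
  set n := (b + κ) * (p - 1) with hn
  have hq1 : 1 ≤ q := by rw [hq, le_div_iff₀ hκ]; nlinarith
  have hq0 : 0 < q := by linarith
  have hi := integrableOn_tail hp ha1 hg hE
  set h : ℝ → ℝ := (Iio ρ).indicator g with hh
  have hhm : Measurable h := hg.indicator measurableSet_Iio
  have hh0 : ∀ s, 0 ≤ h s := fun s => indicator_nonneg (fun s _ => hg0 s) s
  have hhE : energyOn p a h (Ioo 0 1) = energyOn p a g (Ioo 0 ρ) := by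
    have h1 : energyOn p a h (Ioo 0 1) =
        ∫⁻ r in Ioo 0 1, (Iio ρ).indicator (fun r => ENNReal.ofReal (r ^ a * |g r| ^ p)) r := by
      refine lintegral_congr fun r => ?_
      by_cases hr : r < ρ
      · simp [hh, indicator, hr]
      · simp [hh, indicator, hr, Real.zero_rpow hp0.ne']
    rw [h1, lintegral_indicator measurableSet_Iio, Measure.restrict_restrict measurableSet_Iio]
    unfold energyOn
    congr 2
    ext x; simp only [mem_inter_iff, mem_Iio, mem_Ioo]
    exact ⟨fun h => ⟨h.2.1, h.1⟩, fun h => ⟨h.2, h.1, h.2.trans hρ.2⟩⟩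
  have hhE1 : energyOn p a h (Ioo 0 1) ≤ 1 := by
    rw [hhE]; exact (energyOn_mono p a g (Ioo_subset_Ioo_right hρ.2.le)).trans hE
  have hih := integrableOn_tail hp ha1 hhm hhE1
  have htail : ∀ r ∈ Ioo 0 ρ, tail g r = tail h r + tail g ρ := by
    intro r hr
    have h1 : tail h r = ∫ s in Ioo r ρ, g s := by
      rw [tail, setIntegral_indicator measurableSet_Iio]
      congr 2
      ext x; simp only [mem_inter_iff, mem_Iio, mem_Ioo]
      exact ⟨fun h => ⟨h.1.1, h.2⟩, fun h => ⟨⟨h.1, h.2.trans hρ.2⟩, h.2⟩⟩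
    rw [h1, tail_eq_sub (hi r hr.1) ⟨hr.2.le, hρ.2.le⟩,
      intervalIntegral.integral_of_le hr.2.le, integral_Ioc_eq_integral_Ioo]
    ring
  have hpow : ∀ r ∈ Ioo 0 ρ, ∀ t, 0 ≤ t →
      ENNReal.ofReal (r ^ ((n - 1) / q) * t) ^ q = ENNReal.ofReal (r ^ (n - 1) * t ^ q) := by
    intro r hr t ht
    have hr0 := hr.1
    rw [ENNReal.ofReal_rpow_of_nonneg (by positivity) hq0.le, Real.mul_rpow (by positivity) ht,
      ← Real.rpow_mul hr0.le, div_mul_cancel₀ _ hq0.ne']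
  have hmt : AEMeasurable (fun r : ℝ => ENNReal.ofReal (r ^ ((n - 1) / q) * tail h r))
      (volume.restrict (Ioo 0 ρ)) := by
    have := (aemeasurable_tail hih).mono_measure
      (Measure.restrict_mono (Ioo_subset_Ioo_right hρ.2.le) le_rfl)
    fun_prop
  have hmink := ENNReal.lintegral_Lp_add_le hmt
    (g := fun r => ENNReal.ofReal (r ^ ((n - 1) / q) * tail g ρ)) (by fun_prop) hq1
  have e1 : ∫⁻ r in Ioo 0 ρ, ((fun r : ℝ => ENNReal.ofReal (r ^ ((n - 1) / q) * tail h r)) +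
      fun r => ENNReal.ofReal (r ^ ((n - 1) / q) * tail g ρ)) r ^ q =
      ∫⁻ r in Ioo 0 ρ, ENNReal.ofReal (r ^ (n - 1) * tail g r ^ q) := by
    refine setLIntegral_congr_fun measurableSet_Ioo fun r hr => ?_
    have hr0 := hr.1
    have h1 := tail_nonneg hh0 r
    have h2 := tail_nonneg hg0 ρ
    simp only [Pi.add_apply]
    rw [← ENNReal.ofReal_add (by positivity) (by positivity), ← mul_add, ← htail r hr,
      hpow r hr _ (tail_nonneg hg0 r)]
  have e2 : ∫⁻ r in Ioo 0 ρ, ENNReal.ofReal (r ^ ((n - 1) / q) * tail h r) ^ q ≤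
      ENNReal.ofReal (blissConst p κ b) * s ^ ((b + κ) / κ) := by
    calc _ = ∫⁻ r in Ioo 0 ρ, ENNReal.ofReal (r ^ (n - 1) * tail h r ^ q) :=
          setLIntegral_congr_fun measurableSet_Ioo fun r hr => hpow r hr _ (tail_nonneg hh0 r)
      _ ≤ ∫⁻ r in Ioo 0 1, ENNReal.ofReal (r ^ (n - 1) * tail h r ^ q) :=
          lintegral_mono_set (Ioo_subset_Ioo_right hρ.2.le)
      _ ≤ _ := bliss_inequality hp hκ hb hhm.aemeasurable hh0
      _ ≤ _ := by rw [← ha, hhE]; gcongr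
  have e3 : ∫⁻ r in Ioo 0 ρ, ENNReal.ofReal (r ^ ((n - 1) / q) * tail g ρ) ^ q =
      ∫⁻ r in Ioo 0 ρ, ENNReal.ofReal (r ^ (n - 1) * tail g ρ ^ q) :=
    setLIntegral_congr_fun measurableSet_Ioo fun r hr => hpow r hr _ (tail_nonneg hg0 ρ)
  rw [e1, e3] at hmink
  have hfin := ENNReal.rpow_le_rpow hmink hq0.le
  rw [← ENNReal.rpow_mul, one_div_mul_cancel hq0.ne', ENNReal.rpow_one] at hfin
  refine hfin.trans ?_
  gcongr

lemma lintegral_weight_le {θ q τ β c : ℝ} (hc : 0 ≤ c) {g : ℝ → ℝ} (hg0 : ∀ s, 0 ≤ g s) {x y : ℝ}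
    (hx : 0 ≤ x) (h : ∀ r ∈ Ioo x y, |Real.log (τ + tail g r)| ^ (r ^ β) ≤ c) :
    ∫⁻ r in Ioo x y, ENNReal.ofReal
        (r ^ θ * tail g r ^ q * |Real.log (τ + tail g r)| ^ (r ^ β)) ≤
      ENNReal.ofReal c * ∫⁻ r in Ioo x y, ENNReal.ofReal (r ^ θ * tail g r ^ q) := by
  rw [← lintegral_const_mul' _ _ ENNReal.ofReal_ne_top]
  refine setLIntegral_mono' measurableSet_Ioo fun r hr => ?_
  rw [← ENNReal.ofReal_mul hc, mul_comm c]
  exact ENNReal.ofReal_le_ofReal (mul_le_mul_of_nonneg_left (h r hr)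
    (mul_nonneg (Real.rpow_nonneg (hx.trans hr.1.le) _) (Real.rpow_nonneg (tail_nonneg hg0 r) _)))

lemma lintegral_Ioo_split (f : ℝ → ℝ≥0∞) {ρ : ℝ} (hρ : ρ ∈ Ioo (0 : ℝ) 1) :
    ∫⁻ r in Ioo (0 : ℝ) 1, f r = (∫⁻ r in Ioo 0 ρ, f r) + ∫⁻ r in Ioo ρ 1, f r := by
  rw [← Ioc_union_Ioo_eq_Ioo hρ.1.le hρ.2, lintegral_union measurableSet_Ioo
    (Set.disjoint_left.2 fun x hx hx' => absurd hx.2 (not_le.2 hx'.1)),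
    ← restrict_Ioo_eq_restrict_Ioc (a := 0) (b := ρ)]

lemma tail_le_of_energy_le_one {a : ℝ} (hp : 1 < p) (ha : p - 1 < a) {g : ℝ → ℝ}
    (hg : Measurable g) (hE : energyOn p a g (Ioo 0 1) ≤ 1) {r : ℝ} (hr : 0 < r) :
    tail g r ≤ tailConst p a * r ^ (-((a - p + 1) / p)) := by
  have := abs_tail_le hp ha hg.aemeasurable hr zero_le_one
    ((energyOn_mono p a g (Ioo_subset_Ioo_left hr.le)).trans (by simpa using hE))
  rw [Real.one_rpow, mul_one] at this
  exact (le_abs_self _).trans this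

lemma profileSup_lt_top (hp : 1 < p) (hκ : 0 < κ) (hb : 0 < b) {τ β : ℝ} (hτ : 1 ≤ τ)
    (hβ : 0 < β) : profileSup p ((κ + 1) * (p - 1)) ((b + κ) * (p - 1) - 1) ((b + κ) * p / κ) τ β
      < ∞ := by
  have hp0 : 0 < p := by linarith
  set a := (κ + 1) * (p - 1) with ha
  have ha1 : p - 1 < a := by rw [ha]; nlinarith
  have hC := tailConst_pos hp ha1
  have hk : 0 ≤ (a - p + 1) / p := div_nonneg (by linarith) hp0.le
  obtain ⟨ρ, hρ, hw⟩ := exists_log_weight_le hτ hβ hC.le hk one_pos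
  set M := tailConst p a * ρ ^ (-((a - p + 1) / p)) with hM
  have hM0 : 0 < M := by have := hρ.1; positivity
  have hL : 0 ≤ Real.log (τ + M) := Real.log_nonneg (by linarith)
  refine lt_of_le_of_lt (iSup₂_le fun g hg => ?_)
    (show ENNReal.ofReal (1 + 1) * ENNReal.ofReal (blissConst p κ b) +
      ENNReal.ofReal (1 + Real.log (τ + M)) * ENNReal.ofReal (blissConst p κ b) < ∞ from
      ENNReal.add_lt_top.2 ⟨ENNReal.mul_lt_top ENNReal.ofReal_lt_top ENNReal.ofReal_lt_top,
        ENNReal.mul_lt_top ENNReal.ofReal_lt_top ENNReal.ofReal_lt_top⟩)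
  have hbl := bliss_inequality hp hκ hb hg.measurable.aemeasurable hg.nonneg
  rw [← ha, hg.energy, ENNReal.one_rpow, mul_one] at hbl
  rw [logIntegral, lintegral_Ioo_split _ hρ]
  refine add_le_add ?_ ?_
  · refine (lintegral_weight_le (by norm_num) hg.nonneg le_rfl fun r hr => hw r hr _
      (tail_nonneg hg.nonneg r)
      (tail_le_of_energy_le_one hp ha1 hg.measurable hg.energy.le hr.1)).trans ?_
    gcongr
    exact (lintegral_mono_set (Ioo_subset_Ioo_right hρ.2.le)).trans hbl
  · refine (lintegral_weight_le (c := 1 + Real.log (τ + M)) (by linarith) hg.nonneg hρ.1.le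
      fun r hr => log_weight_le_of_le hτ hβ ⟨hρ.1.trans hr.1, hr.2⟩ (tail_nonneg hg.nonneg r)
      ((antitoneOn_tail hg.nonneg (integrableOn_tail hp ha1 hg.measurable hg.energy.le) hρ.1
        hr.1.le).trans
        (tail_le_of_energy_le_one hp ha1 hg.measurable hg.energy.le hρ.1))).trans ?_
    gcongr
    exact (lintegral_mono_set (Ioo_subset_Ioo_left hρ.1.le)).trans hbl

end Concentration

/-! ### Exclusion of concentration at the origin -/

/-- The energy on `(ρ, 1)` exhausts the energy on `(0, 1)`. -/
lemma exists_lt_energyOn {p a : ℝ} {G : ℝ → ℝ} {c : ℝ≥0∞} (h : c < energyOn p a G (Ioo 0 1)) :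
    ∃ ρ ∈ Ioo (0 : ℝ) 1, ∀ r, r ≤ ρ → c < energyOn p a G (Ioo r 1) := by
  have hU : Ioo (0 : ℝ) 1 = ⋃ n : ℕ, Ioo (1 / ((n : ℝ) + 2)) 1 := by
    ext x
    simp only [mem_iUnion, mem_Ioo]
    constructor
    · rintro ⟨h0, h1⟩
      obtain ⟨n, hn⟩ := exists_nat_one_div_lt h0
      refine ⟨n, lt_of_le_of_lt ?_ hn, h1⟩
      gcongr; norm_num
    · rintro ⟨n, h0, h1⟩
      exact ⟨lt_trans (by positivity) h0, h1⟩
  have hmono : Monotone fun n : ℕ => Ioo (1 / ((n : ℝ) + 2)) 1 := by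
    intro m n hmn
    refine Ioo_subset_Ioo_left ?_
    gcongr
  rw [hU, energyOn, setLIntegral_iUnion_of_directed _ hmono.directed_le, lt_iSup_iff] at h
  obtain ⟨n, hn⟩ := h
  refine ⟨1 / ((n : ℝ) + 2), ⟨by positivity, ?_⟩, fun r hr =>
    hn.trans_le (energyOn_mono p a G (Ioo_subset_Ioo_left hr))⟩
  rw [div_lt_one (by positivity)]
  linarith [Nat.cast_nonneg (α := ℝ) n]

section Limit

variable {p : ℝ}

/-- Away from the origin the functional is continuous along a sequence of primitives which
converges pointwise. -/
lemma tendsto_lintegral_weight {a θ q τ β : ℝ} (hp : 1 < p) (ha : p - 1 < a) (hq : 0 < q)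
    (hτ : 1 ≤ τ) (hβ : 0 < β) {g : ℕ → ℝ → ℝ} {u : ℝ → ℝ} (hg : ∀ n, Measurable (g n))
    (hg0 : ∀ n s, 0 ≤ g n s) (hE : ∀ n, energyOn p a (g n) (Ioo 0 1) ≤ 1)
    (hu : ∀ r ∈ Ioo (0 : ℝ) 1, Tendsto (fun n => tail (g n) r) atTop (𝓝 (u r))) {ρ : ℝ}
    (hρ : ρ ∈ Ioo (0 : ℝ) 1) :
    Tendsto (fun n => ∫⁻ r in Ioo ρ 1, ENNReal.ofReal
        (r ^ θ * tail (g n) r ^ q * |Real.log (τ + tail (g n) r)| ^ (r ^ β))) atTop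
      (𝓝 (∫⁻ r in Ioo ρ 1, ENNReal.ofReal (r ^ θ * u r ^ q * |Real.log (τ + u r)| ^ (r ^ β)))) := by
  have hC := tailConst_pos hp ha
  have hρ0 := hρ.1
  set M := tailConst p a * ρ ^ (-((a - p + 1) / p)) with hM
  have hM0 : 0 < M := by positivity
  have hL : 0 ≤ Real.log (τ + M) := Real.log_nonneg (by linarith)
  have hi : ∀ n, ∀ r, 0 < r → IntegrableOn (g n) (Ioo r 1) := fun n =>
    integrableOn_tail hp ha (hg n) (hE n)
  refine tendsto_lintegral_of_dominated_convergence'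
    (fun r => ENNReal.ofReal (r ^ θ * (M ^ q * (1 + Real.log (τ + M))))) (fun n => ?_)
    (fun n => ?_) ?_ ?_
  · have := (aemeasurable_tail (hi n)).mono_measure
      (Measure.restrict_mono (Ioo_subset_Ioo_left hρ.1.le) le_rfl)
    have h2 : AEMeasurable (fun r => |Real.log (τ + tail (g n) r)| ^ (r ^ β))
        (volume.restrict (Ioo ρ 1)) := by
      have h3 : AEMeasurable (fun r => |Real.log (τ + tail (g n) r)|)
          (volume.restrict (Ioo ρ 1)) := (Real.measurable_log.comp_aemeasurable
            (this.const_add τ)).norm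
      exact h3.pow (by fun_prop)
    fun_prop
  · filter_upwards [ae_restrict_mem measurableSet_Ioo] with r hr
    have hr0 : 0 < r := hρ0.trans hr.1
    have ht := tail_nonneg (hg0 n) r
    have htM : tail (g n) r ≤ M := (antitoneOn_tail (hg0 n) (hi n) hρ0 hr.1.le).trans
      (tail_le_of_energy_le_one hp ha (hg n) (hE n) hρ0)
    refine ENNReal.ofReal_le_ofReal ?_
    rw [mul_assoc]
    refine mul_le_mul_of_nonneg_left ?_ (by positivity)
    exact mul_le_mul (Real.rpow_le_rpow ht htM hq.le)
      (log_weight_le_of_le hτ hβ ⟨hr0, hr.2⟩ ht htM) (Real.rpow_nonneg (abs_nonneg _) _)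
      (by positivity)
  · have hc : ContinuousOn (fun r : ℝ => r ^ θ * (M ^ q * (1 + Real.log (τ + M)))) (Icc ρ 1) :=
      ContinuousOn.mul (fun r hr => (Real.continuousAt_rpow_const _ _
        (Or.inl (hρ0.trans_le hr.1).ne')).continuousWithinAt) continuousOn_const
    have := (hc.integrableOn_Icc (μ := volume)).mono_set (Ioo_subset_Icc_self (a := ρ) (b := 1))
    exact this.lintegral_lt_top.ne
  · filter_upwards [ae_restrict_mem measurableSet_Ioo] with r hr
    have hr0 : 0 < r := hρ0.trans hr.1
    have hur := hu r ⟨hr0, hr.2⟩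
    have hu0 : 0 ≤ u r := ge_of_tendsto' hur fun n => tail_nonneg (hg0 n) r
    refine ENNReal.tendsto_ofReal ?_
    refine Tendsto.mul ((hur.rpow_const (Or.inr hq.le)).const_mul _) ?_
    refine Tendsto.rpow_const ?_ (Or.inr (by positivity))
    exact (((hur.const_add τ).log (by linarith)).abs)

/-- The alternative at the origin: a loss `1 - E` of energy in the limit contributes at most the
Bliss constant times a power of the lost energy. -/
lemma limit_le_logIntegral_add {κ b : ℝ} (hp : 1 < p) (hκ : 0 < κ) (hb : 0 < b) {τ β : ℝ}
    (hτ : 1 ≤ τ) (hβ : 0 < β) {g : ℕ → ℝ → ℝ}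
    (hg : ∀ n, IsProfile p ((κ + 1) * (p - 1)) (g n)) {u G : ℝ → ℝ}
    (hu : ∀ r ∈ Ioo (0 : ℝ) 1, Tendsto (fun n => tail (g n) r) atTop (𝓝 (u r)))
    (hG : Measurable G) (hG0 : ∀ s, 0 ≤ G s) (huG : ∀ r ∈ Ioo (0 : ℝ) 1, u r ≤ tail G r)
    (hGE : ∀ ρ, 0 ≤ ρ → energyOn p ((κ + 1) * (p - 1)) G (Ioo ρ 1) ≤
      liminf (fun n => energyOn p ((κ + 1) * (p - 1)) (g n) (Ioo ρ 1)) atTop)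
    (hGE1 : energyOn p ((κ + 1) * (p - 1)) G (Ioo 0 1) ≤ 1) {F : ℝ≥0∞}
    (hF : Tendsto (fun n => logIntegral ((b + κ) * (p - 1) - 1) ((b + κ) * p / κ) τ β (g n)) atTop
      (𝓝 F)) :
    F ≤ ENNReal.ofReal (blissConst p κ b) *
        (1 - energyOn p ((κ + 1) * (p - 1)) G (Ioo 0 1)) ^ ((b + κ) / κ) +
      logIntegral ((b + κ) * (p - 1) - 1) ((b + κ) * p / κ) τ β G := by
  have hp0 : 0 < p := by linarith
  have hn0 : 0 < (b + κ) * (p - 1) := mul_pos (by linarith) (by linarith)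
  have hbl := bliss_inequality hp hκ hb hG.aemeasurable hG0
  have hlow := fun n (ρ : ℝ) (hρ : ρ ∈ Ioo (0 : ℝ) 1) (s : ℝ≥0∞) =>
    lintegral_near_zero_le hp hκ hb (hg n).measurable (hg n).nonneg (hg n).energy.le hρ (s := s)
  set a := (κ + 1) * (p - 1) with ha
  have ha1 : p - 1 < a := by rw [ha]; nlinarith
  set q := (b + κ) * p / κ with hq
  set x := (b + κ) / κ with hx
  set n' := (b + κ) * (p - 1) with hn
  set S := ENNReal.ofReal (blissConst p κ b) with hS
  set E := energyOn p a G (Ioo 0 1) with hEdef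
  have hq0 : 0 < q := by rw [hq]; positivity
  have hx0 : 0 < x := by rw [hx]; positivity
  have hC := tailConst_pos hp ha1
  have hk : 0 ≤ (a - p + 1) / p := div_nonneg (by linarith) hp0.le
  have hi := integrableOn_tail hp ha1 hG hGE1
  set L := logIntegral (n' - 1) q τ β G with hL
  have hu0 : ∀ r ∈ Ioo (0 : ℝ) 1, 0 ≤ u r := fun r hr =>
    ge_of_tendsto' (hu r hr) fun n => tail_nonneg (hg n).nonneg r
  set Z : ℝ → ℝ≥0∞ := fun ρ => ∫⁻ r in Ioo 0 ρ, ENNReal.ofReal (r ^ (n' - 1) * tail G r ^ q) with hZ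
  have hSE : S * E ^ x ≠ ∞ := ENNReal.mul_ne_top ENNReal.ofReal_ne_top
    (ENNReal.rpow_lt_top_of_nonneg hx0.le (hGE1.trans_lt ENNReal.one_lt_top).ne).ne
  -- the boundary term of the Minkowski splitting at `ρ` is dominated by `Z ρ`, which vanishes with
  -- `ρ` because `tail G` is decreasing
  have hZlim : Tendsto Z (𝓝[>] 0) (𝓝 0) := by
    have h1 : Tendsto ((volume.restrict (Ioo (0 : ℝ) 1)) ∘ fun ρ => Ioo 0 ρ) (𝓝[>] (0 : ℝ)) (𝓝 0) := by
      have h2 : Tendsto (fun ρ : ℝ => ENNReal.ofReal (ρ - 0)) (𝓝[>] (0 : ℝ)) (𝓝 0) := by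
        have h3 : Tendsto (fun ρ : ℝ => ENNReal.ofReal (ρ - 0)) (𝓝 (0 : ℝ))
            (𝓝 (ENNReal.ofReal (0 - 0))) :=
          ENNReal.tendsto_ofReal (tendsto_id.sub_const 0)
        rw [sub_zero, ENNReal.ofReal_zero] at h3
        exact h3.mono_left nhdsWithin_le_nhds
      refine tendsto_of_tendsto_of_tendsto_of_le_of_le tendsto_const_nhds h2
        (fun _ => zero_le) fun ρ => ?_
      exact (Measure.restrict_apply_le _ _).trans_eq Real.volume_Ioo
    have h2 := tendsto_setLIntegral_zero (hbl.trans_lt hSE.lt_top).ne h1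
    refine h2.congr' ?_
    filter_upwards [Ioo_mem_nhdsGT one_pos] with ρ hρ
    rw [Measure.restrict_restrict measurableSet_Ioo,
      inter_eq_left.2 (Ioo_subset_Ioo_right hρ.2.le)]
  have key : ∀ δ > 0, F ≤ ENNReal.ofReal (1 + δ) * (S * ((1 - E) + ENNReal.ofReal δ) ^ x) + L := by
    intro δ hδ
    -- `s` bounds the energy left on a small interval `(0, ρ)` along the sequence
    set s := (1 - E) + ENNReal.ofReal δ with hs
    obtain ⟨ρ₀, hρ₀, hw⟩ := exists_log_weight_le hτ hβ hC.le hk hδ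
    obtain ⟨ρ₁, hρ₁, hρs⟩ : ∃ ρ ∈ Ioo (0 : ℝ) 1, ∀ r, r ≤ ρ →
        1 ≤ s ∨ 1 - s < energyOn p a G (Ioo r 1) := by
      rcases le_or_gt 1 s with h1 | h1
      · exact ⟨1 / 2, ⟨by norm_num, by norm_num⟩, fun _ _ => Or.inl h1⟩
      · have h2 : 1 - s < E := by
          refine ENNReal.sub_lt_of_lt_add h1.le ?_
          have h3 : (1 : ℝ≥0∞) = E + (1 - E) := (add_tsub_cancel_of_le hGE1).symm
          have h4 : E + (1 - E) < E + s := by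
            refine ENNReal.add_lt_add_left (hGE1.trans_lt ENNReal.one_lt_top).ne ?_
            rw [hs]
            exact ENNReal.lt_add_right (ENNReal.sub_ne_top ENNReal.one_ne_top)
              (by simpa using hδ)
          rwa [← h3] at h4
        obtain ⟨ρ, hρ, H⟩ := exists_lt_energyOn h2
        exact ⟨ρ, hρ, fun r hr => Or.inr (H r hr)⟩
    have step : ∀ ρ ∈ Ioo (0 : ℝ) (min ρ₀ ρ₁), F ≤ ENNReal.ofReal (1 + δ) *
        ((S * s ^ x) ^ (1 / q) + Z ρ ^ (1 / q)) ^ q + L := by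
      intro ρ hρ
      have hρ01 : ρ ∈ Ioo (0 : ℝ) 1 := ⟨hρ.1, (hρ.2.trans_le (min_le_left _ _)).trans hρ₀.2⟩
      have hen : ∀ᶠ n in atTop, energyOn p a (g n) (Ioo 0 ρ) ≤ s := by
        rcases hρs ρ (hρ.2.le.trans (min_le_right _ _)) with h1 | h1
        · refine .of_forall fun n => le_trans ?_ h1
          rw [← (hg n).energy]
          exact energyOn_mono p a _ (Ioo_subset_Ioo_right hρ01.2.le)
        · have h2 := eventually_lt_of_lt_liminf (h1.trans_le (hGE ρ hρ01.1.le))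
          filter_upwards [h2] with n hn
          have h3 : energyOn p a (g n) (Ioo 0 ρ) + energyOn p a (g n) (Ioo ρ 1) = 1 := by
            rw [← (hg n).energy]
            exact (lintegral_Ioo_split _ hρ01).symm
          have h4 : energyOn p a (g n) (Ioo ρ 1) ≠ ∞ := fun h => by simp [h] at h3
          have h5 : 1 ≤ s + energyOn p a (g n) (Ioo ρ 1) := tsub_le_iff_left.1 hn.le
          rw [← h3] at h5
          exact (ENNReal.add_le_add_iff_right h4).1 h5
      set m := ∫⁻ r in Ioo 0 ρ, ENNReal.ofReal (r ^ (n' - 1)) with hm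
      have hmz : ∀ t, 0 ≤ t → ∫⁻ r in Ioo 0 ρ, ENNReal.ofReal (r ^ (n' - 1) * t ^ q) =
          m * ENNReal.ofReal (t ^ q) := by
        intro t ht
        rw [hm, ← lintegral_mul_const' _ _ ENNReal.ofReal_ne_top]
        refine setLIntegral_congr_fun measurableSet_Ioo fun r hr => ?_
        exact ENNReal.ofReal_mul (Real.rpow_nonneg hr.1.le _)
      have hmfin : m ≠ ∞ := by
        have := (intervalIntegral.intervalIntegrable_rpow' (a := 0) (b := ρ)
          (show -1 < n' - 1 by linarith))
        rw [intervalIntegrable_iff_integrableOn_Ioo_of_le hρ.1.le] at this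
        exact this.lintegral_lt_top.ne
      have hbound : ∀ᶠ n in atTop, logIntegral (n' - 1) q τ β (g n) ≤
          ENNReal.ofReal (1 + δ) * ((S * s ^ x) ^ (1 / q) +
            (m * ENNReal.ofReal (tail (g n) ρ ^ q)) ^ (1 / q)) ^ q +
          ∫⁻ r in Ioo ρ 1, ENNReal.ofReal
            (r ^ (n' - 1) * tail (g n) r ^ q * |Real.log (τ + tail (g n) r)| ^ (r ^ β)) := by
        filter_upwards [hen] with n hn
        rw [logIntegral, lintegral_Ioo_split _ hρ01]
        gcongr
        refine (lintegral_weight_le (c := 1 + δ) (by linarith) (hg n).nonneg le_rfl fun r hr =>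
          hw r ⟨hr.1, hr.2.trans (hρ.2.trans_le (min_le_left _ _))⟩ _ (tail_nonneg (hg n).nonneg r)
          (tail_le_of_energy_le_one hp ha1 (hg n).measurable (hg n).energy.le hr.1)).trans ?_
        gcongr
        rw [← hmz _ (tail_nonneg (hg n).nonneg ρ)]
        exact hlow n ρ hρ01 s hn
      have hlimit : Tendsto (fun n => ENNReal.ofReal (1 + δ) * ((S * s ^ x) ^ (1 / q) +
            (m * ENNReal.ofReal (tail (g n) ρ ^ q)) ^ (1 / q)) ^ q +
          ∫⁻ r in Ioo ρ 1, ENNReal.ofReal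
            (r ^ (n' - 1) * tail (g n) r ^ q * |Real.log (τ + tail (g n) r)| ^ (r ^ β))) atTop
          (𝓝 (ENNReal.ofReal (1 + δ) * ((S * s ^ x) ^ (1 / q) +
            (m * ENNReal.ofReal (u ρ ^ q)) ^ (1 / q)) ^ q +
          ∫⁻ r in Ioo ρ 1, ENNReal.ofReal
            (r ^ (n' - 1) * u r ^ q * |Real.log (τ + u r)| ^ (r ^ β)))) := by
        refine Tendsto.add ?_ (tendsto_lintegral_weight hp ha1 hq0 hτ hβ
          (fun n => (hg n).measurable) (fun n => (hg n).nonneg) (fun n => (hg n).energy.le) hu hρ01)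
        refine ENNReal.Tendsto.const_mul ?_ (Or.inr ENNReal.ofReal_ne_top)
        refine Tendsto.ennrpow_const _ (tendsto_const_nhds.add ?_)
        refine Tendsto.ennrpow_const _ (ENNReal.Tendsto.const_mul ?_ (Or.inr hmfin))
        exact ENNReal.tendsto_ofReal ((hu ρ hρ01).rpow_const (Or.inr hq0.le))
      refine (le_of_tendsto_of_tendsto hF hlimit hbound).trans ?_
      have hZρ : m * ENNReal.ofReal (u ρ ^ q) ≤ Z ρ := by
        rw [← hmz _ (hu0 ρ hρ01)]
        refine setLIntegral_mono' measurableSet_Ioo fun r hr => ENNReal.ofReal_le_ofReal ?_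
        refine mul_le_mul_of_nonneg_left (Real.rpow_le_rpow (hu0 ρ hρ01)
          ((huG ρ hρ01).trans (antitoneOn_tail hG0 hi hr.1 hr.2.le)) hq0.le)
          (Real.rpow_nonneg hr.1.le _)
      have hLρ : ∫⁻ r in Ioo ρ 1, ENNReal.ofReal
            (r ^ (n' - 1) * u r ^ q * |Real.log (τ + u r)| ^ (r ^ β)) ≤ L := by
        refine le_trans ?_ (lintegral_mono_set (Ioo_subset_Ioo_left hρ01.1.le))
        refine setLIntegral_mono' measurableSet_Ioo fun r hr => ENNReal.ofReal_le_ofReal ?_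
        have hr01 : r ∈ Ioo (0 : ℝ) 1 := ⟨hρ01.1.trans hr.1, hr.2⟩
        rw [mul_assoc, mul_assoc]
        exact mul_le_mul_of_nonneg_left (log_weight_mono hτ (hu0 r hr01) (huG r hr01)
          (Real.rpow_nonneg hr01.1.le _) hq0.le) (Real.rpow_nonneg hr01.1.le _)
      gcongr
    have hlim : Tendsto (fun ρ => ENNReal.ofReal (1 + δ) *
        ((S * s ^ x) ^ (1 / q) + Z ρ ^ (1 / q)) ^ q + L) (𝓝[>] 0)
        (𝓝 (ENNReal.ofReal (1 + δ) * ((S * s ^ x) ^ (1 / q) + 0 ^ (1 / q)) ^ q + L)) := by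
      refine Tendsto.add_const _ (ENNReal.Tendsto.const_mul ?_ (Or.inr ENNReal.ofReal_ne_top))
      exact Tendsto.ennrpow_const _ (tendsto_const_nhds.add (Tendsto.ennrpow_const _ hZlim))
    rw [ENNReal.zero_rpow_of_pos (by positivity), add_zero, ← ENNReal.rpow_mul,
      one_div_mul_cancel hq0.ne', ENNReal.rpow_one] at hlim
    refine ge_of_tendsto hlim ?_
    filter_upwards [Ioo_mem_nhdsGT (lt_min hρ₀.1 hρ₁.1)] with ρ hρ using step ρ hρ
  have hlim : Tendsto (fun δ : ℝ => ENNReal.ofReal (1 + δ) *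
      (S * ((1 - E) + ENNReal.ofReal δ) ^ x) + L) (𝓝 0)
      (𝓝 (ENNReal.ofReal (1 + 0) * (S * ((1 - E) + ENNReal.ofReal 0) ^ x) + L)) := by
    refine Tendsto.add_const _ (ENNReal.Tendsto.mul ?_ (Or.inl (by simp)) ?_
      (Or.inr ENNReal.ofReal_ne_top))
    · exact ENNReal.tendsto_ofReal (tendsto_id.const_add 1)
    · refine ENNReal.Tendsto.const_mul ?_ (Or.inr ENNReal.ofReal_ne_top)
      exact Tendsto.ennrpow_const _ (tendsto_const_nhds.add (ENNReal.tendsto_ofReal tendsto_id))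
  rw [add_zero, ENNReal.ofReal_one, one_mul, ENNReal.ofReal_zero, add_zero] at hlim
  refine ge_of_tendsto (hlim.mono_left (nhdsWithin_le_nhds (s := Ioi 0))) ?_
  filter_upwards [self_mem_nhdsWithin] with δ hδ using key δ hδ

/-- Some profile attains the supremum. No energy can concentrate at the origin, because the
supremum exceeds the Bliss constant and the functional grows faster than linearly in the energy. -/
lemma exists_logIntegral_eq_profileSup {κ b : ℝ} (hp : 1 < p) (hκ : 0 < κ) (hb : 0 < b) {τ β : ℝ}
    (hτ : 1 ≤ τ) (hβ : 0 < β) (hβκ : β < κ) (hβb : β < (b + κ) * (p - 1) / p) :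
    ∃ G, IsProfile p ((κ + 1) * (p - 1)) G ∧
      logIntegral ((b + κ) * (p - 1) - 1) ((b + κ) * p / κ) τ β G =
        profileSup p ((κ + 1) * (p - 1)) ((b + κ) * (p - 1) - 1) ((b + κ) * p / κ) τ β := by
  have hp0 : 0 < p := by linarith
  have hFtop := profileSup_lt_top hp hκ hb hτ hβ
  obtain ⟨g₀, hg₀, hg₀0, hg₀E, hg₀S⟩ := exists_lt_logIntegral hp hκ hb hτ hβ hβκ hβb
  have hlimit := fun g hg u G hu hG hG0 huG hGE hGE1 F hF =>
    limit_le_logIntegral_add (g := g) (u := u) (G := G) (F := F) hp hκ hb hτ hβ hg hu hG hG0 huG hGE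
      hGE1 hF
  set a := (κ + 1) * (p - 1) with ha
  have ha1 : p - 1 < a := by rw [ha]; nlinarith
  set q := (b + κ) * p / κ with hq
  set x := (b + κ) / κ with hx
  set θ := (b + κ) * (p - 1) - 1 with hθ
  set S := ENNReal.ofReal (blissConst p κ b) with hS
  set F := profileSup p a θ q τ β with hF
  have hq0 : 0 < q := by rw [hq]; positivity
  have hx1 : 1 < x := by rw [hx, lt_div_iff₀ hκ]; linarith
  have hqx : q / p = x := by rw [hq, hx]; field_simp
  have hscale := fun g hg hg0 hE =>
    logIntegral_le_energy_rpow_mul (θ := θ) (β := β) (g := g) hp ha1 hq0 hτ hg hg0 hE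
  rw [hqx] at hscale
  have hpow : ∀ t : ℝ≥0∞, t ≤ 1 → t ^ x ≤ t := fun t ht => by
    simpa using ENNReal.rpow_le_rpow_of_exponent_ge ht hx1.le
  have hSF : S < F := by
    refine hg₀S.trans_le ((hscale g₀ hg₀ hg₀0 hg₀E).trans ?_)
    exact (mul_le_mul_left ((hpow _ hg₀E).trans hg₀E) F).trans_eq (one_mul F)
  -- A maximizing sequence exists: the set of profiles is nonempty, since the supremum is positive
  set A : Set ℝ≥0∞ := {y | ∃ g, IsProfile p a g ∧ logIntegral θ q τ β g = y} with hA
  have hAF : sSup A = F := by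
    refine le_antisymm (sSup_le ?_) (iSup₂_le fun g hg => le_sSup ⟨g, hg, rfl⟩)
    rintro _ ⟨g, hg, rfl⟩
    exact hg.logIntegral_le
  have hAne : A.Nonempty := by
    rw [nonempty_iff_ne_empty]
    intro h
    rw [h, sSup_empty] at hAF
    exact absurd hSF (by rw [← hAF]; simp)
  obtain ⟨y, -, hy, hyA⟩ := exists_seq_tendsto_sSup hAne (OrderTop.bddAbove A)
  rw [hAF] at hy
  choose g hg hgy using hyA
  obtain ⟨φ, hφ, u, hu⟩ := exists_subseq_tendsto_tail hp ha1 (fun n => (hg n).measurable)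
    (fun n => (hg n).nonneg) (fun n => (hg n).energy.le)
  obtain ⟨G, hG, hG0, huG, hGE⟩ := exists_limit_profile hp ha1 (fun n => (hg (φ n)).measurable)
    (fun n => (hg (φ n)).nonneg) (fun n => (hg (φ n)).energy.le) hu
  have hGE1 : energyOn p a G (Ioo 0 1) ≤ 1 :=
    (hGE 0 le_rfl).trans ((liminf_le_liminf (.of_forall fun n => (hg (φ n)).energy.le)).trans_eq
      (liminf_const _))
  have hmain := hlimit (fun n => g (φ n)) (fun n => hg (φ n)) u G hu hG hG0 huG hGE hGE1 F
    (by simp only [hgy]; exact hy.comp hφ.tendsto_atTop)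
  have hGF := hscale G hG hG0 hGE1
  set E := energyOn p a G (Ioo 0 1) with hE
  have hE1 : E = 1 := by
    by_contra hne
    have hlt : E < 1 := lt_of_le_of_ne hGE1 hne
    have h0 : 1 - E ≠ 0 := (tsub_pos_of_lt hlt).ne'
    have h1 : 1 - E ≠ ∞ := ENNReal.sub_ne_top ENNReal.one_ne_top
    -- both powers are at most their base, since `x > 1`
    have h2 : F ≤ S * (1 - E) + E * F := by
      refine hmain.trans (add_le_add ?_ (hGF.trans ?_))
      · gcongr; exact hpow _ tsub_le_self
      · gcongr; exact hpow _ hGE1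
    have h3 : S * (1 - E) < F * (1 - E) := (ENNReal.mul_lt_mul_iff_left h0 h1).2 hSF
    have h4 : S * (1 - E) + E * F < F * (1 - E) + E * F :=
      ENNReal.add_lt_add_right (ENNReal.mul_ne_top (hGE1.trans_lt ENNReal.one_lt_top).ne hFtop.ne) h3
    rw [mul_comm E F, ← mul_add, tsub_add_cancel_of_le hGE1, mul_one, mul_comm F E] at h4
    exact absurd (h2.trans_lt h4) (lt_irrefl _)
  have hprof : IsProfile p a G := ⟨hG, hG0, hE1⟩
  refine ⟨G, hprof, le_antisymm hprof.logIntegral_le ?_⟩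
  rw [hE1, tsub_self, ENNReal.zero_rpow_of_pos (by linarith), mul_zero, zero_add] at hmain
  exact hmain

end Limit

/-! ### Transfer to the Sobolev space -/

section Transfer

variable {p α₀ a : ℝ}

/-- Replacing the derivative of an element of the unit sphere by its absolute value gives a profile
and does not decrease the functional. -/
lemma SpaceX.exists_isProfile_logFunctional_le {θ τ β : ℝ} (hp : 1 < p) (ha : p - 1 < a)
    (hq : 0 ≤ critExp p a θ) (hτ : 1 ≤ τ) (u : SpaceX p α₀ a) (hu : u.gradNorm = 1) :
    ∃ g, IsProfile p a g ∧ logFunctional θ τ β u ≤ logIntegral θ (critExp p a θ) τ β g := by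
  have hp0 : 0 < p := by linarith
  have hm := ((memLp_weightMeasure_iff hp0).1 u.memLp_grad).1
  have hen := (u.gradNorm_eq_one_iff hp0).1 hu
  have hae := hm.ae_eq_mk
  set g : ℝ → ℝ := fun s => |hm.mk u.grad s| with hg
  have hgE : energyOn p a g (Ioo 0 1) = 1 := by
    rw [← hen]
    refine energyOn_congr_ae ?_
    filter_upwards [hae] with r hr
    rw [hg, abs_abs, hr]
  refine ⟨g, ⟨hm.measurable_mk.norm, fun s => abs_nonneg _, hgE⟩, ?_⟩
  refine lintegral_mono_ae ?_
  filter_upwards [u.ae_fn_eq hp ha, ae_restrict_mem measurableSet_Ioo] with r hr hr01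
  have hle : |u.fn r| ≤ tail g r := by
    rw [hr, abs_neg]
    refine abs_integral_le_integral_abs.trans (le_of_eq ?_)
    refine integral_congr_ae ?_
    filter_upwards [ae_restrict_of_ae_restrict_of_subset (Ioo_subset_Ioo_left hr01.1.le) hae]
      with s hs
    rw [hg, hs]
  refine ENNReal.ofReal_le_ofReal ?_
  rw [mul_assoc, mul_assoc]
  exact mul_le_mul_of_nonneg_left (log_weight_mono hτ (abs_nonneg _) hle
    (Real.rpow_nonneg hr01.1.le _) hq) (Real.rpow_nonneg hr01.1.le _)

/-- The primitive of a profile is an element of the unit sphere. -/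
lemma IsProfile.exists_spaceX {θ τ β : ℝ} (hp : 1 < p) (ha : p - 1 < a) (hα₀ : a - p ≤ α₀)
    {g : ℝ → ℝ} (hg : IsProfile p a g) :
    ∃ u : SpaceX p α₀ a, u.gradNorm = 1 ∧
      logFunctional θ τ β u = logIntegral θ (critExp p a θ) τ β g := by
  have hp0 : 0 < p := by linarith
  have hcore := isCoreX_tail hp ha hα₀ hg.measurable.aemeasurable
    (hg.energy.trans_lt ENNReal.one_lt_top)
  refine ⟨SpaceX.ofCore hp0 hcore, ?_, ?_⟩
  · rw [SpaceX.gradNorm_eq_one_iff hp0, ← hg.energy]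
    refine energyOn_congr_ae ?_
    filter_upwards [ae_hasDerivAt_tail (integrableOn_tail hp ha hg.measurable hg.energy.le)]
      with r hr
    change |deriv (tail g) r| = |g r|
    rw [hr.deriv, abs_neg]
  · refine lintegral_congr fun r => ?_
    change ENNReal.ofReal (r ^ θ * |tail g r| ^ critExp p a θ *
      |Real.log (τ + |tail g r|)| ^ (r ^ β)) = _
    rw [abs_of_nonneg (tail_nonneg hg.nonneg r)]

lemma logSup_eq_profileSup {θ τ β : ℝ} (hp : 1 < p) (ha : p - 1 < a) (hα₀ : a - p ≤ α₀)
    (hq : 0 ≤ critExp p a θ) (hτ : 1 ≤ τ) :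
    logSup p α₀ a θ τ β = profileSup p a θ (critExp p a θ) τ β := by
  refine le_antisymm (iSup₂_le fun u hu => ?_) (iSup₂_le fun g hg => ?_)
  · obtain ⟨g, hg, hle⟩ := u.exists_isProfile_logFunctional_le (β := β) hp ha hq hτ hu
    exact hle.trans hg.logIntegral_le
  · obtain ⟨u, hu, heq⟩ := hg.exists_spaceX (θ := θ) (τ := τ) (β := β) hp ha hα₀
    rw [← heq]
    exact le_iSup₂ (f := fun (u : SpaceX p α₀ a) (_ : u.gradNorm = 1) => logFunctional θ τ β u) u hu

end Transfer

end

theorem theorem1p4 (p α₀ α₁ θ τ β : ℝ) (hp : 1 < p) (hα₁ : 0 < α₁ - p + 1)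
    (hα₀ : α₁ - p ≤ α₀) (hθ : α₁ - p < θ) (hτ : 1 ≤ τ) (hβ : 0 < β)
    (hβ' : β < min ((θ + 1) / p) ((α₁ - p + 1) / (p - 1))) :
    logSup p α₀ α₁ θ τ β < ∞ ∧
      ∃ u : SpaceX p α₀ α₁, u.gradNorm = 1 ∧
        logFunctional θ τ β u = logSup p α₀ α₁ θ τ β := by
  have hp1 : 0 < p - 1 := by linarith
  have hp0 : 0 < p := by linarith
  have ha : p - 1 < α₁ := by linarith
  set κ := (α₁ - p + 1) / (p - 1) with hκdef
  set b := (θ - α₁ + p) / (p - 1) with hbdef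
  have hκ : 0 < κ := div_pos hα₁ hp1
  have hb : 0 < b := div_pos (by linarith) hp1
  have e1 : (κ + 1) * (p - 1) = α₁ := by rw [hκdef]; field_simp; ring
  have e2 : (b + κ) * (p - 1) = θ + 1 := by rw [hκdef, hbdef]; field_simp; ring
  have e3 : (b + κ) * p / κ = critExp p α₁ θ := by
    rw [critExp, ← e2, hκdef]; field_simp
  have hβκ := hβ'.trans_le (min_le_right _ _)
  have hβb := hβ'.trans_le (min_le_left _ _)
  have hq : 0 ≤ critExp p α₁ θ := by rw [← e3]; positivity
  have hfin := profileSup_lt_top hp hκ hb hτ hβ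
  obtain ⟨G, hG, hGF⟩ := exists_logIntegral_eq_profileSup hp hκ hb hτ hβ hβκ (by rwa [e2])
  rw [e1, e2, e3, add_sub_cancel_right] at hfin hGF
  rw [e1] at hG
  rw [logSup_eq_profileSup hp ha hα₀ hq hτ]
  obtain ⟨u, hu, heq⟩ := hG.exists_spaceX (α₀ := α₀) (θ := θ) (τ := τ) (β := β) hp ha hα₀
  exact ⟨hfin, u, hu, heq.trans hGF⟩
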